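/- Let $p \ge q \ge 2$ be integers, $[n] := \{1,\dots,n\}$. Order the positions of a $p\times q$ matrix row by row, each row from left to right, and order the $0/1$-matrices lexicographically: $A \prec B$ if $A \neq B$ and $A$ has the smaller entry at the first position where they differ. The partitioning orbitope $O^{=}_{p,q}$ for the symmetric group $\mathfrak{S}_q$ is the convex hull of all $p \times q$ $0/1$-matrices that have exactly one $1$-entry in every row and are $\prec$-maximal among all matrices obtained from them by permuting columns. All its elements satisfy $x_{ij}=0$ for $i<j$, so it is regarded as a subset of $\mathbb{R}^{\mathcal{I}_{p,q}}$, where $\mathcal{I}_{p,q} := \{(i,j)\in[p]\times[q] : i \ge j\}$. Write $x(T) := \sum_{(i,j)\in T} x_{ij}$ for $T \subseteq \mathcal{I}_{p,q}$, $\mathrm{row}_i := \{(i,1),\dots,(i,\min\{i,q\})\}$, and $\langle \eta, j\rangle := (j+\eta-1, j)$. **Theorem.** $O^{=}_{p,q}$ equals the set of all $x \in \mathbb{R}^{\mathcal{I}_{p,q}}$ that satisfy the following linear constraints: 1. the row-sum equations $x(\mathrm{row}_i) = 1$ for all $i \in [p]$; 2. the nonnegativity constraints $x_{ij} \ge 0$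 for all $(i,j) \in \mathcal{I}_{p,q} \setminus \{(j,j) : j<q\}$; 3. the shifted column inequalities $x(B) - x(S) \le 0$ for all bars $B = \{(i,j),(i,j+1),\dots,(i,\min\{i,q\})\}$ with $(i,j) = \langle \eta, j\rangle \in \mathcal{I}_{p,q}$, $j \ge 2$, and all sets $S = \{\langle 1,c_1\rangle, \langle 2,c_2\rangle, \dots, \langle \eta, c_\eta\rangle\}$ with $2 \le c_1 = c_2 \le c_3 \le \dots \le c_\eta \le j-1$, where for $\eta = 1$ the condition is $2 \le c_1$ and $j = c_1+1$. This system is non-redundant: omitting any one of its equations or inequalities strictly enlarges the solution set. Moreover, every inequality of the system defines a facet of $O^{=}_{p,q}$. The corresponding separation problem can be solved in time $O(pq)$: there are a constant $C$ and a single program for a random access machine (with natural-number and rational registers and arrays, indirect addressing, and unit-cost addition, subtraction and comparison) such that, for all $p \ge q \ge 2$ and every $x^\star \in \mathbb{Q}^{\mathcal{I}_{p,q}}$, the program, on input $(p,q,x^\star)$, halts after at most $C\,pq$ steps and either reports correctly that $x^\star$ satisfies all constraints of the system, or returns a constraint of the system that is violated by $x^\star$ (for a shifted column inequality in the form $j,\eta,c_1,\dots,c_\eta$).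 -/

import Mathlib

open scoped BigOperators

noncomputable section

namespace Orbitope

/-! ### Orbitopes -/

/-- The set `[n] = {1, …, n}`, used as an index type. -/
abbrev Ints (n : ℕ) : Type := ↥(Finset.Icc 1 n)

/-- `A ≺ B`: the matrices differ, and at the first position where they differ (positions are
ordered row by row, each row from left to right) the entry of `A` is the smaller one. -/
def LexLT {p q : ℕ} (A B : Matrix (Ints p) (Ints q) ℝ) : Prop :=
  ∃ k l, A k l < B k l ∧ ∀ k' l', (k' < k ∨ (k' = k ∧ l' < l)) → A k' l' = B k' l'

/-- The 0/1-matrices of size `p × q`. -/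
def zeroOneMat (p q : ℕ) : Set (Matrix (Ints p) (Ints q) ℝ) :=
  {A | ∀ i j, A i j = 0 ∨ A i j = 1}

/-- The 0/1-matrices that are `≺`-maximal in their orbit under the group `G` permuting columns. -/
def matMax (p q : ℕ) (G : Subgroup (Equiv.Perm (Ints q))) : Set (Matrix (Ints p) (Ints q) ℝ) :=
  {A | A ∈ zeroOneMat p q ∧ ∀ σ ∈ G, ¬ LexLT A (fun i j => A i (σ j))}

/-- The 0/1-matrices with exactly one 1-entry in every row. -/
def matPart (p q : ℕ) : Set (Matrix (Ints p) (Ints q) ℝ) :=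
  {A | A ∈ zeroOneMat p q ∧ ∀ i, ∑ j, A i j = 1}

/-- The partitioning orbitope associated with `G`, as a polytope in the space of `p × q`
matrices. -/
def orbipart (p q : ℕ) (G : Subgroup (Equiv.Perm (Ints q))) :
    Set (Matrix (Ints p) (Ints q) ℝ) :=
  convexHull ℝ (matMax p q G ∩ matPart p q)

/-- The lower triangular positions `{(i, j) ∈ [p] × [q] : i ≥ j}`. -/
def triInds (p q : ℕ) : Finset (ℕ × ℕ) :=
  (Finset.Icc 1 p ×ˢ Finset.Icc 1 q).filter (fun ij => ij.2 ≤ ij.1)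

theorem fst_mem {p q : ℕ} (ij : triInds p q) : ij.1.1 ∈ Finset.Icc 1 p :=
  (Finset.mem_product.1 (Finset.mem_filter.1 ij.2).1).1

theorem snd_mem {p q : ℕ} (ij : triInds p q) : ij.1.2 ∈ Finset.Icc 1 q :=
  (Finset.mem_product.1 (Finset.mem_filter.1 ij.2).1).2

/-- Dropping the coordinates of a matrix strictly above the diagonal. -/
def restrictTri {p q : ℕ} (A : Matrix (Ints p) (Ints q) ℝ) : triInds p q → ℝ :=
  fun ij => A ⟨ij.1.1, fst_mem ij⟩ ⟨ij.1.2, snd_mem ij⟩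

/-- The partitioning orbitope for the symmetric group on `[q]`, in the lower triangular
coordinates. -/
def orbipartTri (p q : ℕ) : Set (triInds p q → ℝ) :=
  restrictTri '' orbipart p q ⊤

/-! ### The linear system -/

/-- The coordinate `x_ij` (by convention `0` if `(i, j)` is not a lower triangular position). -/
def entry {p q : ℕ} (x : triInds p q → ℝ) (ij : ℕ × ℕ) : ℝ :=
  if h : ij ∈ triInds p q then x ⟨ij, h⟩ else 0

/-- `x(T) = ∑_{(i, j) ∈ T} x_ij`. -/
def sumOver {p q : ℕ} (x : triInds p q → ℝ) (T : Finset (ℕ × ℕ)) : ℝ :=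
  ∑ ij ∈ T, entry x ij

/-- `row_i = {(i, 1), …, (i, min {i, q})}`. -/
def row (q i : ℕ) : Finset (ℕ × ℕ) :=
  {i} ×ˢ Finset.Icc 1 (min i q)

/-- The position `⟨η, j⟩ = (j + η - 1, j)` in diagonal coordinates (`η ≥ 1`). -/
def diag (η j : ℕ) : ℕ × ℕ :=
  (j + η - 1, j)

/-- The bar `{(i, j), (i, j + 1), …, (i, min {i, q})}` with leader `(i, j)`. -/
def bar (q : ℕ) (ij : ℕ × ℕ) : Finset (ℕ × ℕ) :=
  {ij.1} ×ˢ Finset.Icc ij.2 (min ij.1 q)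

/-- For `cs = [c_1, …, c_η]`, the set `{⟨1, c_1⟩, ⟨2, c_2⟩, …, ⟨η, c_η⟩}`. -/
def shiftedCol (cs : List ℕ) : Finset (ℕ × ℕ) :=
  Finset.univ.image (fun k : Fin cs.length => diag (k + 1) (cs.get k))

/-- Names of linear constraints:
* `row i` is the row-sum equation `x(row_i) = 1`;
* `nonneg i j` is the nonnegativity constraint `x_ij ≥ 0`;
* `sci j cs`, for `cs = [c_1, …, c_η]`, is the inequality `x(B) - x(S) ≤ 0`, where `B` is the bar with
  leader `⟨η, j⟩` and `S = {⟨1, c_1⟩, …, ⟨η, c_η⟩}`. -/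
inductive Constraint : Type
  | row (i : ℕ)
  | nonneg (i j : ℕ)
  | sci (j : ℕ) (cs : List ℕ)

/-- The point `x` satisfies the constraint. -/
def Constraint.Holds {p q : ℕ} (x : triInds p q → ℝ) : Constraint → Prop
  | .row i => sumOver x (Orbitope.row q i) = 1
  | .nonneg i j => 0 ≤ entry x (i, j)
  | .sci j cs => sumOver x (bar q (diag cs.length j)) - sumOver x (shiftedCol cs) ≤ 0

/-- The point `x` satisfies the constraint with equality. -/
def Constraint.Tight {p q : ℕ} (x : triInds p q → ℝ) : Constraint → Prop
  | .row i => sumOver x (Orbitope.row q i) = 1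
  | .nonneg i j => entry x (i, j) = 0
  | .sci j cs => sumOver x (bar q (diag cs.length j)) - sumOver x (shiftedCol cs) = 0

/-- The constraint is an inequality (not an equation). -/
def Constraint.IsIneq : Constraint → Prop
  | .row _ => False
  | .nonneg _ _ => True
  | .sci _ _ => True

/-- The constraints of the system for the parameters `p`, `q`:
* all row-sum equations, `i ∈ [p]`;
* the nonnegativity constraints for all positions except `(j, j)` with `j < q`;
* the shifted column inequalities with leader `⟨η, j⟩` (a lower triangular position, `j ≥ 2`) and
  `2 ≤ c_1 = c_2 ≤ … ≤ c_η ≤ j - 1`; if `η = 1`, then `2 ≤ c_1` and `j = c_1 + 1`. -/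
def Constraint.Listed (p q : ℕ) : Constraint → Prop
  | .row i => i ∈ Finset.Icc 1 p
  | .nonneg i j => (i, j) ∈ triInds p q ∧ ¬ (i = j ∧ j < q)
  | .sci j cs =>
      1 ≤ cs.length ∧ 2 ≤ j ∧ diag cs.length j ∈ triInds p q ∧
      cs.Pairwise (· ≤ ·) ∧ (∀ a ∈ cs, 2 ≤ a ∧ a ≤ j - 1) ∧
      (∀ h : 2 ≤ cs.length, cs[0] = cs[1]) ∧
      (∀ h : cs.length = 1, j = cs[0] + 1)

/-- The solution set of the subsystem consisting of the constraints in `L`. -/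
def solutionSet (p q : ℕ) (L : Set Constraint) : Set (triInds p q → ℝ) :=
  {x | ∀ l ∈ L, l.Holds x}

/-- The whole system. -/
def system (p q : ℕ) : Set Constraint :=
  {l | l.Listed p q}

/-- The inequality `l` defines a facet of the polytope `P`: it is valid for `P`, and the face of `P`
that it defines is non-empty and of dimension `dim P - 1`. -/
def DefinesFacet {p q : ℕ} (P : Set (triInds p q → ℝ)) (l : Constraint) : Prop :=
  (∀ x ∈ P, l.Holds x) ∧
  {x | x ∈ P ∧ l.Tight x}.Nonempty ∧
  Module.finrank ℝ (vectorSpan ℝ {x | x ∈ P ∧ l.Tight x}) + 1 =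
    Module.finrank ℝ (vectorSpan ℝ P)

/-! ### A random access machine with unit-cost additive arithmetic

A program uses finitely many registers and arrays, which hold either natural numbers or rational
numbers. Array cells are addressed through natural number registers. The only arithmetic operations
are addition and subtraction. Every instruction and every evaluation of a test is one step. -/

/-- Contents of the registers (`nreg`, `qreg`: register number) and of the arrays
(`nmem`, `qmem`: array number, address). -/
structure Ram : Type where
  nreg : ℕ → ℕ
  qreg : ℕ → ℚ
  nmem : ℕ → ℕ → ℕ
  qmem : ℕ → ℕ → ℚ

/-- Elementary instructions. The arguments are numbers of registers and arrays, apart from the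
constants `k` and `r`; `arr` is the number of an array and `i` that of a natural number register
which holds an address. -/
inductive Instr : Type
  | nconst (a k : ℕ)
  | nadd (a b c : ℕ)
  | nsub (a b c : ℕ)
  | nload (a arr i : ℕ)
  | nstore (arr i a : ℕ)
  | qconst (a : ℕ) (r : ℚ)
  | qadd (a b c : ℕ)
  | qsub (a b c : ℕ)
  | qload (a arr i : ℕ)
  | qstore (arr i a : ℕ)

/-- Effect of an elementary instruction (`nsub` is truncated subtraction). -/
def Instr.eval (s : Ram) : Instr → Ram
  | nconst a k => { s with nreg := Function.update s.nreg a k }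
  | nadd a b c => { s with nreg := Function.update s.nreg a (s.nreg b + s.nreg c) }
  | nsub a b c => { s with nreg := Function.update s.nreg a (s.nreg b - s.nreg c) }
  | nload a arr i => { s with nreg := Function.update s.nreg a (s.nmem arr (s.nreg i)) }
  | nstore arr i a =>
    let cells := Function.update (s.nmem arr) (s.nreg i) (s.nreg a)
    { s with nmem := Function.update s.nmem arr cells }
  | qconst a r => { s with qreg := Function.update s.qreg a r }
  | qadd a b c => { s with qreg := Function.update s.qreg a (s.qreg b + s.qreg c) }
  | qsub a b c => { s with qreg := Function.update s.qreg a (s.qreg b - s.qreg c) }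
  | qload a arr i => { s with qreg := Function.update s.qreg a (s.qmem arr (s.nreg i)) }
  | qstore arr i a =>
    let cells := Function.update (s.qmem arr) (s.nreg i) (s.qreg a)
    { s with qmem := Function.update s.qmem arr cells }

/-- Comparisons of the contents of two registers. -/
inductive Test : Type
  | nle (a b : ℕ)
  | nlt (a b : ℕ)
  | qle (a b : ℕ)
  | qlt (a b : ℕ)

/-- The outcome of a comparison. -/
def Test.IsTrue (s : Ram) : Test → Prop
  | nle a b => s.nreg a ≤ s.nreg b
  | nlt a b => s.nreg a < s.nreg b
  | qle a b => s.qreg a ≤ s.qreg b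
  | qlt a b => s.qreg a < s.qreg b

/-- Programs. -/
inductive Prog : Type
  | instr (c : Instr)
  | seq (P Q : Prog)
  | ite (b : Test) (P Q : Prog)
  | loop (b : Test) (P : Prog)

/-- `Exec P s t s'`: started in state `s`, the program `P` halts after exactly `t` steps in
state `s'`. Here `loop b P` repeats `P` as long as `b` is true. -/
inductive Exec : Prog → Ram → ℕ → Ram → Prop
  | instr (c : Instr) (s : Ram) : Exec (.instr c) s 1 (c.eval s)
  | seq {P Q : Prog} {s₁ s₂ s₃ : Ram} {t₁ t₂ : ℕ} :
      Exec P s₁ t₁ s₂ → Exec Q s₂ t₂ s₃ → Exec (.seq P Q) s₁ (t₁ + t₂) s₃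
  | ite_true {b : Test} {P Q : Prog} {s s' : Ram} {t : ℕ} :
      b.IsTrue s → Exec P s t s' → Exec (.ite b P Q) s (t + 1) s'
  | ite_false {b : Test} {P Q : Prog} {s s' : Ram} {t : ℕ} :
      ¬ b.IsTrue s → Exec Q s t s' → Exec (.ite b P Q) s (t + 1) s'
  | loop_true {b : Test} {P : Prog} {s₁ s₂ s₃ : Ram} {t₁ t₂ : ℕ} :
      b.IsTrue s₁ → Exec P s₁ t₁ s₂ → Exec (.loop b P) s₂ t₂ s₃ →
      Exec (.loop b P) s₁ (t₁ + t₂ + 1) s₃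
  | loop_false {b : Test} {P : Prog} {s : Ram} :
      ¬ b.IsTrue s → Exec (.loop b P) s 1 s

/-- A program has at most one run from a given state. -/
theorem Exec.unique {P : Prog} {s s₁ s₂ : Ram} {t₁ t₂ : ℕ}
    (h₁ : Exec P s t₁ s₁) (h₂ : Exec P s t₂ s₂) : t₁ = t₂ ∧ s₁ = s₂ := by
  induction h₁ generalizing t₂ s₂ with
  | instr c s => cases h₂; exact ⟨rfl, rfl⟩
  | seq _ _ ih₁ ih₂ =>
    cases h₂ with
    | seq a b =>
      obtain ⟨rfl, rfl⟩ := ih₁ a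
      obtain ⟨rfl, rfl⟩ := ih₂ b
      exact ⟨rfl, rfl⟩
  | ite_true hb _ ih =>
    cases h₂ with
    | ite_true _ a => obtain ⟨rfl, rfl⟩ := ih a; exact ⟨rfl, rfl⟩
    | ite_false hb' _ => exact absurd hb hb'
  | ite_false hb _ ih =>
    cases h₂ with
    | ite_true hb' _ => exact absurd hb' hb
    | ite_false _ a => obtain ⟨rfl, rfl⟩ := ih a; exact ⟨rfl, rfl⟩
  | loop_true hb _ _ ih₁ ih₂ =>
    cases h₂ with
    | loop_true _ a b =>
      obtain ⟨rfl, rfl⟩ := ih₁ a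
      obtain ⟨rfl, rfl⟩ := ih₂ b
      exact ⟨rfl, rfl⟩
    | loop_false hb' => exact absurd hb hb'
  | loop_false hb =>
    cases h₂ with
    | loop_true hb' _ _ => exact absurd hb' hb
    | loop_false _ => exact ⟨rfl, rfl⟩

/-- The initial state for the input `(p, q, x)`: the natural number registers `0` and `1` hold `p`
and `q`, the cell `(i - 1) q + (j - 1)` of the rational array `0` holds `x_ij` for every lower
triangular position `(i, j)` (row-major order), and everything else is `0`. -/
def inputState (p q : ℕ) (x : triInds p q → ℚ) : Ram where
  nreg := fun a => if a = 0 then p else if a = 1 then q else 0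
  qreg := fun _ => 0
  nmem := fun _ _ => 0
  qmem := fun arr n =>
    if arr = 0 then
      (if h : (n / q + 1, n % q + 1) ∈ triInds p q then x ⟨(n / q + 1, n % q + 1), h⟩ else 0)
    else 0

/-- The answer given by a final state. If register `0` holds `0`, the answer is that there is no
violated constraint. Otherwise a constraint is returned: its kind is held by register `0`, its
parameters by registers `1` and `2`; in the case of a shifted column inequality, register `1` holds
`j`, register `2` holds `η`, and `c_1, …, c_η` are the first `η` cells of the array `0`. -/
def Ram.answer (s : Ram) : Option Constraint :=
  if s.nreg 0 = 0 then none
  else if s.nreg 0 = 1 then some (.row (s.nreg 1))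
  else if s.nreg 0 = 2 then some (.nonneg (s.nreg 1) (s.nreg 2))
  else some (.sci (s.nreg 1) ((List.range (s.nreg 2)).map (s.nmem 0)))

/-- A correct answer to the separation problem for the point `x`: either there is no violated
constraint in the system and the answer says so, or the answer is a constraint of the system that
is violated by `x`. -/
def CorrectAnswer (p q : ℕ) (x : triInds p q → ℝ) : Option Constraint → Prop
  | none => x ∈ solutionSet p q (system p q)
  | some l => l ∈ system p q ∧ ¬ l.Holds x

/-- The program `P` solves the separation problem for the systems of all parameters `p ≥ q ≥ 2`
within at most `C * (p * q)` steps. -/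
def SolvesSeparation (P : Prog) (C : ℕ) : Prop :=
  ∀ p q : ℕ, 2 ≤ q → q ≤ p → ∀ x : triInds p q → ℚ,
    ∃ (t : ℕ) (s : Ram), Exec P (inputState p q x) t s ∧ t ≤ C * (p * q) ∧
      CorrectAnswer p q (fun ij => (x ij : ℝ)) s.answer

end Orbitope

end

/-!
A 0/1-matrix with one 1-entry per row is maximal under column permutations if and only if no column
is used before all columns to its left have been used (`matMax_inter_matPart`). So the vertices of
the orbitope are the restricted growth functions `f : [p] → [q]`, whose values exceed the running
maximum of the preceding values by at most one.

*Validity.* If such a function missed every position of a shifted column, its running maximum would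
stay behind the shifted column, so that it could not meet the bar (`IsGrowth.exists_hit`).

*Completeness.* A random restricted growth function whose matrix has expectation `X` is governed by
the numbers `F i j`, the probability that the running maximum on the first `i` rows is at least `j`.
The largest candidate is `F i j = min (F (i - 1) (j - 1)) (F (i - 1) j + X i j)` (`stateProb`), and
unrolling the recursion shows that `F i j` is `1` or the value of a shifted column
(`exists_path_le_stateProb`). Thus the shifted column inequalities say precisely that the bar with
leader `(i, j)` is at most `F i j`. Instead of constructing the random function, one shows that no
linear functional is larger at `X` than at all vertices: the best vertex is found by dynamic
programming over the running maximum (`tailValue`), and summation by parts bounds the value at `X`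
along the distributions `F` (`reward_step`, `reward_le_tailValue`). Separation of a point from a
compact convex set finishes the argument (`solutionSet_subset`).

*Irredundancy and facets.* Explicit weights on the diagonals give a point at which all inequalities
are strict (`exists_interior_point`) and, for every constraint, a point that violates only this one
(`irredundant_of_listed`). For a shifted column inequality the weights make its shifted column the
unique lightest one, and the leader of its bar is then raised until the inequality fails. On the
segment between the two points there is one at which a given inequality is tight and all others are
strict, so that the face of this inequality has codimension one (`definesFacet_of_listed`).

*Separation.* A recursion like the one for `F` computes the lightest shifted column for every bar
(`lightest`). The program `separationProg` tabulates it in a single pass over the positions, checks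
every constraint on the way, and finally reconstructs a lightest shifted column from the table.
-/

namespace Orbitope

/-! ### Coordinates and constraints in terms of column sequences -/

theorem mem_triInds {p q i j : ℕ} :
    (i, j) ∈ triInds p q ↔ 1 ≤ i ∧ i ≤ p ∧ 1 ≤ j ∧ j ≤ q ∧ j ≤ i := by
  simp only [triInds, Finset.mem_filter, Finset.mem_product, Finset.mem_Icc]
  tauto

theorem entry_of_mem {p q : ℕ} (x : triInds p q → ℝ) {ij : ℕ × ℕ} (h : ij ∈ triInds p q) :
    entry x ij = x ⟨ij, h⟩ := dif_pos h

theorem entry_of_notMem {p q : ℕ} (x : triInds p q → ℝ) {ij : ℕ × ℕ} (h : ij ∉ triInds p q) :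
    entry x ij = 0 := dif_neg h

theorem sumOver_singleton_product {p q : ℕ} (x : triInds p q → ℝ) (i : ℕ) (s : Finset ℕ) :
    sumOver x ({i} ×ˢ s) = ∑ j ∈ s, entry x (i, j) := by
  rw [sumOver, Finset.sum_product, Finset.sum_singleton]

theorem sumOver_row {p q : ℕ} (x : triInds p q → ℝ) (i : ℕ) :
    sumOver x (row q i) = ∑ j ∈ Finset.Icc 1 (min i q), entry x (i, j) :=
  sumOver_singleton_product x i _

theorem sumOver_bar {p q : ℕ} (x : triInds p q → ℝ) (η j : ℕ) :
    sumOver x (bar q (diag η j)) =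
      ∑ m ∈ Finset.Icc j (min (j + η - 1) q), entry x (j + η - 1, m) :=
  sumOver_singleton_product x (j + η - 1) _

/-- The conditions on the columns `c_1 = γ 0, …, c_η = γ (η - 1)` of a shifted column inequality
whose bar starts in column `c + 1`. Indices are shifted by one: the `k`-th position of the shifted
column is `(γ k + k, γ k)`, for `k < η`. -/
structure IsPath (η c : ℕ) (γ : ℕ → ℕ) : Prop where
  two_le : ∀ k, k < η → 2 ≤ γ k
  le_max : ∀ k, k < η → γ k ≤ c
  mono_succ : ∀ k, k + 1 < η → γ k ≤ γ (k + 1)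
  start_eq : 2 ≤ η → γ 0 = γ 1
  start_one : η = 1 → γ 0 = c

theorem IsPath.mono {η c : ℕ} {γ : ℕ → ℕ} (h : IsPath η c γ) {k l : ℕ} (hkl : k ≤ l)
    (hl : l < η) : γ k ≤ γ l := by
  induction l, hkl using Nat.le_induction with
  | base => rfl
  | succ l _ ih => exact (ih (by omega)).trans (h.mono_succ l hl)

theorem exists_eq_map_range (cs : List ℕ) : ∃ γ : ℕ → ℕ, cs = (List.range cs.length).map γ :=
  ⟨fun k => cs.getD k 0, List.ext_getElem (by simp) fun k h₁ h₂ => by simp [h₁]⟩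

theorem sumOver_shiftedCol {p q : ℕ} (x : triInds p q → ℝ) (η : ℕ) (γ : ℕ → ℕ) :
    sumOver x (shiftedCol ((List.range η).map γ)) =
      ∑ k ∈ Finset.range η, entry x (γ k + k, γ k) := by
  have e : shiftedCol ((List.range η).map γ) =
      (Finset.range η).image (fun k => (γ k + k, γ k)) := by
    ext ⟨a, b⟩
    simp only [shiftedCol, diag, Finset.mem_image, Finset.mem_univ, true_and, Finset.mem_range]
    constructor
    · rintro ⟨⟨k, hk⟩, e⟩
      have hk' : k < η := by simpa using hk
      refine ⟨k, hk', ?_⟩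
      rw [← e]
      simp
    · rintro ⟨k, hk, e⟩
      refine ⟨⟨k, by simpa using hk⟩, ?_⟩
      rw [← e]
      simp
  rw [sumOver, e, Finset.sum_image]
  intro k hk l hl e
  simp only [Finset.coe_range, Set.mem_Iio] at hk hl
  simp only [Prod.mk.injEq] at e
  omega

theorem listed_sci {p q j η : ℕ} {γ : ℕ → ℕ} :
    (Constraint.sci j ((List.range η).map γ)).Listed p q ↔
      1 ≤ η ∧ 3 ≤ j ∧ j ≤ q ∧ j + η - 1 ≤ p ∧ IsPath η (j - 1) γ := by
  simp only [Constraint.Listed, diag, mem_triInds, List.length_map, List.length_range,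
    List.mem_map, List.mem_range, forall_exists_index, and_imp, forall_apply_eq_imp_iff₂,
    List.getElem_map, List.getElem_range]
  rw [List.pairwise_map]
  constructor
  · rintro ⟨h1, h2, h3, h4, h5, h6, h7⟩
    have := h5 0 (by omega)
    refine ⟨h1, by omega, by omega, by omega, fun k hk => (h5 k hk).1, fun k hk => (h5 k hk).2,
      fun k hk => ?_, h6, fun h => ?_⟩
    · rw [List.pairwise_iff_getElem] at h4
      have := h4 k (k + 1) (by rw [List.length_range]; omega) (by rw [List.length_range]; omega)
        (by omega)
      rwa [List.getElem_range, List.getElem_range] at this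
    · have := h7 h; omega
  · rintro ⟨h1, h2, h3, h4, h5⟩
    refine ⟨h1, by omega, by omega, ?_, fun k hk => ⟨h5.two_le k hk, h5.le_max k hk⟩,
      h5.start_eq, fun h => ?_⟩
    · rw [List.pairwise_iff_getElem]
      intro a b ha hb hab
      simp only [List.length_range] at ha hb
      rw [List.getElem_range, List.getElem_range]
      exact h5.mono hab.le hb
    · have := h5.start_one h; omega

theorem holds_sci {p q : ℕ} (x : triInds p q → ℝ) (j η : ℕ) (γ : ℕ → ℕ) :
    (Constraint.sci j ((List.range η).map γ)).Holds x ↔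
      ∑ m ∈ Finset.Icc j (min (j + η - 1) q), entry x (j + η - 1, m) ≤
        ∑ k ∈ Finset.range η, entry x (γ k + k, γ k) := by
  simp only [Constraint.Holds, List.length_map, List.length_range]
  rw [sumOver_bar, sumOver_shiftedCol, sub_nonpos]

theorem holds_row {p q i : ℕ} (x : triInds p q → ℝ) :
    (Constraint.row i).Holds x ↔ ∑ j ∈ Finset.Icc 1 (min i q), entry x (i, j) = 1 := by
  simp only [Constraint.Holds, sumOver_row]

theorem mem_solutionSet_system {p q : ℕ} {x : triInds p q → ℝ} :
    x ∈ solutionSet p q (system p q) ↔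
      (∀ i, 1 ≤ i → i ≤ p → ∑ j ∈ Finset.Icc 1 (min i q), entry x (i, j) = 1) ∧
      (∀ i j, (i, j) ∈ triInds p q → ¬ (i = j ∧ j < q) → 0 ≤ entry x (i, j)) ∧
      (∀ j η γ, 1 ≤ η → 3 ≤ j → j ≤ q → j + η - 1 ≤ p → IsPath η (j - 1) γ →
        ∑ m ∈ Finset.Icc j (min (j + η - 1) q), entry x (j + η - 1, m) ≤
          ∑ k ∈ Finset.range η, entry x (γ k + k, γ k)) := by
  constructor
  · intro h
    refine ⟨fun i h1 h2 => ?_, fun i j h1 h2 => ?_, fun j η γ h1 h2 h3 h4 h5 => ?_⟩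
    · exact (holds_row x).1 (h (.row i) (Finset.mem_Icc.2 ⟨h1, h2⟩))
    · exact h (.nonneg i j) ⟨h1, h2⟩
    · exact (holds_sci x _ _ _).1 (h _ (listed_sci.2 ⟨h1, h2, h3, h4, h5⟩))
  · rintro ⟨h1, h2, h3⟩ l hl
    cases l with
    | row i =>
      obtain ⟨a, b⟩ : 1 ≤ i ∧ i ≤ p := Finset.mem_Icc.1 hl
      exact (holds_row x).2 (h1 i a b)
    | nonneg i j => exact h2 i j hl.1 hl.2
    | sci j cs =>
      obtain ⟨γ, hγ⟩ := exists_eq_map_range cs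
      rw [hγ] at hl ⊢
      obtain ⟨a, b, c, d, e⟩ := listed_sci.1 hl
      exact (holds_sci x _ _ _).2 (h3 _ _ _ a b c d e)

/-! ### Vertices and restricted growth functions -/

/-- The largest value of `f` on the rows `1, …, n` (and `0` for `n = 0`). -/
def runMax (f : ℕ → ℕ) : ℕ → ℕ
  | 0 => 0
  | n + 1 => max (runMax f n) (f (n + 1))

/-- On the rows `1, …, n`, the function `f` is a restricted growth function with values in `[q]`:
every value exceeds the maximum of the earlier ones by at most one. -/
def IsGrowth (q n : ℕ) (f : ℕ → ℕ) : Prop :=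
  ∀ i, i < n → 1 ≤ f (i + 1) ∧ f (i + 1) ≤ q ∧ f (i + 1) ≤ runMax f i + 1

/-- The 0/1-matrix whose 1-entry in row `i` is in column `f i`. -/
def growthMat (p q : ℕ) (f : ℕ → ℕ) : Matrix (Ints p) (Ints q) ℝ :=
  fun i j => if f i = j then 1 else 0

theorem runMax_congr {f g : ℕ → ℕ} {n : ℕ} (h : ∀ i, 1 ≤ i → i ≤ n → f i = g i) :
    runMax f n = runMax g n := by
  induction n with
  | zero => rfl
  | succ n ih =>
    rw [runMax, runMax, ih fun i h1 h2 => h i h1 (by omega), h (n + 1) (by omega) le_rfl]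

theorem le_runMax {f : ℕ → ℕ} {i n : ℕ} (h1 : 1 ≤ i) (h2 : i ≤ n) : f i ≤ runMax f n := by
  induction n with
  | zero => omega
  | succ n ih =>
    rw [runMax]
    rcases Nat.lt_or_ge n i with h | h
    · have : i = n + 1 := by omega
      subst this; exact le_max_right _ _
    · exact (ih h).trans (le_max_left _ _)

theorem IsGrowth.runMax_le {q n : ℕ} {f : ℕ → ℕ} (h : IsGrowth q n f) {i : ℕ} (hi : i ≤ n) :
    runMax f i ≤ min i q := by
  induction i with
  | zero => simp [runMax]
  | succ i ih =>
    have h1 := ih (by omega)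
    have h2 := h i (by omega)
    rw [runMax]
    omega

theorem IsGrowth.bounds {q n : ℕ} {f : ℕ → ℕ} (h : IsGrowth q n f) {i : ℕ} (h1 : 1 ≤ i)
    (hi : i ≤ n) : 1 ≤ f i ∧ f i ≤ min i q := by
  obtain ⟨i, rfl⟩ := Nat.exists_eq_add_of_le' h1
  exact ⟨(h i (by omega)).1, (le_runMax h1 le_rfl).trans (h.runMax_le hi)⟩

theorem IsGrowth.exists_eq {q n : ℕ} {f : ℕ → ℕ} (h : IsGrowth q n f) {i j : ℕ} (hi : i ≤ n)
    (h1 : 1 ≤ j) (h2 : j ≤ runMax f i) : ∃ k, 1 ≤ k ∧ k ≤ i ∧ f k = j := by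
  induction i with
  | zero => rw [runMax] at h2; omega
  | succ i ih =>
    rw [runMax] at h2
    have h3 := h i (by omega)
    rcases Nat.lt_or_ge (runMax f i) j with h4 | h4
    · exact ⟨i + 1, by omega, le_rfl, by omega⟩
    · obtain ⟨k, a, b, c⟩ := ih (by omega) h4
      exact ⟨k, a, by omega, c⟩

/-- In a `≺`-maximal matrix a column cannot start to be used before all columns to its left have
been used: otherwise a transposition of two columns would give a larger matrix. -/
theorem exists_earlier_of_mem {p q : ℕ} {A : Matrix (Ints p) (Ints q) ℝ} (hA : A ∈ matMax p q ⊤)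
    {f : Ints p → Ints q} (hf : ∀ i j, A i j = if f i = j then 1 else 0) (i : Ints p) (j : Ints q)
    (hj : j < f i) : ∃ k, k < i ∧ f k = j := by
  by_contra! hne
  obtain ⟨k, hk, hmin⟩ := WellFounded.has_min (wellFounded_lt : WellFounded
    ((· < ·) : Ints p → Ints p → Prop)) {k | f k = f i} ⟨i, rfl⟩
  have hki : k ≤ i := not_lt.1 (hmin i rfl)
  have hk' : f k = f i := hk
  refine hA.2 (Equiv.swap j (f i)) (Subgroup.mem_top _) ⟨k, j, ?_, ?_⟩
  · simp [hf, hk', hj.ne']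
  · rintro k' l' (h | ⟨rfl, h⟩)
    · have h1 : f k' ≠ j := hne k' (h.trans_le hki)
      have h2 : f k' ≠ f i := fun e => hmin k' e h
      simp only [hf]
      congr 1
      rw [eq_iff_iff, ← Equiv.symm_apply_eq, Equiv.symm_swap, Equiv.swap_apply_of_ne_of_ne h1 h2]
    · beta_reduce
      rw [Equiv.swap_apply_of_ne_of_ne h.ne (h.trans hj).ne]

/-- A permutation that makes the matrix larger fixes all columns that occur before the first row
where the matrices differ. In this row the 1-entry would have to move to a smaller column that has
not occurred yet, but there is no such column. -/
theorem growthMat_mem_matMax {p q : ℕ} {f : ℕ → ℕ} (hf : IsGrowth q p f) :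
    growthMat p q f ∈ matMax p q ⊤ := by
  refine ⟨fun i j => ?_, ?_⟩
  · unfold growthMat; split_ifs <;> simp
  rintro σ - ⟨k, l, hlt, heq⟩
  have hk := Finset.mem_Icc.1 k.2
  have hl := Finset.mem_Icc.1 l.2
  have entry_eq : ∀ (i : Ints p) (m : Ints q),
      growthMat p q f i m = growthMat p q f i (σ m) → f i = m → f i = σ m := by
    intro i m h1 h2
    by_contra h3
    simp [growthMat, h2] at h1
    exact h3 (h2.trans (congrArg Subtype.val h1))
  have hfk : f k ≠ l ∧ f k = σ l := by
    simp only [growthMat] at hlt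
    by_cases h1 : f k = l <;> by_cases h2 : f k = σ l
    · rw [if_pos h1, if_pos h2] at hlt; exact absurd hlt (lt_irrefl _)
    · rw [if_pos h1, if_neg h2] at hlt; exact absurd hlt (by norm_num)
    · exact ⟨h1, h2⟩
    · rw [if_neg h1, if_neg h2] at hlt; exact absurd hlt (lt_irrefl _)
  obtain ⟨n, hn⟩ : ∃ n, (k : ℕ) = n + 1 := ⟨k - 1, by omega⟩
  -- the columns that occur before row `k` are fixed by `σ`
  have fixed : ∀ m : Ints q, (m : ℕ) ≤ runMax f n → σ m = m := by
    intro m hm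
    have hm1 := Finset.mem_Icc.1 m.2
    obtain ⟨i, h1, h2, h3⟩ := hf.exists_eq (i := n) (by omega) hm1.1 hm
    have hi : i ∈ Finset.Icc 1 p := Finset.mem_Icc.2 ⟨h1, by omega⟩
    have := entry_eq ⟨i, hi⟩ m (heq ⟨i, hi⟩ m (Or.inl (Subtype.mk_lt_mk.2 (by omega)))) h3
    exact Subtype.ext (this.symm.trans h3)
  have hgr := (hf n (by omega)).2.2
  rw [← hn] at hgr
  rcases Nat.lt_or_ge (runMax f n) (f k) with h | h
  · rcases Nat.lt_or_ge (f k) l with h' | h'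
    · have h1 : σ (σ l) = σ l := by
        have := entry_eq k (σ l) (heq k (σ l) (Or.inr ⟨rfl,
          Subtype.coe_lt_coe.1 (by omega)⟩)) hfk.2
        exact Subtype.ext (this.symm.trans hfk.2)
      have := congrArg Subtype.val (σ.injective h1)
      omega
    · have h1 := congrArg Subtype.val (fixed l (by omega))
      omega
  · have h1 := congrArg Subtype.val (σ.injective (fixed (σ l) (by omega)))
    omega

theorem matMax_inter_matPart (p q : ℕ) :
    matMax p q ⊤ ∩ matPart p q = {A | ∃ f, IsGrowth q p f ∧ A = growthMat p q f} := by
  ext A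
  constructor
  · rintro ⟨hmax, h01, hsum⟩
    have hex : ∀ i, ∃ j, ∀ l, A i l = if j = l then 1 else 0 := by
      intro i
      obtain ⟨j, -, hj⟩ := Finset.exists_ne_zero_of_sum_ne_zero
        (show ∑ j, A i j ≠ 0 by rw [hsum]; norm_num)
      have hj1 : A i j = 1 := (h01 i j).resolve_left hj
      refine ⟨j, fun l => ?_⟩
      split_ifs with h
      · rw [← h, hj1]
      · have h1 := hsum i
        rw [← Finset.add_sum_erase _ _ (Finset.mem_univ j), hj1, add_eq_left,
          Finset.sum_eq_zero_iff_of_nonneg] at h1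
        · exact h1 l (Finset.mem_erase.2 ⟨Ne.symm h, Finset.mem_univ _⟩)
        · intro m _
          rcases h01 i m with h | h <;> rw [h]
          exact zero_le_one
    choose f hf using hex
    refine ⟨fun i => if h : i ∈ Finset.Icc 1 p then f ⟨i, h⟩ else 0, fun i hi => ?_, ?_⟩
    · have hi' : i + 1 ∈ Finset.Icc 1 p := Finset.mem_Icc.2 ⟨by omega, by omega⟩
      have h1 := Finset.mem_Icc.1 (f ⟨i + 1, hi'⟩).2
      simp only [hi', dif_pos]
      refine ⟨h1.1, h1.2, ?_⟩
      set m := (f ⟨i + 1, hi'⟩ : ℕ) with hm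
      rcases Nat.lt_or_ge m 2 with h2 | h2
      · omega
      · obtain ⟨k, hk, hfk⟩ := exists_earlier_of_mem hmax hf ⟨i + 1, hi'⟩
          ⟨m - 1, Finset.mem_Icc.2 ⟨by omega, by omega⟩⟩ (Subtype.coe_lt_coe.1 (by
            show m - 1 < m; omega))
        have hk1 := Finset.mem_Icc.1 k.2
        have hk2 : (k : ℕ) < i + 1 := hk
        have := le_runMax (f := fun i => if h : i ∈ Finset.Icc 1 p then (f ⟨i, h⟩ : ℕ) else 0)
          hk1.1 (show (k : ℕ) ≤ i by omega)
        simp only [k.2, dif_pos, Subtype.coe_eta, hfk] at this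
        omega
    · ext i j
      simp only [growthMat, hf, i.2, dif_pos, Subtype.coe_eta, Subtype.ext_iff]
  · rintro ⟨f, hf, rfl⟩
    refine ⟨growthMat_mem_matMax hf, (growthMat_mem_matMax hf).1, fun i => ?_⟩
    have hi := Finset.mem_Icc.1 i.2
    have hb := hf.bounds hi.1 hi.2
    rw [Finset.sum_eq_single ⟨f i, Finset.mem_Icc.2 ⟨hb.1, by omega⟩⟩]
    · simp [growthMat]
    · intro j _ hj
      rw [growthMat, if_neg]
      intro e
      exact hj (Subtype.ext e.symm)
    · simp

theorem apply_eq_zero_of_mem_orbipart {p q : ℕ} {A : Matrix (Ints p) (Ints q) ℝ}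
    (hA : A ∈ orbipart p q ⊤) (i : Ints p) (j : Ints q) (hij : (i : ℕ) < j) : A i j = 0 := by
  have hlin : IsLinearMap ℝ (fun B : Matrix (Ints p) (Ints q) ℝ => B i j) :=
    ⟨fun _ _ => rfl, fun _ _ => rfl⟩
  refine convexHull_min (t := {B | B i j = 0}) ?_ (convex_hyperplane hlin 0) hA
  rw [matMax_inter_matPart]
  rintro _ ⟨f, hf, rfl⟩
  have hi := Finset.mem_Icc.1 i.2
  have hb := hf.bounds hi.1 hi.2
  exact if_neg (by omega)

/-- The vertex of the orbitope given by `f`, in lower triangular coordinates. -/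
def growthVec (p q : ℕ) (f : ℕ → ℕ) : triInds p q → ℝ :=
  fun ij => if f ij.1.1 = ij.1.2 then 1 else 0

theorem orbipartTri_eq (p q : ℕ) :
    orbipartTri p q = convexHull ℝ {v | ∃ f, IsGrowth q p f ∧ v = growthVec p q f} := by
  have hlin : IsLinearMap ℝ (restrictTri (p := p) (q := q)) := ⟨fun _ _ => rfl, fun _ _ => rfl⟩
  rw [orbipartTri, orbipart, hlin.image_convexHull, matMax_inter_matPart]
  congr 1
  ext v
  constructor
  · rintro ⟨_, ⟨f, hf, rfl⟩, rfl⟩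
    exact ⟨f, hf, rfl⟩
  · rintro ⟨f, hf, rfl⟩
    exact ⟨_, ⟨f, hf, rfl⟩, rfl⟩

theorem entry_growthVec {p q : ℕ} {f : ℕ → ℕ} (hf : IsGrowth q p f) {i : ℕ} (h1 : 1 ≤ i)
    (hi : i ≤ p) (j : ℕ) : entry (growthVec p q f) (i, j) = if f i = j then 1 else 0 := by
  have hb := hf.bounds h1 hi
  by_cases h : (i, j) ∈ triInds p q
  · rw [entry_of_mem _ h]; rfl
  · rw [entry_of_notMem _ h, if_neg]
    rintro rfl
    exact h (mem_triInds.2 ⟨h1, hi, hb.1, by omega, by omega⟩)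

/-! ### The constraints as linear functionals -/

/-- The coordinate `x ↦ x_ij` as a linear functional. -/
noncomputable def entryLin {p q : ℕ} (ij : ℕ × ℕ) : (triInds p q → ℝ) →ₗ[ℝ] ℝ :=
  if h : ij ∈ triInds p q then LinearMap.proj ⟨ij, h⟩ else 0

theorem entryLin_apply {p q : ℕ} (ij : ℕ × ℕ) (x : triInds p q → ℝ) :
    entryLin ij x = entry x ij := by
  unfold entryLin entry
  split_ifs <;> rfl

/-- The functional `x ↦ x(T)`. -/
noncomputable def sumLin {p q : ℕ} (T : Finset (ℕ × ℕ)) : (triInds p q → ℝ) →ₗ[ℝ] ℝ :=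
  ∑ ij ∈ T, entryLin ij

theorem sumLin_apply {p q : ℕ} (T : Finset (ℕ × ℕ)) (x : triInds p q → ℝ) :
    sumLin T x = sumOver x T := by
  simp [sumLin, sumOver, entryLin_apply]

/-- The linear functional of a constraint. An inequality of the system says that it is
non-negative, an equation that it is `1`. -/
noncomputable def Constraint.val {p q : ℕ} : Constraint → ((triInds p q → ℝ) →ₗ[ℝ] ℝ)
  | .row i => sumLin (Orbitope.row q i)
  | .nonneg i j => entryLin (i, j)
  | .sci j cs => sumLin (shiftedCol cs) - sumLin (bar q (diag cs.length j))

theorem Constraint.IsIneq.holds_iff {p q : ℕ} {l : Constraint} (hl : l.IsIneq)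
    (x : triInds p q → ℝ) : l.Holds x ↔ 0 ≤ l.val x := by
  cases l with
  | row => exact hl.elim
  | nonneg i j => simp only [Constraint.Holds, Constraint.val, entryLin_apply]
  | sci j cs =>
    simp only [Constraint.Holds, Constraint.val, sumLin_apply, LinearMap.sub_apply, sub_nonneg,
      sub_nonpos]

theorem Constraint.IsIneq.tight_iff {p q : ℕ} {l : Constraint} (hl : l.IsIneq)
    (x : triInds p q → ℝ) : l.Tight x ↔ l.val x = 0 := by
  cases l with
  | row => exact hl.elim
  | nonneg i j => simp only [Constraint.Tight, Constraint.val, entryLin_apply]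
  | sci j cs =>
    simp only [Constraint.Tight, Constraint.val, sumLin_apply, LinearMap.sub_apply, sub_eq_zero]
    exact eq_comm

theorem convex_solutionSet (p q : ℕ) (L : Set Constraint) : Convex ℝ (solutionSet p q L) := by
  have : solutionSet p q L = ⋂ l ∈ L, {x | l.Holds x} := by
    ext x; simp [solutionSet]
  rw [this]
  refine convex_iInter₂ fun l _ => ?_
  by_cases hl : l.IsIneq
  · simp only [hl.holds_iff]
    exact convex_halfSpace_ge l.val.isLinear 0
  · cases l with
    | row i =>
      simp only [Constraint.Holds, ← sumLin_apply]
      exact convex_hyperplane (LinearMap.isLinear _) 1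
    | nonneg => exact absurd trivial hl
    | sci => exact absurd trivial hl

/-! ### Validity of the system -/

theorem IsGrowth.runMax_add_le {q n : ℕ} {f : ℕ → ℕ} (h : IsGrowth q n f) {i d : ℕ}
    (hi : i + d ≤ n) : runMax f (i + d) ≤ runMax f i + d := by
  induction d with
  | zero => rfl
  | succ d ih =>
    have h1 := ih (by omega)
    have h2 := (h (i + d) (by omega)).2.2
    rw [← add_assoc, runMax]
    omega

/-- A restricted growth function that meets the bar with leader `(c + η, c + 1)` meets every
shifted column of `η` positions to the left of column `c + 1`. Otherwise its running maximum
would stay behind the shifted column all the way up to the row of the bar. -/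
theorem IsGrowth.exists_hit {q p η c : ℕ} {f γ : ℕ → ℕ} (hf : IsGrowth q p f) (h : IsPath η c γ)
    (hη : 1 ≤ η) (hp : c + η ≤ p) (hbar : c + 1 ≤ f (c + η)) :
    ∃ k, k < η ∧ f (γ k + k) = γ k := by
  by_contra! hne
  have key : ∀ k, k < η → runMax f (γ k + k) < γ k := by
    intro k hk
    induction k with
    | zero =>
      have h1 := h.two_le 0 hk
      have h2 := h.le_max 0 hk
      obtain ⟨n, hn⟩ : ∃ n, γ 0 = n + 1 := ⟨γ 0 - 1, by omega⟩
      have h3 := hf.runMax_le (i := n) (by omega)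
      have h4 := hf n (by omega)
      have h5 := hne 0 hk
      rw [hn] at h5 ⊢
      rw [add_zero] at h5 ⊢
      rw [runMax]
      omega
    | succ k ih =>
      have h1 := ih (by omega)
      have h2 := h.mono_succ k hk
      have h3 := h.le_max (k + 1) hk
      have h4 := hf.runMax_add_le (i := γ k + k) (d := γ (k + 1) - γ k) (by omega)
      rw [show γ k + k + (γ (k + 1) - γ k) = γ (k + 1) + k by omega] at h4
      have h5 := hf (γ (k + 1) + k) (by omega)
      have h6 := hne (k + 1) hk
      rw [← add_assoc] at h6 ⊢
      rw [runMax]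
      omega
  have h1 := key (η - 1) (by omega)
  have h2 := h.le_max (η - 1) (by omega)
  have h3 := hf.runMax_add_le (i := γ (η - 1) + (η - 1)) (d := c + 1 - γ (η - 1)) (by omega)
  rw [show γ (η - 1) + (η - 1) + (c + 1 - γ (η - 1)) = c + η by omega] at h3
  have h4 := le_runMax (f := f) (i := c + η) (by omega) le_rfl
  omega

theorem growthVec_mem_solutionSet {p q : ℕ} {f : ℕ → ℕ} (hf : IsGrowth q p f) :
    growthVec p q f ∈ solutionSet p q (system p q) := by
  refine mem_solutionSet_system.2 ⟨fun i h1 h2 => ?_, fun i j h1 _ => ?_,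
    fun j η γ h1 h2 h3 h4 h5 => ?_⟩
  · have hb := hf.bounds h1 h2
    simp only [entry_growthVec hf h1 h2]
    rw [Finset.sum_ite_eq, if_pos (Finset.mem_Icc.2 hb)]
  · obtain ⟨a, b, -⟩ := mem_triInds.1 h1
    rw [entry_growthVec hf a b]
    split_ifs <;> norm_num
  · have hrow : ∀ k ∈ Finset.range η, entry (growthVec p q f) (γ k + k, γ k) =
        if f (γ k + k) = γ k then 1 else 0 := by
      intro k hk
      have hk := Finset.mem_range.1 hk
      have := h5.two_le k hk
      have := h5.le_max k hk
      exact entry_growthVec hf (by omega) (by omega) _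
    rw [Finset.sum_congr rfl hrow]
    simp only [entry_growthVec hf (show 1 ≤ j + η - 1 by omega) h4]
    rw [Finset.sum_ite_eq]
    have hnn : ∀ k ∈ Finset.range η, (0 : ℝ) ≤ if f (γ k + k) = γ k then 1 else 0 :=
      fun k _ => by split_ifs <;> norm_num
    split_ifs with h
    · have e : j - 1 + η = j + η - 1 := by omega
      obtain ⟨k, hk, hk'⟩ := hf.exists_hit h5 h1 (by omega)
        (by rw [e]; have := (Finset.mem_Icc.1 h).1; omega)
      refine le_trans (by rw [if_pos hk']) (Finset.single_le_sum hnn (Finset.mem_range.2 hk))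
    · exact Finset.sum_nonneg hnn

theorem orbipartTri_subset (p q : ℕ) :
    orbipartTri p q ⊆ solutionSet p q (system p q) := by
  rw [orbipartTri_eq]
  refine convexHull_min ?_ (convex_solutionSet p q _)
  rintro _ ⟨f, hf, rfl⟩
  exact growthVec_mem_solutionSet hf

/-! ### Completeness of the system -/

/-- The largest possible values for the probability, in a random restricted growth function whose
matrix has expectation `X`, that the running maximum on the rows `1, …, i` is at least `j`. -/
noncomputable def stateProb (X : ℕ → ℕ → ℝ) : ℕ → ℕ → ℝ
  | 0, 0 => 1
  | 0, _ + 1 => 0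
  | _ + 1, 0 => 1
  | i + 1, j + 1 => min (stateProb X i j) (stateProb X i (j + 1) + X (i + 1) (j + 1))

section stateProb

variable {X : ℕ → ℕ → ℝ}

theorem stateProb_zero_right (i : ℕ) : stateProb X i 0 = 1 := by
  cases i <;> rw [stateProb]

theorem stateProb_nonneg (hX : ∀ i j, 0 ≤ X i j) (i j : ℕ) : 0 ≤ stateProb X i j := by
  induction i generalizing j with
  | zero => cases j <;> rw [stateProb]; exact zero_le_one
  | succ i ih =>
    cases j with
    | zero => rw [stateProb]; exact zero_le_one
    | succ j => rw [stateProb]; exact le_min (ih j) (add_nonneg (ih _) (hX _ _))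

theorem stateProb_mono_antitone (hX : ∀ i j, 0 ≤ X i j) (i : ℕ) :
    (∀ j, stateProb X i (j + 1) ≤ stateProb X i j) ∧
      ∀ j, stateProb X i j ≤ stateProb X (i + 1) j := by
  have step : ∀ i, (∀ j, stateProb X i (j + 1) ≤ stateProb X i j) →
      ∀ j, stateProb X i j ≤ stateProb X (i + 1) j := by
    intro i h j
    cases j with
    | zero => rw [stateProb_zero_right, stateProb_zero_right]
    | succ j =>
      rw [stateProb.eq_4]
      exact le_min (h j) (le_add_of_nonneg_right (hX _ _))
  induction i with
  | zero =>
    have : ∀ j, stateProb X 0 (j + 1) ≤ stateProb X 0 j := fun j => by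
      rw [stateProb]; exact stateProb_nonneg hX _ _
    exact ⟨this, step 0 this⟩
  | succ i ih =>
    have : ∀ j, stateProb X (i + 1) (j + 1) ≤ stateProb X (i + 1) j := fun j => by
      rw [stateProb.eq_4]
      exact (min_le_left _ _).trans (ih.2 j)
    exact ⟨this, step (i + 1) this⟩

theorem stateProb_eq_zero {q : ℕ} (hX : ∀ i j, 0 ≤ X i j) (hq : ∀ i, X i (q + 1) = 0) (i : ℕ) :
    stateProb X i (q + 1) = 0 := by
  induction i with
  | zero => rw [stateProb]
  | succ i ih =>
    rw [stateProb, ih, hq, add_zero]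
    exact min_eq_right (stateProb_nonneg hX _ _)

theorem stateProb_one (hX : ∀ i j, 0 ≤ X i j) (h1 : X 1 1 = 1) (i : ℕ) :
    stateProb X (i + 1) 1 = 1 := by
  induction i with
  | zero => simp [stateProb, h1]
  | succ i ih =>
    rw [stateProb, ih, stateProb_zero_right]
    exact min_eq_left (by linarith [hX (i + 1 + 1) (0 + 1)])

/-- The values of `stateProb` are at least `1` or attained by shifted columns. -/
theorem exists_path_le_stateProb {q : ℕ} (hX : ∀ i j, 0 ≤ X i j) (h1 : X 1 1 = 1)
    (hle : ∀ c, c + 2 ≤ q → X (c + 2) (c + 2) ≤ 1)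
    (hdiag : ∀ c, 2 ≤ c → c + 1 ≤ q → X (c + 1) (c + 1) ≤ X c c) (e c : ℕ)
    (hc1 : 1 ≤ c) (hcq : c ≤ q) :
    1 ≤ stateProb X (c + e) c ∨ ∃ γ, IsPath (e + 1) c γ ∧
      ∑ k ∈ Finset.range (e + 1), X (γ k + k) (γ k) ≤ stateProb X (c + e) c := by
  induction hN : c + e generalizing c e with
  | zero => omega
  | succ N ih =>
    obtain ⟨c, rfl⟩ := Nat.exists_eq_add_of_le' hc1
    rcases Nat.eq_zero_or_pos c with rfl | hc
    · left
      rw [stateProb_one hX h1]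
    rcases Nat.eq_zero_or_pos e with rfl | he
    · right
      refine ⟨fun _ => c + 1, ⟨by intros; omega, by intros; omega, by intros; omega,
        by intros; omega, by intros; rfl⟩, ?_⟩
      obtain rfl : c = N := by omega
      simp only [zero_add, Finset.sum_range_one, add_zero]
      rw [stateProb]
      refine le_min ?_ (le_add_of_nonneg_left (stateProb_nonneg hX _ _))
      rcases ih 0 c hc (by omega) rfl with h | ⟨γ, h, h'⟩
      · obtain ⟨d, rfl⟩ := Nat.exists_eq_add_of_le' hc
        exact (hle d (by omega)).trans h
      · have h2 := h.two_le 0 (by omega)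
        have h3 := h.start_one rfl
        simp only [zero_add, Finset.sum_range_one, add_zero] at h'
        rw [h3] at h' h2
        exact (hdiag c h2 hcq).trans h'
    · obtain ⟨e, rfl⟩ := Nat.exists_eq_add_of_le' he
      rw [stateProb]
      rcases min_choice (stateProb X N c) (stateProb X N (c + 1) + X (N + 1) (c + 1)) with hm | hm
      · rw [hm]
        rcases ih (e + 1) c hc (by omega) (by omega) with h | ⟨γ, h, h'⟩
        · exact Or.inl h
        · exact Or.inr ⟨γ, ⟨h.two_le, fun k hk => (h.le_max k hk).trans (by omega), h.mono_succ,
            h.start_eq, by omega⟩, h'⟩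
      · rw [hm]
        rcases ih e (c + 1) hc1 hcq (by omega) with h | ⟨γ, h, h'⟩
        · exact Or.inl (by linarith [hX (N + 1) (c + 1)])
        · refine Or.inr ⟨Function.update γ (e + 1) (c + 1), ⟨?_, ?_, ?_, ?_, by omega⟩, ?_⟩
          · intro k hk
            rw [Function.update_apply]
            split_ifs
            · omega
            · exact h.two_le k (by omega)
          · intro k hk
            rw [Function.update_apply]
            split_ifs
            · omega
            · exact h.le_max k (by omega)
          · intro k hk
            rw [Function.update_of_ne (by omega), Function.update_apply]
            split_ifs
            · exact h.le_max k (by omega)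
            · exact h.mono_succ k (by omega)
          · intro _
            rw [Function.update_of_ne (by omega), Function.update_apply]
            split_ifs
            · exact h.start_one (by omega)
            · exact h.start_eq (by omega)
          · rw [Finset.sum_range_succ, Function.update_self]
            refine add_le_add ?_ (by rw [show c + 1 + (e + 1) = N + 1 by omega])
            refine le_trans (le_of_eq (Finset.sum_congr rfl fun k hk => ?_)) h'
            rw [Function.update_of_ne (Finset.mem_range.1 hk).ne]

end stateProb

theorem sum_mul_nonneg_of_prefix_sum_nonpos {e K : ℕ → ℝ} (hK : Monotone K) {n : ℕ}
    (he : ∀ m, m ≤ n → ∑ t ∈ Finset.range m, e t ≤ 0) (h0 : ∑ t ∈ Finset.range n, e t = 0) :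
    0 ≤ ∑ t ∈ Finset.range n, e t * K t := by
  have key : ∀ m, m < n → (∑ t ∈ Finset.range (m + 1), e t) * K m ≤
      ∑ t ∈ Finset.range (m + 1), e t * K t := by
    intro m hm
    induction m with
    | zero => simp
    | succ m ih =>
      rw [Finset.sum_range_succ, Finset.sum_range_succ (fun t => e t * K t), add_mul]
      have h1 := ih (by omega)
      have h2 := mul_le_mul_of_nonpos_left (hK m.le_succ) (he (m + 1) hm.le)
      linarith
  cases n with
  | zero => simp
  | succ n => simpa [h0] using key n (Nat.lt_succ_self n)

/-- One step of the dynamic program: `F` and `F'` are the distributions of the running maximum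
before and after a row with expectation `X`, and `V` and `V'` are the largest rewards that can
still be collected. -/
theorem reward_step {q : ℕ} {F F' X c V V' : ℕ → ℝ} (h0 : F' 0 = F 0) (h1 : F' 1 = F 0)
    (hq : F (q + 1) = 0) (hq' : F' (q + 1) = 0)
    (hd : ∀ t, t < q → F (t + 1) ≤ F' (t + 1))
    (hX : ∀ t, t < q → F' (t + 1) ≤ F (t + 1) + X (t + 1))
    (hv : ∀ t, t < q → F' (t + 2) ≤ F (t + 1))
    (hpre : ∀ n, n ≤ q → F' 1 - F' (n + 1) ≤ ∑ t ∈ Finset.range n, X (t + 1))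
    (htot : F' 1 = ∑ t ∈ Finset.range q, X (t + 1))
    (hV : ∀ m j, 1 ≤ j → j ≤ q → j ≤ m + 1 → c j + V' (max m j) ≤ V m) :
    ∑ t ∈ Finset.range q, c (t + 1) * X (t + 1) +
        ∑ m ∈ Finset.range (q + 1), (F' m - F' (m + 1)) * V' m ≤
      ∑ m ∈ Finset.range (q + 1), (F m - F (m + 1)) * V m := by
  set K : ℕ → ℝ := fun t => partialSups (fun s => c (s + 1)) t with hK
  have hcK : ∀ t, c (t + 1) ≤ K t := fun t => le_partialSups (fun s => c (s + 1)) t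
  have hVK : ∀ t, t < q → K t + V' (t + 1) ≤ V (t + 1) := by
    intro t ht
    rw [← le_sub_iff_add_le]
    refine partialSups_le _ _ _ fun s hs => ?_
    have := hV (t + 1) (s + 1) (by omega) (by omega) (by omega)
    rw [max_eq_left (by omega)] at this
    linarith
  have hVc : ∀ t, t < q → c (t + 1) + V' (t + 1) ≤ V t := by
    intro t ht
    have := hV t (t + 1) (by omega) (by omega) le_rfl
    rwa [max_eq_right (by omega)] at this
  -- the mass that stays in state `t + 1` and the mass that enters it
  have e1 : ∑ m ∈ Finset.range (q + 1), (F m - F (m + 1)) * V m =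
      ∑ t ∈ Finset.range q, (F (t + 1) - F' (t + 2)) * V (t + 1) +
        ∑ t ∈ Finset.range q, (F' (t + 1) - F (t + 1)) * V t := by
    have : ∀ m, (F m - F (m + 1)) * V m =
        (F m - F' (m + 1)) * V m + (F' (m + 1) - F (m + 1)) * V m := fun m => by ring
    simp only [this, Finset.sum_add_distrib]
    rw [Finset.sum_range_succ', Finset.sum_range_succ (fun m => (F' (m + 1) - F (m + 1)) * V m)]
    simp [h1, hq, hq']
  have e2 : ∑ m ∈ Finset.range (q + 1), (F' m - F' (m + 1)) * V' m =
      ∑ t ∈ Finset.range q, (F' (t + 1) - F' (t + 2)) * V' (t + 1) := by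
    rw [Finset.sum_range_succ']
    simp [h0, h1]
  have e3 : 0 ≤ ∑ t ∈ Finset.range q, (F' (t + 1) - F' (t + 2) - X (t + 1)) * K t := by
    have hsum : ∀ n, ∑ t ∈ Finset.range n, (F' (t + 1) - F' (t + 2) - X (t + 1)) =
        F' 1 - F' (n + 1) - ∑ t ∈ Finset.range n, X (t + 1) := by
      intro n
      rw [Finset.sum_sub_distrib, Finset.sum_range_sub' (fun t => F' (t + 1))]
    refine sum_mul_nonneg_of_prefix_sum_nonpos (partialSups _).monotone (fun m hm => ?_) ?_
    · rw [hsum]; linarith [hpre m hm]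
    · rw [hsum, hq']; linarith
  rw [e1, e2, ← sub_nonneg]
  refine e3.trans ?_
  simp only [← Finset.sum_add_distrib, ← Finset.sum_sub_distrib]
  refine Finset.sum_le_sum fun t ht => ?_
  have ht := Finset.mem_range.1 ht
  have a1 := mul_le_mul_of_nonneg_left (hVK t ht) (sub_nonneg.2 (hv t ht))
  have a2 := mul_le_mul_of_nonneg_left (hVc t ht) (sub_nonneg.2 (hd t ht))
  have a3 := mul_le_mul_of_nonneg_left (hcK t)
    (show 0 ≤ F (t + 1) + X (t + 1) - F' (t + 1) by linarith [hX t ht])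
  linarith

/-- The largest reward on the last `n` of `p` rows for restricted growth functions with running
maximum `m` before these rows, if the entry `(i, j)` earns `c i j`. -/
noncomputable def tailValue (p q : ℕ) (c : ℕ → ℕ → ℝ) : ℕ → ℕ → ℝ
  | 0, _ => 0
  | n + 1, m =>
    if h : (Finset.Icc 1 (min (m + 1) q)).Nonempty then
      (Finset.Icc 1 (min (m + 1) q)).sup' h fun j => c (p - n) j + tailValue p q c n (max m j)
    else 0

theorem le_tailValue {p q : ℕ} {c : ℕ → ℕ → ℝ} {n m j : ℕ} (h1 : 1 ≤ j) (h2 : j ≤ q)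
    (h3 : j ≤ m + 1) :
    c (p - n) j + tailValue p q c n (max m j) ≤ tailValue p q c (n + 1) m := by
  have hj : j ∈ Finset.Icc 1 (min (m + 1) q) := Finset.mem_Icc.2 ⟨h1, le_min h3 h2⟩
  rw [tailValue, dif_pos ⟨j, hj⟩]
  exact Finset.le_sup' (fun j => c (p - n) j + tailValue p q c n (max m j)) hj

theorem exists_growth_eq_tailValue {p q : ℕ} (hq : 1 ≤ q) (c : ℕ → ℕ → ℝ) (n : ℕ) (hn : n ≤ p)
    (f : ℕ → ℕ) (hf : IsGrowth q (p - n) f) :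
    ∃ g, IsGrowth q p g ∧ (∀ i, i ≤ p - n → g i = f i) ∧
      ∑ i ∈ Finset.Ico (p - n) p, c (i + 1) (g (i + 1)) =
        tailValue p q c n (runMax f (p - n)) := by
  induction n generalizing f with
  | zero => exact ⟨f, hf, fun _ _ => rfl, by simp [tailValue]⟩
  | succ n ih =>
    set r := p - (n + 1) with hr
    have hrn : p - n = r + 1 := by omega
    have hne : (Finset.Icc 1 (min (runMax f r + 1) q)).Nonempty :=
      Finset.nonempty_Icc.2 (by omega)
    obtain ⟨j, hj, hj'⟩ := Finset.exists_mem_eq_sup' hne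
      fun j => c (p - n) j + tailValue p q c n (max (runMax f r) j)
    have hj := Finset.mem_Icc.1 hj
    set f' := Function.update f (r + 1) j with hf'
    have hagree : ∀ i, i ≤ r → f' i = f i := fun i hi => Function.update_of_ne (by omega) _ _
    have hrun : ∀ i, i ≤ r → runMax f' i = runMax f i := fun i hi =>
      runMax_congr fun k _ hk => hagree k (by omega)
    have hself : f' (r + 1) = j := Function.update_self _ _ _
    obtain ⟨g, hg1, hg2, hg3⟩ := ih (by omega) f' (by
      intro i hi
      rcases Nat.lt_or_ge i r with h | h
      · rw [hagree _ (by omega), hrun _ h.le]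
        exact hf i h
      · obtain rfl : i = r := by omega
        rw [hself, hrun _ le_rfl]
        omega)
    refine ⟨g, hg1, fun i hi => ?_, ?_⟩
    · rw [hg2 i (by omega), hagree i hi]
    · rw [Finset.sum_eq_sum_Ico_succ_bot (by omega), ← hrn, hg3, hg2 _ le_rfl, hrn, runMax, hself,
        hrun _ le_rfl, tailValue, dif_pos hne, hj', hrn]

/-- A point of the solution set, as an array on `ℕ × ℕ`, never earns more than the best restricted
growth function. -/
theorem reward_le_tailValue {p q : ℕ} {X c : ℕ → ℕ → ℝ} (hX : ∀ i j, 0 ≤ X i j)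
    (h1 : X 1 1 = 1) (hq : ∀ i, X i (q + 1) = 0)
    (hrow : ∀ i, i < p → ∑ t ∈ Finset.range q, X (i + 1) (t + 1) = 1)
    (hbar : ∀ i, i < p → ∀ n, n ≤ q →
      1 - stateProb X (i + 1) (n + 1) ≤ ∑ t ∈ Finset.range n, X (i + 1) (t + 1)) :
    ∑ i ∈ Finset.range p, ∑ t ∈ Finset.range q, c (i + 1) (t + 1) * X (i + 1) (t + 1) ≤
      tailValue p q c p 0 := by
  have key : ∀ n, n ≤ p →
      ∑ i ∈ Finset.Ico (p - n) p, ∑ t ∈ Finset.range q, c (i + 1) (t + 1) * X (i + 1) (t + 1) ≤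
        ∑ m ∈ Finset.range (q + 1), (stateProb X (p - n) m - stateProb X (p - n) (m + 1)) *
          tailValue p q c n m := by
    intro n hn
    induction n with
    | zero => simp [tailValue]
    | succ n ih =>
      obtain ⟨r, hr⟩ : ∃ r, p - (n + 1) = r := ⟨_, rfl⟩
      have hrn : p - n = r + 1 := by omega
      have hone := stateProb_one hX h1 r
      rw [hr, Finset.sum_eq_sum_Ico_succ_bot (by omega), ← hrn]
      refine (add_le_add_right (ih (by omega)) _).trans ?_
      rw [hrn]
      refine reward_step (F := stateProb X r) (F' := stateProb X (r + 1)) (X := X (r + 1))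
        (c := c (r + 1)) (V := tailValue p q c (n + 1)) (V' := tailValue p q c n) ?_ ?_
        (stateProb_eq_zero hX hq _) (stateProb_eq_zero hX hq _)
        (fun t _ => (stateProb_mono_antitone hX r).2 _) (fun t _ => ?_) (fun t _ => ?_)
        (fun n hn => ?_) ?_ (fun m j a b d => ?_)
      · rw [stateProb_zero_right, stateProb_zero_right]
      · rw [stateProb_zero_right, hone]
      · rw [stateProb.eq_4]; exact min_le_right _ _
      · rw [stateProb.eq_4]; exact min_le_left _ _
      · rw [hone]; exact hbar r (by omega) n hn
      · rw [hone, hrow r (by omega)]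
      · rw [← hrn]; exact le_tailValue a b d
  have := key p le_rfl
  rw [Nat.sub_self, ← Finset.range_eq_Ico] at this
  refine this.trans (le_of_eq ?_)
  rw [Finset.sum_range_succ']
  simp [stateProb]

theorem sum_Icc_min {p q : ℕ} (x : triInds p q → ℝ) (i j : ℕ) :
    ∑ m ∈ Finset.Icc j (min i q), entry x (i, m) =
      ∑ m ∈ Finset.Ico j (q + 1), entry x (i, m) := by
  refine Finset.sum_subset (fun m hm => ?_) fun m hm hm' => ?_
  · simp only [Finset.mem_Icc, Finset.mem_Ico] at hm ⊢; omega
  · refine entry_of_notMem _ fun h => hm' ?_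
    have := mem_triInds.1 h
    simp only [Finset.mem_Icc, Finset.mem_Ico] at hm ⊢; omega

theorem sum_Ico_one {M : Type*} [AddCommMonoid M] (g : ℕ → M) (n : ℕ) :
    ∑ m ∈ Finset.Ico 1 (n + 1), g m = ∑ t ∈ Finset.range n, g (t + 1) := by
  rw [Finset.range_eq_Ico, Finset.sum_Ico_add' g 0 n 1, zero_add]

theorem linear_eq_sum_entry {p q : ℕ} (L : (triInds p q → ℝ) →ₗ[ℝ] ℝ) :
    ∃ c : ℕ → ℕ → ℝ, ∀ y, L y = ∑ i ∈ Finset.range p, ∑ t ∈ Finset.range q,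
      c (i + 1) (t + 1) * entry y (i + 1, t + 1) := by
  classical
  obtain ⟨c, hc⟩ : ∃ c : ℕ → ℕ → ℝ, ∀ i j, c i j =
      if h : (i, j) ∈ triInds p q then L (Pi.single ⟨(i, j), h⟩ 1) else 0 := ⟨_, fun _ _ => rfl⟩
  refine ⟨c, fun y => ?_⟩
  have h1 : L y = ∑ ij : triInds p q, entry y ij.1 * c ij.1.1 ij.1.2 := by
    rw [LinearMap.pi_apply_eq_sum_univ L y]
    refine Finset.sum_congr rfl fun ij _ => ?_
    rw [hc, dif_pos ij.2, entry_of_mem y ij.2, smul_eq_mul]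
    congr 2
    ext kl
    rw [Pi.single_apply]
    exact if_congr eq_comm rfl rfl
  rw [h1, Finset.sum_coe_sort (triInds p q) fun ij => entry y ij * c ij.1 ij.2,
    ← sum_Ico_one (fun i => ∑ t ∈ Finset.range q, c i (t + 1) * entry y (i, t + 1))]
  rw [Finset.sum_congr rfl fun i _ => (sum_Ico_one (fun j => c i j * entry y (i, j)) q).symm]
  rw [← Finset.sum_product']
  refine Finset.sum_subset_zero_on_sdiff (fun ij h => ?_) (fun ij h => ?_) fun ij _ => mul_comm _ _
  · obtain ⟨a, b, c, d, -⟩ := mem_triInds.1 (show (ij.1, ij.2) ∈ triInds p q from h)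
    simp only [Finset.mem_product, Finset.mem_Ico]
    omega
  · rw [entry_of_notMem y (Finset.mem_sdiff.1 h).2, mul_zero]

theorem finite_growthVec (p q : ℕ) :
    {v | ∃ f, IsGrowth q p f ∧ v = growthVec p q f}.Finite := by
  refine (Set.Finite.pi' (t := fun _ : triInds p q => ({0, 1} : Set ℝ))
    fun _ => Set.toFinite _).subset ?_
  rintro _ ⟨f, -, rfl⟩ ij
  unfold growthVec
  split_ifs <;> simp

section solution

variable {p q : ℕ} {x : triInds p q → ℝ}

theorem sum_entry_eq_one (hx : x ∈ solutionSet p q (system p q)) {i : ℕ} (hi : i < p) :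
    ∑ m ∈ Finset.Ico 1 (q + 1), entry x (i + 1, m) = 1 := by
  rw [← sum_Icc_min]
  exact (mem_solutionSet_system.1 hx).1 _ (by omega) hi

theorem entry_one_one (hq : 1 ≤ q) (hqp : q ≤ p) (hx : x ∈ solutionSet p q (system p q)) :
    entry x (1, 1) = 1 := by
  have := (mem_solutionSet_system.1 hx).1 1 le_rfl (by omega)
  rwa [min_eq_left hq, Finset.Icc_self, Finset.sum_singleton] at this

theorem entry_diag_succ_le (hqp : q ≤ p) (hx : x ∈ solutionSet p q (system p q)) {c : ℕ}
    (h2 : 2 ≤ c) (hc : c + 1 ≤ q) : entry x (c + 1, c + 1) ≤ entry x (c, c) := by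
  have := (mem_solutionSet_system.1 hx).2.2 (c + 1) 1 (fun _ => c) le_rfl (by omega) hc (by omega)
    ⟨by intros; omega, by intros; omega, by intros; omega, by intros; omega, by intros; omega⟩
  simpa [min_eq_left hc] using this

/-- The entries on the diagonal are non-negative because they decrease. -/
theorem entry_nonneg (hq : 1 ≤ q) (hqp : q ≤ p) (hx : x ∈ solutionSet p q (system p q))
    (i j : ℕ) : 0 ≤ entry x (i, j) := by
  by_cases h : (i, j) ∈ triInds p q
  swap
  · rw [entry_of_notMem x h]
  have hnn := (mem_solutionSet_system.1 hx).2.1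
  by_cases h' : i = j ∧ j < q
  swap
  · exact hnn i j h h'
  obtain ⟨rfl, hlt⟩ := h'
  rcases Nat.lt_or_ge i 2 with h2 | h2
  · obtain rfl : i = 1 := by have := mem_triInds.1 h; omega
    rw [entry_one_one hq hqp hx]
    exact zero_le_one
  · have hlast : 0 ≤ entry x (q, q) :=
      hnn q q (mem_triInds.2 ⟨hq, hqp, hq, le_rfl, le_rfl⟩) (by omega)
    exact Nat.decreasingInduction' (P := fun k => 0 ≤ entry x (k, k))
      (fun k hk hik ih => ih.trans (entry_diag_succ_le hqp hx (by omega) hk)) hlt.le hlast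

theorem sum_entry_le_one (hq : 1 ≤ q) (hqp : q ≤ p) (hx : x ∈ solutionSet p q (system p q))
    {i j : ℕ} (hi : i < p) (hj : 1 ≤ j) :
    ∑ m ∈ Finset.Ico j (q + 1), entry x (i + 1, m) ≤ 1 := by
  rw [← sum_entry_eq_one hx hi]
  exact Finset.sum_le_sum_of_subset_of_nonneg (Finset.Ico_subset_Ico_left hj)
    fun m _ _ => entry_nonneg hq hqp hx _ _

/-- The bars are bounded by the state probabilities of the preceding row; here the shifted column
inequalities are used. -/
theorem bar_le_stateProb_prev (hq : 1 ≤ q) (hqp : q ≤ p)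
    (hx : x ∈ solutionSet p q (system p q)) {i j : ℕ} (hi : i < p) (hj : 1 ≤ j) :
    ∑ m ∈ Finset.Ico (j + 1) (q + 1), entry x (i + 1, m) ≤
      stateProb (fun i j => entry x (i, j)) i j := by
  have hX := entry_nonneg hq hqp hx
  have hF := stateProb_nonneg (X := fun i j => entry x (i, j)) hX i j
  rcases Nat.lt_or_ge j q with hjq | hjq
  swap
  · rwa [Finset.Ico_eq_empty_of_le (by omega), Finset.sum_empty]
  rcases Nat.lt_or_ge i j with hij | hij
  · rw [← sum_Icc_min, Finset.Icc_eq_empty_of_lt (by omega), Finset.sum_empty]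
    exact hF
  obtain ⟨e, rfl⟩ := Nat.exists_eq_add_of_le hij
  have hle : ∀ c, c + 2 ≤ q → entry x (c + 2, c + 2) ≤ 1 := fun c hc =>
    (Finset.single_le_sum (f := fun m => entry x (c + 1 + 1, m)) (fun m _ => hX _ m)
      (Finset.mem_Ico.2 ⟨by omega, by omega⟩)).trans
        (sum_entry_le_one hq hqp hx (show c + 1 < p by omega) (le_refl 1))
  rcases exists_path_le_stateProb (q := q) (X := fun i j => entry x (i, j)) hX
    (entry_one_one hq hqp hx) hle
    (fun c h2 hc => entry_diag_succ_le hqp hx h2 hc) e j hj hjq.le with h | ⟨γ, h, h'⟩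
  · exact (sum_entry_le_one hq hqp hx hi (by omega)).trans h
  · refine le_trans ?_ h'
    have h2 := h.two_le 0 (by omega)
    have h3 := h.le_max 0 (by omega)
    have := (mem_solutionSet_system.1 hx).2.2 (j + 1) (e + 1) γ (by omega) (by omega) (by omega)
      (by omega) h
    rwa [show j + 1 + (e + 1) - 1 = j + e + 1 by omega, sum_Icc_min] at this

theorem bar_le_stateProb (hq : 1 ≤ q) (hqp : q ≤ p) (hx : x ∈ solutionSet p q (system p q))
    {i n : ℕ} (hi : i < p) (hn : n ≤ q) :
    ∑ m ∈ Finset.Ico (n + 1) (q + 1), entry x (i + 1, m) ≤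
      stateProb (fun i j => entry x (i, j)) (i + 1) (n + 1) := by
  have hX := entry_nonneg hq hqp hx
  rcases Nat.eq_zero_or_pos n with rfl | hn0
  · rw [stateProb_one hX (entry_one_one hq hqp hx), zero_add, sum_entry_eq_one hx hi]
  rcases hn.eq_or_lt with rfl | hlt
  · rw [Finset.Ico_self, Finset.sum_empty]
    exact stateProb_nonneg hX _ _
  rw [stateProb]
  refine le_min (bar_le_stateProb_prev hq hqp hx hi hn0) ?_
  rw [Finset.sum_eq_sum_Ico_succ_bot (by omega), add_comm]
  exact add_le_add_left (bar_le_stateProb_prev hq hqp hx hi (by omega)) _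

end solution

/-- A point of the solution set cannot be separated from the vertices, since the reward of any
linear functional is at most that of the best restricted growth function. -/
theorem solutionSet_subset {p q : ℕ} (hq : 1 ≤ q) (hqp : q ≤ p) :
    solutionSet p q (system p q) ⊆ orbipartTri p q := by
  intro x hx
  rw [orbipartTri_eq]
  by_contra hxn
  obtain ⟨L, u, hL, hu⟩ := geometric_hahn_banach_closed_point (convex_convexHull ℝ _)
    ((finite_growthVec p q).isClosed_convexHull ℝ) hxn
  obtain ⟨c, hc⟩ := linear_eq_sum_entry L.toLinearMap
  have hX := entry_nonneg hq hqp hx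
  have h1 := reward_le_tailValue (p := p) (q := q) (X := fun i j => entry x (i, j)) (c := c) hX
    (entry_one_one hq hqp hx)
    (fun i => entry_of_notMem x fun h => by have := mem_triInds.1 h; omega)
    (fun i hi => by rw [← sum_Ico_one fun j => entry x (i + 1, j)]; exact sum_entry_eq_one hx hi)
    (fun i hi n hn => by
      have h1 := sum_entry_eq_one hx hi
      have h2 := bar_le_stateProb hq hqp hx hi hn
      rw [← Finset.sum_Ico_consecutive _ (show 1 ≤ n + 1 by omega) (by omega)] at h1
      rw [← sum_Ico_one fun j => entry x (i + 1, j)]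
      linarith)
  obtain ⟨g, hg, -, h2⟩ := exists_growth_eq_tailValue hq c p le_rfl id
    (by rw [Nat.sub_self]; intro i hi; omega)
  have h3 : L (growthVec p q g) = tailValue p q c p 0 := by
    rw [Nat.sub_self, runMax, ← Finset.range_eq_Ico] at h2
    rw [← h2]
    refine (hc _).trans (Finset.sum_congr rfl fun i hi => ?_)
    have hi := Finset.mem_range.1 hi
    have hb := hg i hi
    rw [Finset.sum_eq_single (g (i + 1) - 1)]
    · rw [entry_growthVec hg (by omega) hi, show g (i + 1) - 1 + 1 = g (i + 1) by omega,
        if_pos rfl, mul_one]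
    · intro t _ ht
      have ht' : ¬ g (i + 1) = t + 1 := by omega
      rw [entry_growthVec hg (by omega) hi, if_neg ht', mul_zero]
    · intro h
      rw [Finset.mem_range] at h
      omega
  have h4 := hL _ (subset_convexHull ℝ _ ⟨g, hg, rfl⟩)
  have h5 := hc x
  change L x = _ at h5
  linarith

/-! ### Points that violate a single constraint -/

theorem val_sci {p q : ℕ} (x : triInds p q → ℝ) (j η : ℕ) (γ : ℕ → ℕ) :
    (Constraint.sci j ((List.range η).map γ)).val x =
      ∑ k ∈ Finset.range η, entry x (γ k + k, γ k) -
        ∑ m ∈ Finset.Icc j (min (j + η - 1) q), entry x (j + η - 1, m) := by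
  simp only [Constraint.val, List.length_map, List.length_range, LinearMap.sub_apply, sumLin_apply]
  rw [sumOver_bar, sumOver_shiftedCol]

/-- The slack `w(S) - w(B)` of a shifted column inequality for an array `w` of weights. -/
def slack (q : ℕ) (w : ℕ → ℕ → ℝ) (j η : ℕ) (γ : ℕ → ℕ) : ℝ :=
  ∑ k ∈ Finset.range η, w (γ k + k) (γ k) -
    ∑ m ∈ Finset.Icc j (min (j + η - 1) q), w (j + η - 1) m

/-- Arbitrary weights outside the first column are, up to scaling, the entries of a point that
satisfies all row-sum equations and is positive in the first column. -/
theorem exists_point {p q : ℕ} (hq : 1 ≤ q) (w : ℕ → ℕ → ℝ) :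
    ∃ (x : triInds p q → ℝ) (N : ℝ), 0 < N ∧
      (∀ i, 1 ≤ i → i ≤ p → (Constraint.row i).Holds x) ∧
      (∀ i, 1 ≤ i → i ≤ p → 0 < entry x (i, 1)) ∧
      (∀ i j, (i, j) ∈ triInds p q → 2 ≤ j → entry x (i, j) = w i j / N) ∧
      (∀ j η γ, 3 ≤ j → j + η - 1 ≤ p → j ≤ q → IsPath η (j - 1) γ →
        (Constraint.sci j ((List.range η).map γ)).val x = slack q w j η γ / N) := by
  set N : ℝ := 1 + ∑ i ∈ Finset.Icc 1 p, ∑ j ∈ Finset.Icc 2 q, |w i j| with hN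
  have hN1 : 1 ≤ N := le_add_of_nonneg_right
    (Finset.sum_nonneg fun i _ => Finset.sum_nonneg fun j _ => abs_nonneg _)
  have hN0 : 0 < N := by linarith
  have hrow : ∀ i, 1 ≤ i → i ≤ p → ∑ m ∈ Finset.Icc 2 (min i q), w i m / N < 1 := by
    intro i h1 h2
    rw [← Finset.sum_div, div_lt_one hN0]
    calc ∑ m ∈ Finset.Icc 2 (min i q), w i m
        ≤ ∑ m ∈ Finset.Icc 2 (min i q), |w i m| := Finset.sum_le_sum fun m _ => le_abs_self _
      _ ≤ ∑ m ∈ Finset.Icc 2 q, |w i m| := Finset.sum_le_sum_of_subset_of_nonneg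
          (Finset.Icc_subset_Icc_right (min_le_right _ _)) fun m _ _ => abs_nonneg _
      _ ≤ ∑ i ∈ Finset.Icc 1 p, ∑ j ∈ Finset.Icc 2 q, |w i j| :=
          Finset.single_le_sum (f := fun i => ∑ j ∈ Finset.Icc 2 q, |w i j|)
            (fun i _ => Finset.sum_nonneg fun j _ => abs_nonneg _) (Finset.mem_Icc.2 ⟨h1, h2⟩)
      _ < N := by linarith
  set x : triInds p q → ℝ := fun ij => if ij.1.2 = 1 then
    1 - ∑ m ∈ Finset.Icc 2 (min ij.1.1 q), w ij.1.1 m / N else w ij.1.1 ij.1.2 / N with hx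
  have h1 : ∀ i, 1 ≤ i → i ≤ p →
      entry x (i, 1) = 1 - ∑ m ∈ Finset.Icc 2 (min i q), w i m / N := by
    intro i h1 h2
    rw [entry_of_mem x (mem_triInds.2 ⟨h1, h2, le_rfl, hq, h1⟩)]
    simp [hx]
  have h2 : ∀ i j, (i, j) ∈ triInds p q → 2 ≤ j → entry x (i, j) = w i j / N := by
    intro i j hij hj
    rw [entry_of_mem x hij]
    simp only [hx]
    rw [if_neg (by omega)]
  refine ⟨x, N, hN0, fun i hi hip => ?_, fun i hi hip => ?_, h2, fun j η γ hj hp hjq h => ?_⟩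
  · rw [holds_row, ← Finset.add_sum_Ioc_eq_sum_Icc (by omega), h1 i hi hip]
    have : ∑ m ∈ Finset.Ioc 1 (min i q), entry x (i, m) =
        ∑ m ∈ Finset.Icc 2 (min i q), w i m / N := by
      refine Finset.sum_congr (by ext m; simp only [Finset.mem_Ioc, Finset.mem_Icc]; omega) ?_
      intro m hm
      simp only [Finset.mem_Icc] at hm
      exact h2 i m (mem_triInds.2 ⟨hi, hip, by omega, by omega, by omega⟩) (by omega)
    rw [this]
    ring
  · rw [h1 i hi hip]
    linarith [hrow i hi hip]
  · rw [val_sci, slack, sub_div, Finset.sum_div, Finset.sum_div]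
    congr 1
    · refine Finset.sum_congr rfl fun k hk => ?_
      have hk := Finset.mem_range.1 hk
      have a := h.two_le k hk
      have b := h.le_max k hk
      exact h2 _ _ (mem_triInds.2 ⟨by omega, by omega, by omega, by omega, by omega⟩) a
    · refine Finset.sum_congr rfl fun m hm => ?_
      simp only [Finset.mem_Icc] at hm
      exact h2 _ _ (mem_triInds.2 ⟨by omega, by omega, by omega, by omega, by omega⟩) (by omega)

/-- In diagonal coordinates, the slack compares the entries on the same diagonals; a diagonal may
miss the bar if the row of the bar is below row `q`. -/
theorem slack_diag {q : ℕ} (φ : ℕ → ℕ → ℝ) {j η : ℕ} (hj : 1 ≤ j) (γ : ℕ → ℕ) :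
    slack q (fun i j => φ (i - j) j) j η γ =
      ∑ k ∈ Finset.range η, (φ k (γ k) -
        if j + η - 1 - k ≤ q then φ k (j + η - 1 - k) else 0) := by
  rw [slack, Finset.sum_sub_distrib]
  congr 1
  · exact Finset.sum_congr rfl fun k _ => by rw [Nat.add_sub_cancel_left]
  · rw [← Finset.sum_filter]
    refine Finset.sum_nbij' (fun m => j + η - 1 - m) (fun k => j + η - 1 - k) ?_ ?_ ?_ ?_ ?_
    · intro m hm; simp only [Finset.mem_Icc, Finset.mem_filter, Finset.mem_range] at hm ⊢; omega
    · intro m hm; simp only [Finset.mem_Icc, Finset.mem_filter, Finset.mem_range] at hm ⊢; omega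
    · intro m hm; simp only [Finset.mem_Icc] at hm ⊢; omega
    · intro m hm; simp only [Finset.mem_filter, Finset.mem_range] at hm ⊢; omega
    · intro m hm
      simp only [Finset.mem_Icc] at hm
      rw [show j + η - 1 - (j + η - 1 - m) = m by omega]

/-- Weights for which all inequalities of the system are strict. -/
def interiorWeight (q k c : ℕ) : ℝ :=
  if k = 0 then 2 * (q + 1) - 2 * c else 1

theorem interiorWeight_pos {q k c : ℕ} (hc : c ≤ q) : 0 < interiorWeight q k c := by
  unfold interiorWeight
  have : (c : ℝ) ≤ q := by exact_mod_cast hc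
  split_ifs <;> linarith

/-- The array with the weights `interiorWeight`. -/
def interiorArray (q i j : ℕ) : ℝ := interiorWeight q (i - j) j

theorem two_le_slack_interior {q j η : ℕ} {γ : ℕ → ℕ} (hη : 1 ≤ η) (hj : 3 ≤ j) (hjq : j ≤ q)
    (h : IsPath η (j - 1) γ) : 2 ≤ slack q (interiorArray q) j η γ := by
  obtain ⟨n, rfl⟩ := Nat.exists_eq_add_of_le' hη
  rw [show interiorArray q = fun i j => interiorWeight q (i - j) j from rfl,
    slack_diag _ (by omega), Finset.sum_range_succ']
  have h1 : 0 ≤ ∑ k ∈ Finset.range n, (interiorWeight q (k + 1) (γ (k + 1)) -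
      if j + (n + 1) - 1 - (k + 1) ≤ q then
        interiorWeight q (k + 1) (j + (n + 1) - 1 - (k + 1)) else 0) := by
    refine Finset.sum_nonneg fun k _ => ?_
    simp only [interiorWeight, if_neg (Nat.succ_ne_zero k)]
    split_ifs <;> norm_num
  have h2 := h.le_max 0 (by omega)
  have h3 : (γ 0 : ℝ) + 1 ≤ j := by exact_mod_cast (show γ 0 + 1 ≤ j by omega)
  have h4 : (j : ℝ) ≤ (j + (n + 1) - 1 - 0 : ℕ) := by
    exact_mod_cast (show j ≤ j + (n + 1) - 1 - 0 by omega)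
  have h5 : (j : ℝ) ≤ q := by exact_mod_cast hjq
  have h6 : 2 ≤ interiorWeight q 0 (γ 0) -
      if j + (n + 1) - 1 - 0 ≤ q then interiorWeight q 0 (j + (n + 1) - 1 - 0) else 0 := by
    simp only [interiorWeight, if_true]
    split_ifs <;> linarith
  linarith

theorem slack_interior_eq {q j η : ℕ} {γ : ℕ → ℕ} (hη : 1 ≤ η) (hj : 1 ≤ j)
    (hq : j + η - 1 ≤ q) :
    slack q (interiorArray q) j η γ = 2 * ((j + η - 1 : ℕ) : ℝ) - 2 * γ 0 := by
  obtain ⟨n, rfl⟩ := Nat.exists_eq_add_of_le' hη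
  rw [show interiorArray q = fun i j => interiorWeight q (i - j) j from rfl,
    slack_diag _ (by omega), Finset.sum_range_succ', Finset.sum_eq_zero]
  · rw [if_pos (by omega)]
    simp only [interiorWeight, if_true, Nat.sub_zero]
    ring
  · intro k _
    rw [if_pos (by omega)]
    simp [interiorWeight]

theorem exists_interior_point {p q : ℕ} (hq : 1 ≤ q) :
    ∃ x : triInds p q → ℝ, (∀ i, 1 ≤ i → i ≤ p → (Constraint.row i).Holds x) ∧
      ∀ l : Constraint, l.Listed p q → l.IsIneq → 0 < l.val x := by
  obtain ⟨x, N, hN, h1, h2, h3, h4⟩ := exists_point (p := p) hq (interiorArray q)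
  refine ⟨x, h1, fun l hl hi => ?_⟩
  cases l with
  | row => exact hi.elim
  | nonneg i j =>
    rw [Constraint.val, entryLin_apply]
    obtain ⟨a, b, c, d, e⟩ := mem_triInds.1 hl.1
    rcases c.eq_or_lt with rfl | hj
    · exact h2 i a b
    · rw [h3 i j hl.1 hj]
      exact div_pos (interiorWeight_pos d) hN
  | sci j cs =>
    obtain ⟨γ, hγ⟩ := exists_eq_map_range cs
    rw [hγ] at hl ⊢
    obtain ⟨a, b, c, d, e⟩ := listed_sci.1 hl
    rw [h4 _ _ _ b d c e]
    exact div_pos (by linarith [two_le_slack_interior a b c e]) hN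

/-- The constraint `l` is not implied by the other constraints of the system: some point violates
`l` only. -/
def Irredundant (p q : ℕ) (l : Constraint) : Prop :=
  ∃ x : triInds p q → ℝ, (∀ m, m.Listed p q → m ≠ l → m.Holds x) ∧ ¬ l.Holds x

theorem exists_holds_of_weights {p q : ℕ} (hq : 1 ≤ q) (w : ℕ → ℕ → ℝ) (l : Constraint)
    (hl : l.IsIneq)
    (hw : ∀ i j, (i, j) ∈ triInds p q → 2 ≤ j → Constraint.nonneg i j ≠ l → 0 ≤ w i j)
    (hs : ∀ j η γ, 1 ≤ η → 3 ≤ j → j ≤ q → j + η - 1 ≤ p → IsPath η (j - 1) γ →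
      Constraint.sci j ((List.range η).map γ) ≠ l → 0 ≤ slack q w j η γ)
    (hn : (∃ i j, l = .nonneg i j ∧ (i, j) ∈ triInds p q ∧ 2 ≤ j ∧ w i j < 0) ∨
      ∃ j η γ, l = .sci j ((List.range η).map γ) ∧ 3 ≤ j ∧ j ≤ q ∧ j + η - 1 ≤ p ∧
        IsPath η (j - 1) γ ∧ slack q w j η γ < 0) : Irredundant p q l := by
  obtain ⟨x, N, hN, h1, h2, h3, h4⟩ := exists_point (p := p) hq w
  refine ⟨x, fun m hm hml => ?_, ?_⟩
  · cases m with
    | row i =>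
      obtain ⟨a, b⟩ : 1 ≤ i ∧ i ≤ p := Finset.mem_Icc.1 hm
      exact h1 i a b
    | nonneg i j =>
      obtain ⟨a, b, c, d, e⟩ := mem_triInds.1 hm.1
      rcases c.eq_or_lt with rfl | hj
      · exact (h2 i a b).le
      · rw [Constraint.Holds, h3 i j hm.1 hj]
        exact div_nonneg (hw i j hm.1 hj hml) hN.le
    | sci j cs =>
      obtain ⟨γ, hγ⟩ := exists_eq_map_range cs
      rw [hγ] at hm hml ⊢
      obtain ⟨a, b, c, d, e⟩ := listed_sci.1 hm
      rw [Constraint.IsIneq.holds_iff (l := .sci _ _) trivial, h4 _ _ _ b d c e]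
      exact div_nonneg (hs _ _ _ a b c d e hml) hN.le
  · rw [hl.holds_iff, not_le]
    rcases hn with ⟨i, j, rfl, a, b, c⟩ | ⟨j, η, γ, rfl, a, b, c, d, e⟩
    · rw [Constraint.val, entryLin_apply, h3 i j a b]
      exact div_neg_of_neg_of_pos c hN
    · rw [h4 _ _ _ a c b d]
      exact div_neg_of_neg_of_pos e hN

theorem irredundant_nonneg_of_two_le {p q a b : ℕ} (hl : (Constraint.nonneg a b).Listed p q)
    (hb : 2 ≤ b) : Irredundant p q (.nonneg a b) := by
  obtain ⟨hmem, hdiag⟩ := hl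
  obtain ⟨ha1, hap, hb1, hbq, hba⟩ := mem_triInds.1 hmem
  set w : ℕ → ℕ → ℝ := fun i j => if i = a ∧ j = b then -1 else interiorArray q i j with hw
  refine exists_holds_of_weights (by omega) w _ trivial (fun i j hij hj hne => ?_)
    (fun j η γ h1 h2 h3 h4 h5 _ => ?_) (Or.inl ⟨a, b, rfl, hmem, hb, by simp [hw]⟩)
  · simp only [hw]
    rw [if_neg (by rintro ⟨rfl, rfl⟩; exact hne rfl)]
    exact (interiorWeight_pos (mem_triInds.1 hij).2.2.2.1).le
  · refine le_trans (?_ : 0 ≤ slack q (interiorArray q) j η γ - 2) ?_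
    · linarith [two_le_slack_interior h1 h2 h3 h5]
    rw [slack, slack, sub_right_comm]
    refine sub_le_sub ?_ (Finset.sum_le_sum fun m hm => ?_)
    · -- the shifted column loses at most `2`, and only in its position on the diagonal of `(a, b)`
      have key : ∀ k ∈ Finset.range η, interiorArray q (γ k + k) (γ k) -
          (if k = a - b then 2 else 0) ≤ w (γ k + k) (γ k) := by
        intro k hk
        have hk := Finset.mem_range.1 hk
        have hk' := h5.le_max k hk
        simp only [hw]
        by_cases e : γ k + k = a ∧ γ k = b
        · have hk0 : k ≠ 0 := by rintro rfl; omega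
          rw [if_pos e, if_pos (by omega), interiorArray, interiorWeight, if_neg (by omega)]
          norm_num
        · rw [if_neg e]
          split_ifs <;> linarith
      refine le_trans ?_ (Finset.sum_le_sum key)
      rw [Finset.sum_sub_distrib, Finset.sum_ite_eq']
      split_ifs <;> linarith
    · simp only [hw]
      split_ifs
      · simp only [Finset.mem_Icc] at hm
        have := interiorWeight_pos (q := q) (k := j + η - 1 - m) (c := m) (by omega)
        rw [interiorArray]
        linarith
      · exact le_rfl

/-- If every other shifted column inequality whose bar contains the leader of the bar of `l` has
a larger slack than `l`, then raising the weight of this leader violates `l` alone. -/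
theorem irredundant_sci_of_slack {p q j₀ η₀ : ℕ} {γ₀ : ℕ → ℕ} (w : ℕ → ℕ → ℝ)
    (hl : (Constraint.sci j₀ ((List.range η₀).map γ₀)).Listed p q)
    (hw : ∀ i j, (i, j) ∈ triInds p q → 0 ≤ w i j)
    (hs : ∀ j η γ, 1 ≤ η → 3 ≤ j → j ≤ q → j + η - 1 ≤ p → IsPath η (j - 1) γ →
      0 ≤ slack q w j η γ)
    (hgap : ∀ j η γ, 1 ≤ η → 3 ≤ j → j ≤ j₀ → j + η = j₀ + η₀ → IsPath η (j - 1) γ →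
      (j = j₀ → ∃ k, k < η ∧ γ k ≠ γ₀ k) → slack q w j₀ η₀ γ₀ + 1 ≤ slack q w j η γ) :
    Irredundant p q (.sci j₀ ((List.range η₀).map γ₀)) := by
  obtain ⟨a, b, c, d, e⟩ := listed_sci.1 hl
  set Δ : ℝ := slack q w j₀ η₀ γ₀ + 1 with hΔ
  have hΔ0 : 0 < Δ := by linarith [hs _ _ _ a b c d e]
  set w' : ℕ → ℕ → ℝ := fun i j => w i j + if i = j₀ + η₀ - 1 ∧ j = j₀ then Δ else 0 with hw'
  have hpath : ∀ j η γ, slack q w' j η γ = slack q w j η γ +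
      (∑ k ∈ Finset.range η, if γ k + k = j₀ + η₀ - 1 ∧ γ k = j₀ then Δ else 0) -
      ∑ m ∈ Finset.Icc j (min (j + η - 1) q),
        if j + η - 1 = j₀ + η₀ - 1 ∧ m = j₀ then Δ else 0 := by
    intro j η γ
    simp only [slack, hw', Finset.sum_add_distrib]
    ring
  have hmono : ∀ (η : ℕ) (γ : ℕ → ℕ), 0 ≤
      ∑ k ∈ Finset.range η, if γ k + k = j₀ + η₀ - 1 ∧ γ k = j₀ then Δ else 0 :=
    fun η γ => Finset.sum_nonneg fun k _ => by split_ifs <;> linarith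
  refine exists_holds_of_weights (by omega) w' _ trivial (fun i j hij _ _ => ?_)
    (fun j η γ h1 h2 h3 h4 h5 hne => ?_) (Or.inr ⟨_, _, _, rfl, b, c, d, e, ?_⟩)
  · exact add_nonneg (hw i j hij) (by split_ifs <;> linarith)
  · rw [hpath]
    have h6 := hmono η γ
    by_cases hcase : j + η - 1 = j₀ + η₀ - 1 ∧ j ≤ j₀
    · have h7 := hgap j η γ h1 h2 hcase.2 (by omega) h5 (by
        rintro rfl
        by_contra! h
        refine hne ?_
        obtain rfl : η = η₀ := by omega
        rw [List.map_congr_left fun k hk => h k (List.mem_range.1 hk)])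
      simp only [hcase.1, true_and]
      rw [Finset.sum_ite_eq']
      split_ifs <;> linarith
    · rw [Finset.sum_eq_zero (s := Finset.Icc j _)]
      · linarith [hs j η γ h1 h2 h3 h4 h5]
      · intro m hm
        rw [if_neg]
        rintro ⟨h8, rfl⟩
        exact hcase ⟨h8, (Finset.mem_Icc.1 hm).1⟩
  · rw [hpath, Finset.sum_eq_zero (s := Finset.range η₀)]
    · simp only [true_and]
      rw [Finset.sum_ite_eq', if_pos (Finset.mem_Icc.2 ⟨le_rfl, by omega⟩)]
      linarith
    · intro k hk
      have := e.le_max k (Finset.mem_range.1 hk)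
      rw [if_neg (by omega)]

theorem irredundant_sci_one {p q j₀ : ℕ} {γ₀ : ℕ → ℕ}
    (hl : (Constraint.sci j₀ ((List.range 1).map γ₀)).Listed p q) :
    Irredundant p q (.sci j₀ ((List.range 1).map γ₀)) := by
  obtain ⟨a, b, c, d, e⟩ := listed_sci.1 hl
  refine irredundant_sci_of_slack (interiorArray q) hl
    (fun i j hij => (interiorWeight_pos (mem_triInds.1 hij).2.2.2.1).le)
    (fun j η γ h1 h2 h3 h4 h5 => by linarith [two_le_slack_interior h1 h2 h3 h5])
    (fun j η γ h1 h2 h3 h4 h5 h6 => ?_)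
  rw [slack_interior_eq (j := j₀) le_rfl (by omega) (by omega), slack_interior_eq h1 (by omega) (by omega)]
  have h7 := e.start_one rfl
  have h8 : γ 0 + 1 ≤ γ₀ 0 := by
    rcases h3.eq_or_lt with rfl | h
    · obtain ⟨k, hk, hk'⟩ := h6 rfl
      obtain rfl : k = 0 := by omega
      have := h5.start_one (by omega)
      omega
    · have := h5.le_max 0 h1
      omega
  have h9 : j₀ + 1 - 1 = j + η - 1 := by rw [h4]
  rw [h9]
  have : (γ 0 : ℝ) + 1 ≤ γ₀ 0 := by exact_mod_cast h8
  linarith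

/-- Weights for which the shifted column `γ₀` of length at least two is the unique lightest one to
the left of its bar. The contributions of the first two positions of a shifted column, which are in
the same column, balance each other. -/
def sciWeight (p q η₀ : ℕ) (γ₀ : ℕ → ℕ) (k c : ℕ) : ℝ :=
  if k = 0 then (2 * p + 2) * (q + 1 - c)
  else if k = 1 then (q + 1 + (2 * p + 2) * c) + (if c = γ₀ 1 then 0 else 2)
  else if k < η₀ then (q + 1) + (if c = γ₀ k then 0 else 2)
  else q + 1 - c

theorem sciWeight_nonneg {p q η₀ : ℕ} {γ₀ : ℕ → ℕ} {k c : ℕ} (hc : c ≤ q) :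
    0 ≤ sciWeight p q η₀ γ₀ k c := by
  have h1 : (c : ℝ) ≤ q := by exact_mod_cast hc
  have h2 : (0 : ℝ) ≤ c := Nat.cast_nonneg c
  have h3 : (0 : ℝ) ≤ p := Nat.cast_nonneg p
  unfold sciWeight
  have h4 : 0 ≤ (2 * (p : ℝ) + 2) * (q + 1 - c) := mul_nonneg (by linarith) (by linarith)
  have h5 : 0 ≤ (2 * (p : ℝ) + 2) * c := mul_nonneg (by linarith) h2
  split_ifs <;> linarith

theorem slack_sciWeight_nonneg {p q η₀ j η : ℕ} {γ₀ γ : ℕ → ℕ} (hη : 1 ≤ η) (hj : 3 ≤ j)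
    (hjq : j ≤ q) (hp : j + η - 1 ≤ p) (h : IsPath η (j - 1) γ) :
    0 ≤ slack q (fun i j => sciWeight p q η₀ γ₀ (i - j) j) j η γ := by
  rw [slack_diag _ (by omega)]
  have hp0 : (0 : ℝ) ≤ p := Nat.cast_nonneg p
  rcases hη.eq_or_lt with rfl | hη
  · rw [Finset.sum_range_one, if_pos (by omega), sub_nonneg]
    simp only [sciWeight, if_true]
    have h2 := h.le_max 0 (by omega)
    have h3 : (γ 0 : ℝ) ≤ (j + 1 - 1 - 0 : ℕ) := by exact_mod_cast (show γ 0 ≤ j + 1 - 1 - 0 by omega)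
    exact mul_le_mul_of_nonneg_left (by linarith) (by linarith)
  obtain ⟨n, rfl⟩ : ∃ n, η = n + 1 + 1 := ⟨η - 2, by omega⟩
  rw [Finset.sum_range_succ',
    Finset.sum_range_succ']
  set i := j + (n + 1 + 1) - 1 with hi
  have h1 : ∑ k ∈ Finset.range n, (-2 : ℝ) ≤ ∑ k ∈ Finset.range n,
      (sciWeight p q η₀ γ₀ (k + 1 + 1) (γ (k + 1 + 1)) -
        if i - (k + 1 + 1) ≤ q then sciWeight p q η₀ γ₀ (k + 1 + 1) (i - (k + 1 + 1)) else 0) := by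
    refine Finset.sum_le_sum fun k hk => ?_
    have hk := Finset.mem_range.1 hk
    have h2 := h.le_max (k + 1 + 1) (by omega)
    have h3 : (γ (k + 1 + 1) : ℝ) ≤ (i - (k + 1 + 1) : ℕ) := by
      exact_mod_cast (show γ (k + 1 + 1) ≤ i - (k + 1 + 1) by omega)
    have h4 : (γ (k + 1 + 1) : ℝ) ≤ q := by
      exact_mod_cast (show γ (k + 1 + 1) ≤ q by omega)
    simp only [sciWeight, if_neg (show ¬ k + 1 + 1 = 0 by omega),
      if_neg (show ¬ k + 1 + 1 = 1 by omega)]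
    have hq0 : (0 : ℝ) ≤ q := Nat.cast_nonneg q
    split_ifs <;> linarith
  rw [Finset.sum_const, Finset.card_range, nsmul_eq_mul] at h1
  have h2 : (n : ℝ) + 2 ≤ p := by exact_mod_cast (show n + 2 ≤ p by omega)
  have h3 : 2 * (p : ℝ) + 2 - 2 ≤
      (sciWeight p q η₀ γ₀ (0 + 1) (γ (0 + 1)) -
        if i - (0 + 1) ≤ q then sciWeight p q η₀ γ₀ (0 + 1) (i - (0 + 1)) else 0) +
      (sciWeight p q η₀ γ₀ 0 (γ 0) -
        if i - 0 ≤ q then sciWeight p q η₀ γ₀ 0 (i - 0) else 0) := by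
    have e : γ 0 = γ 1 := h.start_eq hη
    have hi1 : ((i - (0 + 1) : ℕ) : ℝ) = i - 1 := by
      rw [Nat.cast_sub (by omega)]; norm_num
    simp only [sciWeight, if_true, zero_add, one_ne_zero, if_false, e] at hi1 ⊢
    rw [hi1, Nat.sub_zero]
    have hq0 : (0 : ℝ) ≤ q := Nat.cast_nonneg q
    have h4 : (i - 1 ≤ q) → (2 * (p : ℝ) + 2) * ((i : ℝ) - 1) ≤ (2 * (p : ℝ) + 2) * q := by
      intro h
      refine mul_le_mul_of_nonneg_left ?_ (by linarith)
      rw [sub_le_iff_le_add]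
      exact_mod_cast (show i ≤ q + 1 by omega)
    have h5 : 0 ≤ (2 * (p : ℝ) + 2) * q := mul_nonneg (by linarith) hq0
    by_cases c1 : i ≤ q
    · rw [if_pos c1, if_pos (show i - 1 ≤ q by omega)]
      split_ifs <;> linarith
    · rw [if_neg c1]
      by_cases c2 : i - 1 ≤ q
      · have h4 := h4 c2
        rw [if_pos c2]
        split_ifs <;> linarith
      · rw [if_neg c2]
        split_ifs <;> linarith
  linarith

theorem sum_sciWeight_sub {p q n : ℕ} {γ₀ γ : ℕ → ℕ} (h0 : γ₀ 0 = γ₀ 1) (h : γ 0 = γ 1) :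
    ∑ k ∈ Finset.range (n + 2), (sciWeight p q (n + 2) γ₀ k (γ k) -
        sciWeight p q (n + 2) γ₀ k (γ₀ k)) =
      ∑ k ∈ Finset.range (n + 1), if γ (k + 1) = γ₀ (k + 1) then 0 else 2 := by
  rw [Finset.sum_range_succ', Finset.sum_range_succ', Finset.sum_range_succ' _ n, add_assoc]
  congr 1
  · refine Finset.sum_congr rfl fun k hk => ?_
    have hk := Finset.mem_range.1 hk
    simp only [sciWeight, if_neg (show ¬ k + 1 + 1 = 0 by omega),
      if_neg (show ¬ k + 1 + 1 = 1 by omega), if_pos (show k + 1 + 1 < n + 2 by omega), if_true]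
    ring
  · simp only [sciWeight, zero_add, one_ne_zero, if_false, if_true, h, h0]
    ring

theorem irredundant_sci_of_two_le {p q j₀ η₀ : ℕ} {γ₀ : ℕ → ℕ} (hη₀ : 2 ≤ η₀)
    (hl : (Constraint.sci j₀ ((List.range η₀).map γ₀)).Listed p q) :
    Irredundant p q (.sci j₀ ((List.range η₀).map γ₀)) := by
  obtain ⟨a, b, c, d, e⟩ := listed_sci.1 hl
  refine irredundant_sci_of_slack (fun i j => sciWeight p q η₀ γ₀ (i - j) j) hl
    (fun i j hij => sciWeight_nonneg (mem_triInds.1 hij).2.2.2.1)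
    (fun j η γ h1 h2 h3 h4 h5 => slack_sciWeight_nonneg h1 h2 h3 h4 h5)
    (fun j η γ h1 h2 h3 h4 h5 h6 => ?_)
  obtain ⟨n, rfl⟩ := Nat.exists_eq_add_of_le' hη₀
  obtain ⟨δ, rfl⟩ : ∃ δ, η = n + 2 + δ := ⟨η - (n + 2), by omega⟩
  rw [slack_diag _ (by omega), slack_diag _ (by omega),
    show j₀ + (n + 2) - 1 = j + (n + 2 + δ) - 1 by rw [h4], Finset.sum_range_add _ (n + 2) δ]
  set i := j + (n + 2 + δ) - 1 with hi
  have hsum := sum_sciWeight_sub (p := p) (q := q) (n := n) (e.start_eq hη₀)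
    (h5.start_eq (by omega))
  rw [Finset.sum_sub_distrib] at hsum
  rw [Finset.sum_sub_distrib, Finset.sum_sub_distrib]
  -- the positions beyond the length of `γ₀`
  have htail : (δ : ℝ) ≤ ∑ k ∈ Finset.range δ, (sciWeight p q (n + 2) γ₀ (n + 2 + k)
      (γ (n + 2 + k)) - if i - (n + 2 + k) ≤ q then
        sciWeight p q (n + 2) γ₀ (n + 2 + k) (i - (n + 2 + k)) else 0) := by
    have : (δ : ℝ) = ∑ k ∈ Finset.range δ, (1 : ℝ) := by simp
    rw [this]
    refine Finset.sum_le_sum fun k hk => ?_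
    have hk := Finset.mem_range.1 hk
    have h7 := h5.le_max (n + 2 + k) (by omega)
    rw [if_pos (by omega)]
    simp only [sciWeight, if_neg (show ¬ n + 2 + k = 0 by omega),
      if_neg (show ¬ n + 2 + k = 1 by omega), if_neg (show ¬ n + 2 + k < n + 2 by omega)]
    have : (γ (n + 2 + k) : ℝ) + 1 ≤ (i - (n + 2 + k) : ℕ) := by
      exact_mod_cast (show γ (n + 2 + k) + 1 ≤ i - (n + 2 + k) by omega)
    linarith
  have hnn : ∀ k ∈ Finset.range (n + 1), (0 : ℝ) ≤ if γ (k + 1) = γ₀ (k + 1) then 0 else 2 :=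
    fun k _ => by split_ifs <;> norm_num
  have hmain : (1 : ℝ) ≤ (∑ k ∈ Finset.range (n + 1), if γ (k + 1) = γ₀ (k + 1) then 0 else 2)
      + δ := by
    rcases h3.eq_or_lt with rfl | hlt
    · obtain ⟨k, hk, hk'⟩ := h6 rfl
      obtain ⟨k, hk, hk'⟩ : ∃ k, k < n + 1 ∧ γ (k + 1) ≠ γ₀ (k + 1) := by
        cases k with
        | zero =>
          refine ⟨0, by omega, ?_⟩
          rwa [h5.start_eq (by omega), e.start_eq hη₀] at hk'
        | succ k => exact ⟨k, by omega, hk'⟩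
      have := Finset.single_le_sum hnn (Finset.mem_range.2 hk)
      rw [if_neg hk'] at this
      have : (0 : ℝ) ≤ δ := Nat.cast_nonneg δ
      linarith
    · have : (1 : ℝ) ≤ δ := by exact_mod_cast (show 1 ≤ δ by omega)
      linarith [Finset.sum_nonneg hnn]
  linarith

theorem entry_add_single {p q : ℕ} (x : triInds p q → ℝ) {ij : ℕ × ℕ} (h : ij ∈ triInds p q)
    (c : ℝ) (kl : ℕ × ℕ) :
    entry (x + Pi.single ⟨ij, h⟩ c) kl = entry x kl + if kl = ij then c else 0 := by
  by_cases hkl : kl ∈ triInds p q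
  · rw [entry_of_mem _ hkl, entry_of_mem _ hkl, Pi.add_apply, Pi.single_apply]
    simp only [Subtype.mk.injEq]
  · rw [entry_of_notMem _ hkl, entry_of_notMem _ hkl, if_neg (by rintro rfl; exact hkl h), add_zero]

/-- Coordinates in the first column do not occur in the shifted column inequalities. -/
theorem val_sci_add_single_one {p q j η i : ℕ} {γ : ℕ → ℕ} (hj : 3 ≤ j)
    (hγ : IsPath η (j - 1) γ) (x : triInds p q → ℝ) (h : (i, 1) ∈ triInds p q) (c : ℝ) :
    (Constraint.sci j ((List.range η).map γ)).val (x + Pi.single ⟨(i, 1), h⟩ c) =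
      (Constraint.sci j ((List.range η).map γ)).val x := by
  rw [val_sci, val_sci]
  congr 1
  · refine Finset.sum_congr rfl fun k hk => ?_
    have := hγ.two_le k (Finset.mem_range.1 hk)
    rw [entry_add_single, if_neg (by rw [Prod.mk.injEq]; omega), add_zero]
  · refine Finset.sum_congr rfl fun m hm => ?_
    have := (Finset.mem_Icc.1 hm).1
    rw [entry_add_single, if_neg (by rw [Prod.mk.injEq]; omega), add_zero]

theorem irredundant_row {p q i : ℕ} (hq : 1 ≤ q) (h1 : 1 ≤ i) (hi : i ≤ p) :
    Irredundant p q (.row i) := by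
  obtain ⟨x, hx, hpos⟩ := exists_interior_point (p := p) hq
  have hmem : (i, 1) ∈ triInds p q := mem_triInds.2 ⟨h1, hi, le_rfl, hq, h1⟩
  refine ⟨x + Pi.single ⟨(i, 1), hmem⟩ 1, fun m hm hne => ?_, ?_⟩
  · cases m with
    | row k =>
      obtain ⟨a, b⟩ : 1 ≤ k ∧ k ≤ p := Finset.mem_Icc.1 hm
      have h := (holds_row x).1 (hx k a b)
      rw [holds_row, ← h]
      refine Finset.sum_congr rfl fun m _ => ?_
      rw [entry_add_single, if_neg, add_zero]
      rintro ⟨⟩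
      exact hne rfl
    | nonneg k l =>
      have := hpos _ hm trivial
      rw [Constraint.val, entryLin_apply] at this
      rw [Constraint.Holds, entry_add_single]
      split_ifs <;> linarith
    | sci j cs =>
      have := hpos _ hm trivial
      obtain ⟨γ, hγ⟩ := exists_eq_map_range cs
      rw [hγ] at hm this ⊢
      obtain ⟨a, b, c, d, e⟩ := listed_sci.1 hm
      rw [Constraint.IsIneq.holds_iff (l := .sci _ _) trivial, val_sci_add_single_one b e]
      exact this.le
  · have h := (holds_row x).1 (hx i h1 hi)
    rw [holds_row]
    simp only [entry_add_single, Prod.mk.injEq, true_and]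
    rw [Finset.sum_add_distrib, h, Finset.sum_ite_eq',
      if_pos (Finset.mem_Icc.2 ⟨le_rfl, by omega⟩)]
    norm_num

/-- Weight can be moved from `(i, 1)` to `(i, 2)`, since no bar of the system contains `(i, 2)`. -/
theorem irredundant_nonneg_one {p q i : ℕ} (hq : 2 ≤ q) (h2 : 2 ≤ i) (hi : i ≤ p) :
    Irredundant p q (.nonneg i 1) := by
  obtain ⟨x, hx, hpos⟩ := exists_interior_point (p := p) (show 1 ≤ q by omega)
  have hmem : (i, 1) ∈ triInds p q := mem_triInds.2 ⟨by omega, hi, le_rfl, by omega, by omega⟩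
  have hmem2 : (i, 2) ∈ triInds p q := mem_triInds.2 ⟨by omega, hi, by omega, by omega, h2⟩
  set c := entry x (i, 1) with hc
  have hc0 : 0 < c := by
    have := hpos (.nonneg i 1) ⟨hmem, by omega⟩ trivial
    rwa [Constraint.val, entryLin_apply] at this
  refine ⟨x + Pi.single ⟨(i, 2), hmem2⟩ (2 * c) + Pi.single ⟨(i, 1), hmem⟩ (-(2 * c)),
    fun m hm hne => ?_, ?_⟩
  · cases m with
    | row k =>
      obtain ⟨a, b⟩ : 1 ≤ k ∧ k ≤ p := Finset.mem_Icc.1 hm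
      have h := (holds_row x).1 (hx k a b)
      rw [holds_row]
      simp only [entry_add_single, Prod.mk.injEq]
      rw [Finset.sum_add_distrib, Finset.sum_add_distrib, h]
      by_cases hk : k = i
      · subst hk
        simp only [true_and]
        rw [Finset.sum_ite_eq', Finset.sum_ite_eq', if_pos (Finset.mem_Icc.2 ⟨by omega, by omega⟩),
          if_pos (Finset.mem_Icc.2 ⟨by omega, by omega⟩)]
        ring
      · simp [hk]
    | nonneg k l =>
      have := hpos _ hm trivial
      rw [Constraint.val, entryLin_apply] at this
      rw [Constraint.Holds, entry_add_single, entry_add_single, if_neg (c := (k, l) = (i, 1))]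
      · split_ifs <;> linarith
      · rintro ⟨⟩
        exact hne rfl
    | sci j cs =>
      have := hpos _ hm trivial
      obtain ⟨γ, hγ⟩ := exists_eq_map_range cs
      rw [hγ] at hm this ⊢
      obtain ⟨a, b, c', d, e⟩ := listed_sci.1 hm
      rw [Constraint.IsIneq.holds_iff (l := .sci _ _) trivial, val_sci_add_single_one b e]
      refine this.le.trans ?_
      rw [val_sci, val_sci]
      refine sub_le_sub (Finset.sum_le_sum fun k _ => ?_) (Finset.sum_le_sum fun m hm => ?_)
      · rw [entry_add_single]
        split_ifs <;> linarith
      · have := (Finset.mem_Icc.1 hm).1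
        rw [entry_add_single, if_neg (by rw [Prod.mk.injEq]; omega), add_zero]
  · rw [Constraint.Holds, entry_add_single, entry_add_single, if_neg (by simp), if_pos rfl, ← hc]
    linarith

theorem irredundant_of_listed {p q : ℕ} (hq : 2 ≤ q) {l : Constraint} (hl : l.Listed p q) :
    Irredundant p q l := by
  cases l with
  | row i =>
    obtain ⟨a, b⟩ : 1 ≤ i ∧ i ≤ p := Finset.mem_Icc.1 hl
    exact irredundant_row (by omega) a b
  | nonneg i j =>
    obtain ⟨a, b, c, d, e⟩ := mem_triInds.1 hl.1
    rcases c.eq_or_lt with rfl | hj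
    · have := hl.2
      exact irredundant_nonneg_one hq (by omega) b
    · exact irredundant_nonneg_of_two_le hl hj
  | sci j cs =>
    obtain ⟨γ, hγ⟩ := exists_eq_map_range cs
    rw [hγ] at hl ⊢
    obtain ⟨a, -⟩ := listed_sci.1 hl
    rcases a.eq_or_lt with h | h
    · rw [← h] at hl ⊢
      exact irredundant_sci_one hl
    · exact irredundant_sci_of_two_le h hl

theorem solutionSet_ssubset {p q : ℕ} (hq : 2 ≤ q) {l : Constraint} (hl : l ∈ system p q) :
    solutionSet p q (system p q) ⊂ solutionSet p q (system p q \ {l}) := by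
  obtain ⟨x, h1, h2⟩ := irredundant_of_listed hq hl
  have hsub : solutionSet p q (system p q) ⊆ solutionSet p q (system p q \ {l}) :=
    fun y hy m hm => hy m hm.1
  refine (Set.ssubset_iff_of_subset hsub).2 ⟨x, fun m hm => h1 m hm.1 hm.2, fun hx => h2 (hx l hl)⟩

/-! ### Facets -/

theorem finite_listed (p q : ℕ) : {l : Constraint | l.Listed p q}.Finite := by
  have hlist : {cs : List ℕ | cs.length ≤ p ∧ ∀ a ∈ cs, a ≤ q}.Finite := by
    refine ((List.finite_length_le (Fin (q + 1)) p).image (List.map Fin.val)).subset ?_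
    rintro cs ⟨h1, h2⟩
    have h3 : ∀ a ∈ cs, a < q + 1 := fun a ha => Nat.lt_succ_of_le (h2 a ha)
    exact ⟨cs.pmap (fun a ha => ⟨a, ha⟩) h3, by simpa using h1, by simp [List.map_pmap]⟩
  refine (((Set.finite_Icc 1 p).image Constraint.row).union
    (((triInds p q).finite_toSet.image fun ij => Constraint.nonneg ij.1 ij.2).union
      (Set.Finite.image2 Constraint.sci (Set.finite_Icc 1 q) hlist))).subset ?_
  rintro l hl
  cases l with
  | row i => exact Or.inl ⟨i, Finset.mem_Icc.1 hl, rfl⟩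
  | nonneg i j => exact Or.inr (Or.inl ⟨(i, j), hl.1, rfl⟩)
  | sci j cs =>
    obtain ⟨h1, h2, h3, -, h4, -⟩ := hl
    obtain ⟨a, b, c, d, e⟩ := mem_triInds.1 h3
    exact Or.inr (Or.inr ⟨j, ⟨c, d⟩, cs, ⟨by omega, fun a ha => by have := h4 a ha; omega⟩, rfl⟩)

/-- The directions in which all row sums are constant. -/
noncomputable def rowDirections (p q : ℕ) : Submodule ℝ (triInds p q → ℝ) :=
  ⨅ i ∈ Finset.Icc 1 p, LinearMap.ker (sumLin (row q i))

theorem mem_rowDirections {p q : ℕ} {d : triInds p q → ℝ} :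
    d ∈ rowDirections p q ↔ ∀ i ∈ Finset.Icc 1 p, sumLin (row q i) d = 0 := by
  simp [rowDirections]

theorem exists_pos_forall_val_nonneg {p q : ℕ} {T : Set Constraint} (hT : T.Finite)
    {z : triInds p q → ℝ} (hz : ∀ m ∈ T, 0 < m.val z) (d : triInds p q → ℝ) :
    ∃ ε : ℝ, 0 < ε ∧ ∀ m ∈ T, 0 ≤ m.val (z + ε • d) := by
  have h : ∀ᶠ ε : ℝ in nhdsWithin 0 (Set.Ioi 0), ∀ m ∈ T, 0 < m.val (z + ε • d) := by
    rw [Filter.eventually_all_finite hT]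
    intro m hm
    have hc : Continuous fun ε : ℝ => m.val z + ε * m.val d := by fun_prop
    have := hc.tendsto 0
    rw [zero_mul, add_zero] at this
    filter_upwards [(this.mono_left nhdsWithin_le_nhds).eventually (lt_mem_nhds (hz m hm))] with ε hε
    simpa using hε
  obtain ⟨ε, h1, h2⟩ := (h.and self_mem_nhdsWithin).exists
  exact ⟨ε, h2, fun m hm => (h1 m hm).le⟩

theorem vectorSpan_eq_of_exists_pos {V : Type*} [AddCommGroup V] [Module ℝ V] {A : Set V}
    {E : Submodule ℝ V} {z : V} (hz : z ∈ A) (hA : ∀ x ∈ A, ∀ y ∈ A, x - y ∈ E)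
    (hE : ∀ d ∈ E, ∃ ε : ℝ, 0 < ε ∧ z + ε • d ∈ A) : vectorSpan ℝ A = E := by
  apply le_antisymm
  · refine Submodule.span_le.2 ?_
    rintro _ ⟨x, hx, y, hy, rfl⟩
    exact hA x hx y hy
  · intro d hd
    obtain ⟨ε, h1, h2⟩ := hE d hd
    have := vsub_mem_vectorSpan ℝ h2 hz
    rw [vsub_eq_sub, add_sub_cancel_left] at this
    simpa [h1.ne'] using (vectorSpan ℝ A).smul_mem ε⁻¹ this

theorem holds_row_add {p q i : ℕ} {z d : triInds p q → ℝ} (hi : i ∈ Finset.Icc 1 p)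
    (hz : (Constraint.row i).Holds z) (hd : d ∈ rowDirections p q) (ε : ℝ) :
    (Constraint.row i).Holds (z + ε • d) := by
  simp only [Constraint.Holds, ← sumLin_apply] at hz ⊢
  rw [map_add, map_smul, hz, mem_rowDirections.1 hd i hi, smul_zero, add_zero]

theorem sub_mem_rowDirections {p q : ℕ} {x y : triInds p q → ℝ}
    (hx : ∀ i ∈ Finset.Icc 1 p, (Constraint.row i).Holds x)
    (hy : ∀ i ∈ Finset.Icc 1 p, (Constraint.row i).Holds y) : x - y ∈ rowDirections p q := by
  refine mem_rowDirections.2 fun i hi => ?_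
  have h1 := hx i hi
  have h2 := hy i hi
  simp only [Constraint.Holds, ← sumLin_apply] at h1 h2
  rw [map_sub, h1, h2, sub_self]

/-- An irredundant inequality of a system with an interior point defines a facet: on the segment
from the interior point to a point that violates this inequality only, there is a point at which it
is tight and all other inequalities are strict. -/
theorem definesFacet_of_listed {p q : ℕ} (hq : 2 ≤ q) {l : Constraint} (hl : l.Listed p q)
    (hi : l.IsIneq) : DefinesFacet (solutionSet p q (system p q)) l := by
  obtain ⟨x, hxrow, hx⟩ := exists_interior_point (p := p) (show 1 ≤ q by omega)
  obtain ⟨y, hy, hyl⟩ := irredundant_of_listed hq hl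
  rw [hi.holds_iff, not_le] at hyl
  have hxrow' : ∀ i ∈ Finset.Icc 1 p, (Constraint.row i).Holds x := fun i hi =>
    hxrow i (Finset.mem_Icc.1 hi).1 (Finset.mem_Icc.1 hi).2
  have hyrow : ∀ i ∈ Finset.Icc 1 p, (Constraint.row i).Holds y := fun i hi' =>
    hy (.row i) hi' (by rintro rfl; exact hi)
  have hxl := hx l hl hi
  set a := l.val x with ha
  set b := l.val y with hb
  have hab : 0 < a - b := by linarith
  set t := a / (a - b) with ht
  have ht0 : 0 < t := div_pos hxl hab
  have ht1 : t < 1 := by rw [ht, div_lt_one hab]; linarith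
  set z := x + t • (y - x) with hz
  have hval : ∀ m : Constraint, m.val z = (1 - t) * m.val x + t * m.val y := by
    intro m
    rw [hz, map_add, map_smul, map_sub, smul_eq_mul]
    ring
  have hzl : l.val z = 0 := by
    rw [hval, ← ha, ← hb, ht]
    field_simp
    ring
  have hzrow : ∀ i ∈ Finset.Icc 1 p, (Constraint.row i).Holds z := fun i hi =>
    holds_row_add hi (hxrow' i hi) (sub_mem_rowDirections hyrow hxrow') t
  have hzpos : ∀ m ∈ {m : Constraint | m.Listed p q ∧ m.IsIneq ∧ m ≠ l}, 0 < m.val z := by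
    rintro m ⟨h1, h2, h3⟩
    rw [hval]
    have := hx m h1 h2
    have := (h2.holds_iff y).1 (hy m h1 h3)
    exact add_pos_of_pos_of_nonneg (mul_pos (by linarith) (by assumption))
      (mul_nonneg ht0.le this)
  have hmem : ∀ w : triInds p q → ℝ, (∀ i ∈ Finset.Icc 1 p, (Constraint.row i).Holds w) →
      (∀ m : Constraint, m.Listed p q → m.IsIneq → 0 ≤ m.val w) →
      w ∈ solutionSet p q (system p q) := by
    intro w h1 h2 m hm
    cases m with
    | row i => exact h1 i hm
    | nonneg i j => exact (Constraint.IsIneq.holds_iff (l := .nonneg i j) trivial w).2 (h2 _ hm trivial)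
    | sci j cs => exact (Constraint.IsIneq.holds_iff (l := .sci j cs) trivial w).2 (h2 _ hm trivial)
  have hrowP : ∀ w ∈ solutionSet p q (system p q), ∀ i ∈ Finset.Icc 1 p,
      (Constraint.row i).Holds w := fun w hw i hi => hw (.row i) hi
  have hface : ∀ w : triInds p q → ℝ, (∀ i ∈ Finset.Icc 1 p, (Constraint.row i).Holds w) →
      (∀ m ∈ {m : Constraint | m.Listed p q ∧ m.IsIneq ∧ m ≠ l}, 0 ≤ m.val w) → l.val w = 0 →
      w ∈ {w | w ∈ solutionSet p q (system p q) ∧ l.Tight w} := by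
    intro w h1 h2 h3
    refine ⟨hmem w h1 fun m hm hm' => ?_, (hi.tight_iff w).2 h3⟩
    by_cases e : m = l
    · rw [e, h3]
    · exact h2 m ⟨hm, hm', e⟩
  have hzface := hface z hzrow (fun m hm => (hzpos m hm).le) hzl
  have hspanP : vectorSpan ℝ (solutionSet p q (system p q)) = rowDirections p q := by
    refine vectorSpan_eq_of_exists_pos (hmem x hxrow' fun m h1 h2 => (hx m h1 h2).le)
      (fun u hu v hv => sub_mem_rowDirections (hrowP u hu) (hrowP v hv)) fun d hd => ?_
    obtain ⟨ε, h1, h2⟩ := exists_pos_forall_val_nonneg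
      (T := {m : Constraint | m.Listed p q ∧ m.IsIneq})
      ((finite_listed p q).subset fun m hm => hm.1) (fun m hm => hx m hm.1 hm.2) d
    exact ⟨ε, h1, hmem _ (fun i hi => holds_row_add hi (hxrow' i hi) hd ε)
      fun m a b => h2 m ⟨a, b⟩⟩
  have hspanF : vectorSpan ℝ {w | w ∈ solutionSet p q (system p q) ∧ l.Tight w} =
      rowDirections p q ⊓ LinearMap.ker l.val := by
    refine vectorSpan_eq_of_exists_pos hzface (fun u hu v hv => ⟨sub_mem_rowDirections
      (hrowP u hu.1) (hrowP v hv.1), ?_⟩) fun d hd => ?_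
    · rw [SetLike.mem_coe, LinearMap.mem_ker, map_sub, (hi.tight_iff u).1 hu.2,
        (hi.tight_iff v).1 hv.2, sub_zero]
    · obtain ⟨ε, h1, h2⟩ := exists_pos_forall_val_nonneg
        ((finite_listed p q).subset fun m hm => hm.1) hzpos d
      refine ⟨ε, h1, hface _ (fun i hi => holds_row_add hi (hzrow i hi) hd.1 ε) h2 ?_⟩
      rw [map_add, map_smul, hzl, LinearMap.mem_ker.1 hd.2, smul_zero, add_zero]
  refine ⟨fun w hw => hw l hl, ⟨z, hzface⟩, ?_⟩
  rw [hspanP, hspanF, ← Submodule.map_comap_subtype, Submodule.finrank_map_subtype_eq,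
    ← LinearMap.ker_comp]
  refine Module.Dual.finrank_ker_add_one_of_ne_zero fun h => ?_
  have h1 := LinearMap.congr_fun h ⟨x - z, sub_mem_rowDirections hxrow' hzrow⟩
  simp only [LinearMap.comp_apply, Submodule.subtype_apply, LinearMap.zero_apply, map_sub, hzl,
    sub_zero] at h1
  exact hxl.ne' h1

/-! ### Lightest shifted columns -/

/-- The weight of a lightest shifted column `{(γ k + k, γ k) | k < η}` with `IsPath η c γ`, where
`r = c + η - 1`. For `c < r` the position in the last row used is `(r, c)`, or else the shifted
column stays to the left of column `c`. -/
def lightest (X : ℕ → ℕ → ℚ) : ℕ → ℕ → ℚ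
  | 0, _ => 0
  | r + 1, c =>
    if c < r + 1 then
      if 3 ≤ c then min (lightest X r (c - 1)) (lightest X r c + X (r + 1) c)
      else lightest X r c + X (r + 1) c
    else X (r + 1) c

theorem lightest_of_le {X : ℕ → ℕ → ℚ} {r c : ℕ} (hr : 1 ≤ r) (h : r ≤ c) :
    lightest X r c = X r c := by
  obtain ⟨r, rfl⟩ := Nat.exists_eq_add_of_le' hr
  rw [lightest, if_neg (by omega)]

theorem lightest_of_lt {X : ℕ → ℕ → ℚ} {r c : ℕ} (h : c < r) (hc : c < 3) :
    lightest X r c = lightest X (r - 1) c + X r c := by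
  obtain ⟨r, rfl⟩ := Nat.exists_eq_add_of_le' (show 1 ≤ r by omega)
  rw [lightest, if_pos h, if_neg (by omega), Nat.add_sub_cancel]

theorem lightest_of_three_le {X : ℕ → ℕ → ℚ} {r c : ℕ} (h : c < r) (hc : 3 ≤ c) :
    lightest X r c = min (lightest X (r - 1) (c - 1)) (lightest X (r - 1) c + X r c) := by
  obtain ⟨r, rfl⟩ := Nat.exists_eq_add_of_le' (show 1 ≤ r by omega)
  rw [lightest, if_pos h, if_pos hc, Nat.add_sub_cancel]

theorem lightest_le {X : ℕ → ℕ → ℚ} {γ : ℕ → ℕ} (e c : ℕ) (hc : 2 ≤ c)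
    (h : IsPath (e + 1) c γ) :
    lightest X (c + e) c ≤ ∑ k ∈ Finset.range (e + 1), X (γ k + k) (γ k) := by
  induction hN : c + e generalizing c e with
  | zero => omega
  | succ N ih =>
    rcases Nat.eq_zero_or_pos e with rfl | he
    · rw [lightest_of_le (by omega) (by omega), zero_add, Finset.sum_range_one, h.start_one rfl,
        add_zero, ← hN, add_zero]
    obtain ⟨e, rfl⟩ := Nat.exists_eq_add_of_le' he
    rcases (h.le_max (e + 1) (by omega)).eq_or_lt with hlast | hlast
    · -- the last position is in column `c`
      have h1 : IsPath (e + 1) c γ := ⟨fun k hk => h.two_le k (by omega),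
        fun k hk => h.le_max k (by omega), fun k hk => h.mono_succ k (by omega),
        fun _ => h.start_eq (by omega), fun he => by
          obtain rfl : e = 0 := by omega
          rw [h.start_eq (by omega), hlast]⟩
      have h2 := ih e c hc h1 (by omega)
      rw [Finset.sum_range_succ, hlast, show c + (e + 1) = N + 1 by omega]
      refine le_trans ?_ (add_le_add_left h2 _)
      rcases Nat.lt_or_ge c 3 with h3 | h3
      · rw [lightest_of_lt (by omega) h3, Nat.add_sub_cancel]
      · rw [lightest_of_three_le (by omega) h3, Nat.add_sub_cancel]
        exact min_le_right _ _
    · have h3 := h.two_le (e + 1) (by omega)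
      have h1 : IsPath (e + 1 + 1) (c - 1) γ := ⟨h.two_le,
        fun k hk => (h.mono (show k ≤ e + 1 by omega) (by omega)).trans (by omega), h.mono_succ,
        h.start_eq, by omega⟩
      have h2 := ih (e + 1) (c - 1) (by omega) h1 (by omega)
      rw [lightest_of_three_le (by omega) (by omega), Nat.add_sub_cancel]
      exact (min_le_left _ _).trans h2

/-! ### Reasoning about programs -/

/-- Started in state `s`, the program `P` halts after at most `T` steps in a state with the
property `Q`. -/
def Runs (P : Prog) (s : Ram) (T : ℕ) (Q : Ram → Prop) : Prop :=
  ∃ t s', Exec P s t s' ∧ t ≤ T ∧ Q s'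

theorem Runs.imp {P : Prog} {s : Ram} {T : ℕ} {Q Q' : Ram → Prop} (h : Runs P s T Q)
    (hQ : ∀ s', Q s' → Q' s') : Runs P s T Q' := by
  obtain ⟨t, s', h1, h2, h3⟩ := h
  exact ⟨t, s', h1, h2, hQ s' h3⟩

theorem Runs.seq {P P' : Prog} {s : Ram} {T T' : ℕ} {Q Q' : Ram → Prop} (h : Runs P s T Q)
    (h' : ∀ s', Q s' → Runs P' s' T' Q') : Runs (.seq P P') s (T + T') Q' := by
  obtain ⟨t, s₁, h1, h2, h3⟩ := h
  obtain ⟨t', s₂, h4, h5, h6⟩ := h' s₁ h3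
  exact ⟨t + t', s₂, .seq h1 h4, by omega, h6⟩

theorem Runs.ite {b : Test} {P P' : Prog} {s : Ram} {T : ℕ} {Q : Ram → Prop}
    (h : b.IsTrue s → Runs P s T Q) (h' : ¬ b.IsTrue s → Runs P' s T Q) :
    Runs (.ite b P P') s (T + 1) Q := by
  by_cases hb : b.IsTrue s
  · obtain ⟨t, s', h1, h2, h3⟩ := h hb
    exact ⟨t + 1, s', .ite_true hb h1, by omega, h3⟩
  · obtain ⟨t, s', h1, h2, h3⟩ := h' hb
    exact ⟨t + 1, s', .ite_false hb h1, by omega, h3⟩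

theorem Runs.mono {P : Prog} {s : Ram} {T T' : ℕ} {Q : Ram → Prop} (h : Runs P s T Q)
    (hT : T ≤ T') : Runs P s T' Q := by
  obtain ⟨t, s', h1, h2, h3⟩ := h
  exact ⟨t, s', h1, h2.trans hT, h3⟩

/-- The rule for loops: the index of the invariant `I` bounds the number of remaining rounds. -/
theorem Runs.loop {b : Test} {P : Prog} {T : ℕ} (I : ℕ → Ram → Prop)
    (hstep : ∀ n s, I n s → b.IsTrue s → ∃ m, n = m + 1 ∧ Runs P s T (I m)) {n : ℕ} {s : Ram}
    (h : I n s) :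
    Runs (.loop b P) s (n * (T + 1) + 1) fun s' => ¬ b.IsTrue s' ∧ ∃ m, I m s' := by
  induction n generalizing s with
  | zero =>
    have hb : ¬ b.IsTrue s := fun hb => by
      obtain ⟨m, hm, -⟩ := hstep 0 s h hb
      omega
    exact ⟨1, s, .loop_false hb, by omega, hb, 0, h⟩
  | succ n ih =>
    by_cases hb : b.IsTrue s
    · obtain ⟨m, hm, t, s', h1, h2, h3⟩ := hstep _ s h hb
      obtain rfl : n = m := by omega
      obtain ⟨t', s'', h4, h5, h6⟩ := ih h3
      refine ⟨t + t' + 1, s'', .loop_true hb h1 h4, ?_, h6⟩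
      rw [Nat.succ_mul]
      omega
    · exact ⟨1, s, .loop_false hb, by omega, hb, n + 1, h⟩

/-- The program does not contain loops. -/
def Prog.LoopFree : Prog → Prop
  | .instr _ => True
  | .seq P Q => P.LoopFree ∧ Q.LoopFree
  | .ite _ P Q => P.LoopFree ∧ Q.LoopFree
  | .loop _ _ => False

/-- A bound on the number of steps of a program without loops. -/
def Prog.cost : Prog → ℕ
  | .instr _ => 1
  | .seq P Q => P.cost + Q.cost
  | .ite _ P Q => P.cost + Q.cost + 1
  | .loop _ _ => 0

open Classical in
/-- The effect of a program without loops (loops are ignored). -/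
noncomputable def Prog.run : Prog → Ram → Ram
  | .instr c, s => c.eval s
  | .seq P Q, s => Q.run (P.run s)
  | .ite b P Q, s => if b.IsTrue s then P.run s else Q.run s
  | .loop _ _, s => s

theorem Prog.LoopFree.exec {P : Prog} (hP : P.LoopFree) (s : Ram) :
    ∃ t, Exec P s t (P.run s) ∧ t ≤ P.cost := by
  induction P generalizing s with
  | instr c => exact ⟨1, .instr c s, le_rfl⟩
  | seq P Q ihP ihQ =>
    obtain ⟨t, h1, h2⟩ := ihP hP.1 s
    obtain ⟨t', h3, h4⟩ := ihQ hP.2 (P.run s)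
    exact ⟨t + t', .seq h1 h3, add_le_add h2 h4⟩
  | ite b P Q ihP ihQ =>
    rw [Prog.run, Prog.cost]
    split_ifs with hb
    · obtain ⟨t, h1, h2⟩ := ihP hP.1 s
      exact ⟨t + 1, .ite_true hb h1, by omega⟩
    · obtain ⟨t, h1, h2⟩ := ihQ hP.2 s
      exact ⟨t + 1, .ite_false hb h1, by omega⟩
  | loop => exact hP.elim

theorem Prog.LoopFree.runs {P : Prog} (hP : P.LoopFree) {s : Ram} {Q : Ram → Prop}
    (h : Q (P.run s)) : Runs P s P.cost Q := by
  obtain ⟨t, h1, h2⟩ := hP.exec s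
  exact ⟨t, _, h1, h2, h⟩

/-- A sequence of elementary instructions. -/
def block : Instr → List Instr → Prog
  | c, [] => .instr c
  | c, d :: l => .seq (.instr c) (block d l)

/-! ### The separation program

Natural number registers: `0` and `1` hold `p` and `q`; `3`, `4` and `5` hold the current row `i`,
the current column `j` and `(i - 1) q`; `6`, `7` and `14` hold the constants `1`, `3` and `0`; `8`
and `9` are used for addresses; `10` holds the kind of the violated constraint recorded last (`0` if
there is none), `11`, `12` and `13` hold the row and the column where it was found and the offset of
this row; `15` holds the number of columns that the reconstruction of a shifted column still has to
find; `2` holds the length of this shifted column; `16` is scratch space.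

Rational registers: `0` and `1` hold the constants `0` and `1`; `2`, `3` and `4` hold `x_ij`, the
value of the current bar and the weight of the current lightest shifted column; `5` and `6` hold
weights from the preceding row. The rational array `1` is the table of the weights `lightest`. -/

/-- The address of the position `(i, j)`. -/
def addr (q i j : ℕ) : ℕ := (i - 1) * q + (j - 1)

/-- An instruction that only changes scratch space. -/
def skip : Prog := .instr (.nconst 16 0)

/-- Records a violated row-sum equation. -/
def recordRow : Prog := block (.nconst 10 1) [.nadd 11 3 14]

/-- Records a violated nonnegativity constraint. -/
def recordNonneg : Prog := block (.nconst 10 2) [.nadd 11 3 14, .nadd 12 4 14]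

/-- Records the leader of the bar of a violated shifted column inequality. -/
def recordSci : Prog := block (.nconst 10 3) [.nadd 11 3 14, .nadd 12 4 14, .nadd 13 5 14]

/-- Loads the data of the current position and adds `x_ij` to the bar. -/
def visitLoad : Prog :=
  block (.nadd 8 5 4) [.nsub 8 8 6, .qload 2 0 8, .qadd 3 3 2, .nsub 9 8 1, .qload 5 1 9,
    .nsub 9 9 6, .qload 6 1 9]

/-- Checks the nonnegativity constraint of the current position if it is in the system. -/
def visitNonneg : Prog :=
  .ite (.qlt 2 0) (.ite (.nlt 4 3) recordNonneg (.ite (.nle 1 4) recordNonneg skip)) skip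

/-- Compares the current bar with the lightest shifted column. -/
def visitSci : Prog :=
  .ite (.nle 7 4) (.ite (.qlt 6 3) recordSci skip) skip

/-- Computes the table entry of the current position. -/
def visitWeight : Prog :=
  .ite (.nlt 4 3)
    (.seq (.instr (.qadd 4 5 2)) (.ite (.nle 7 4) (.ite (.qlt 6 4) (.instr (.qadd 4 6 0)) skip) skip))
    (.instr (.qadd 4 2 0))

/-- Stores the table entry and moves on to the left. -/
def visitStore : Prog := block (.qstore 1 8 4) [.nsub 4 4 6]

/-- Processes one position. -/
def visit : Prog := .seq visitLoad (.seq visitNonneg (.seq visitSci (.seq visitWeight visitStore)))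

/-- Starts a row in its last position. -/
def rowStart : Prog :=
  .seq (.instr (.qconst 3 0)) (.ite (.nle 3 1) (.instr (.nadd 4 3 14)) (.instr (.nadd 4 1 14)))

/-- Checks the row-sum equation. -/
def rowCheck : Prog := .ite (.qlt 3 1) recordRow (.ite (.qlt 1 3) recordRow skip)

/-- Moves on to the next row. -/
def rowNext : Prog := block (.nadd 5 5 1) [.nadd 3 3 6]

/-- Processes one row, from right to left. -/
def sweepRow : Prog := .seq rowStart (.seq (.loop (.nle 6 4) visit) (.seq rowCheck rowNext))

/-- Initializes the constants. -/
def setup : Prog := block (.nconst 6 1) [.nconst 7 3, .qconst 1 1, .nconst 3 1]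

/-- Prepares the reconstruction of a lightest shifted column. -/
def traceStart : Prog :=
  block (.nadd 16 11 6) [.nsub 15 16 12, .nadd 2 15 14, .nsub 3 11 6, .nsub 4 12 6, .nsub 5 13 1]

/-- Loads the weights for the current position and for its neighbour on the same diagonal. -/
def traceLoad : Prog :=
  block (.nadd 8 5 4) [.nsub 8 8 6, .qload 4 1 8, .nsub 9 8 1, .nsub 9 9 6, .qload 6 1 9]

/-- Stores a column of the shifted column. -/
def traceColumn : Prog := block (.nsub 15 15 6) [.nstore 0 15 4]

/-- Decides whether the shifted column uses the current position. -/
def traceChoice : Prog :=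
  .ite (.nlt 4 3)
    (.ite (.nle 7 4) (.ite (.qle 6 4) (.instr (.nsub 4 4 6)) traceColumn) traceColumn)
    traceColumn

/-- Moves on to the row above. -/
def traceNext : Prog := block (.nsub 3 3 6) [.nsub 5 5 1]

/-- One step of the reconstruction of a lightest shifted column. -/
def traceStep : Prog := .seq traceLoad (.seq traceChoice traceNext)

/-- Writes the answer in case of a violated shifted column inequality. -/
def answerSci : Prog := block (.nconst 0 3) [.nadd 1 12 14]

/-- Writes the answer in all other cases. -/
def answerPlain : Prog := block (.nadd 0 10 14) [.nadd 1 11 14, .nadd 2 12 14]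

/-- The separation program. -/
def separationProg : Prog :=
  .seq setup (.seq (.loop (.nle 3 0) sweepRow)
    (.ite (.nle 7 10) (.seq traceStart (.seq (.loop (.nle 6 15) traceStep) answerSci)) answerPlain))

section spec

variable {p q : ℕ} {X : ℕ → ℕ → ℚ}

/-- The registers and the input array that the main loop does not change. -/
structure Env (p q : ℕ) (X : ℕ → ℕ → ℚ) (s : Ram) : Prop where
  n0 : s.nreg 0 = p
  n1 : s.nreg 1 = q
  n6 : s.nreg 6 = 1
  n7 : s.nreg 7 = 3
  n14 : s.nreg 14 = 0
  q0 : s.qreg 0 = 0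
  q1 : s.qreg 1 = 1
  input : ∀ i j, (i, j) ∈ triInds p q → s.qmem 0 (addr q i j) = X i j

/-- The positions that precede `(i, j)`, with rows being traversed from right to left, have their
entries in the table. -/
def Table (p q : ℕ) (X : ℕ → ℕ → ℚ) (i j : ℕ) (s : Ram) : Prop :=
  ∀ r c, (r, c) ∈ triInds p q → (r < i ∨ r = i ∧ j < c) → s.qmem 1 (addr q r c) = lightest X r c

/-- The value of the bar with leader `(i, j)`. -/
def barValue (q : ℕ) (X : ℕ → ℕ → ℚ) (i j : ℕ) : ℚ := ∑ m ∈ Finset.Icc j (min i q), X i m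

/-- The nonnegativity constraint of the position `(i, j)` and all shifted column inequalities whose
bar has this leader are satisfied. -/
def CellOk (q : ℕ) (X : ℕ → ℕ → ℚ) (i j : ℕ) : Prop :=
  (¬ (i = j ∧ j < q) → 0 ≤ X i j) ∧ (3 ≤ j → barValue q X i j ≤ lightest X (i - 1) (j - 1))

/-- All constraints that belong to the rows before row `i` are satisfied. -/
def RowsOk (p q : ℕ) (X : ℕ → ℕ → ℚ) (i : ℕ) : Prop :=
  ∀ r, 1 ≤ r → r < i → barValue q X r 1 = 1 ∧ ∀ c, (r, c) ∈ triInds p q → CellOk q X r c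

/-- The registers describe a constraint that is violated. -/
def Recorded (p q : ℕ) (X : ℕ → ℕ → ℚ) (s : Ram) : Prop :=
  (s.nreg 10 = 1 ∧ 1 ≤ s.nreg 11 ∧ s.nreg 11 ≤ p ∧ barValue q X (s.nreg 11) 1 ≠ 1) ∨
  (s.nreg 10 = 2 ∧ (s.nreg 11, s.nreg 12) ∈ triInds p q ∧
    ¬ (s.nreg 11 = s.nreg 12 ∧ s.nreg 12 < q) ∧ X (s.nreg 11) (s.nreg 12) < 0) ∨
  (s.nreg 10 = 3 ∧ (s.nreg 11, s.nreg 12) ∈ triInds p q ∧ 3 ≤ s.nreg 12 ∧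
    s.nreg 13 = (s.nreg 11 - 1) * q ∧
    lightest X (s.nreg 11 - 1) (s.nreg 12 - 1) < barValue q X (s.nreg 11) (s.nreg 12))

/-- Either nothing has been recorded, and then `chk` holds, or a violated constraint has been
recorded. -/
def Log (p q : ℕ) (X : ℕ → ℕ → ℚ) (chk : Prop) (s : Ram) : Prop :=
  (s.nreg 10 = 0 ∧ chk) ∨ Recorded p q X s

theorem Log.imp {chk chk' : Prop} {s : Ram} (h : Log p q X chk s) (hc : chk → chk') :
    Log p q X chk' s :=
  h.imp_left fun h => ⟨h.1, hc h.2⟩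

theorem Log.congr {chk : Prop} {s s' : Ram} (h : Log p q X chk s) (h10 : s'.nreg 10 = s.nreg 10)
    (h11 : s'.nreg 11 = s.nreg 11) (h12 : s'.nreg 12 = s.nreg 12)
    (h13 : s'.nreg 13 = s.nreg 13) : Log p q X chk s' := by
  unfold Log Recorded at h ⊢
  rwa [h10, h11, h12, h13]

/-- The states differ only in the registers used for recording and in scratch space. -/
def SameData (s s' : Ram) : Prop :=
  (∀ a, a ∉ ({10, 11, 12, 13, 16} : Finset ℕ) → s'.nreg a = s.nreg a) ∧ s'.qreg = s.qreg ∧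
    s'.nmem = s.nmem ∧ s'.qmem = s.qmem

theorem Env.of_sameData {s s' : Ram} (h : Env p q X s) (e : SameData s s') : Env p q X s' := by
  obtain ⟨e1, e2, e3, e4⟩ := e
  exact ⟨by rw [e1 _ (by decide)]; exact h.n0, by rw [e1 _ (by decide)]; exact h.n1,
    by rw [e1 _ (by decide)]; exact h.n6, by rw [e1 _ (by decide)]; exact h.n7,
    by rw [e1 _ (by decide)]; exact h.n14, by rw [e2]; exact h.q0, by rw [e2]; exact h.q1,
    by rw [e4]; exact h.input⟩

theorem sameData_skip (s : Ram) : SameData s (skip.run s) := by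
  refine ⟨fun a ha => ?_, rfl, rfl, rfl⟩
  simp only [Finset.mem_insert, Finset.mem_singleton, not_or] at ha
  simp [skip, Prog.run, Instr.eval, ha]

theorem sameData_recordRow (s : Ram) : SameData s (recordRow.run s) := by
  refine ⟨fun a ha => ?_, rfl, rfl, rfl⟩
  simp only [Finset.mem_insert, Finset.mem_singleton, not_or] at ha
  simp [recordRow, block, Prog.run, Instr.eval, ha]

theorem sameData_recordNonneg (s : Ram) : SameData s (recordNonneg.run s) := by
  refine ⟨fun a ha => ?_, rfl, rfl, rfl⟩
  simp only [Finset.mem_insert, Finset.mem_singleton, not_or] at ha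
  simp [recordNonneg, block, Prog.run, Instr.eval, ha]

theorem sameData_recordSci (s : Ram) : SameData s (recordSci.run s) := by
  refine ⟨fun a ha => ?_, rfl, rfl, rfl⟩
  simp only [Finset.mem_insert, Finset.mem_singleton, not_or] at ha
  simp [recordSci, block, Prog.run, Instr.eval, ha]

theorem Log.skip {chk : Prop} {s : Ram} (h : Log p q X chk s) : Log p q X chk (skip.run s) := by
  refine h.congr ?_ ?_ ?_ ?_ <;> simp [Orbitope.skip, Prog.run, Instr.eval]

theorem addr_inj {i j r c : ℕ} (hi : 1 ≤ i) (hr : 1 ≤ r) (hj : 1 ≤ j) (hjq : j ≤ q) (hc : 1 ≤ c)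
    (hcq : c ≤ q) (h : addr q r c = addr q i j) : r = i ∧ c = j := by
  unfold addr at h
  have h1 : ∀ a b, 1 ≤ b → b ≤ q → (a * q + (b - 1)) / q = a ∧ (a * q + (b - 1)) % q = b - 1 := by
    intro a b hb hbq
    rw [mul_comm, Nat.mul_add_div (by omega), Nat.mul_add_mod, Nat.div_eq_of_lt (by omega),
      Nat.mod_eq_of_lt (by omega)]
    exact ⟨rfl, rfl⟩
  have h2 := h1 (r - 1) c hc hcq
  have h3 := h1 (i - 1) j hj hjq
  rw [h] at h2
  omega

theorem addr_sub {i j : ℕ} (hi : 2 ≤ i) : addr q i j - q = addr q (i - 1) j := by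
  obtain ⟨i, rfl⟩ := Nat.exists_eq_add_of_le' hi
  unfold addr
  rw [show i + 2 - 1 = i + 1 by omega, show i + 1 - 1 = i by omega, Nat.succ_mul]
  omega

theorem addr_sub_one {i j : ℕ} (hj : 2 ≤ j) : addr q i j - 1 = addr q i (j - 1) := by
  unfold addr
  omega

theorem barValue_succ {i j : ℕ} (hj : 1 ≤ j) (h : j ≤ min i q) :
    barValue q X i (j - 1 + 1) = barValue q X i (j + 1) + X i j := by
  rw [Nat.sub_add_cancel hj, barValue, barValue, ← Finset.add_sum_Ioc_eq_sum_Icc h, add_comm]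
  refine congrArg (· + X i j) (Finset.sum_congr ?_ fun _ _ => rfl)
  ext m
  simp only [Finset.mem_Icc, Finset.mem_Ioc]
  omega

/-- The state before the position `(i, j)` is processed. -/
structure Before (p q : ℕ) (X : ℕ → ℕ → ℚ) (i j : ℕ) (s : Ram) : Prop where
  env : Env p q X s
  n3 : s.nreg 3 = i
  n4 : s.nreg 4 = j
  n5 : s.nreg 5 = (i - 1) * q
  q3 : s.qreg 3 = barValue q X i (j + 1)
  table : Table p q X i j s

/-- The state while the position `(i, j)` is processed. -/
structure During (p q : ℕ) (X : ℕ → ℕ → ℚ) (i j : ℕ) (s : Ram) : Prop where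
  env : Env p q X s
  n3 : s.nreg 3 = i
  n4 : s.nreg 4 = j
  n5 : s.nreg 5 = (i - 1) * q
  n8 : s.nreg 8 = addr q i j
  q2 : s.qreg 2 = X i j
  q3 : s.qreg 3 = barValue q X i j
  q5 : j < i → s.qreg 5 = lightest X (i - 1) j
  q6 : 3 ≤ j → s.qreg 6 = lightest X (i - 1) (j - 1)
  table : Table p q X i j s

theorem During.of_sameData {i j : ℕ} {s s' : Ram} (h : During p q X i j s) (e : SameData s s') :
    During p q X i j s' := by
  have e0 := e
  obtain ⟨e1, e2, e3, e4⟩ := e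
  exact ⟨h.env.of_sameData e0, by rw [e1 _ (by decide)]; exact h.n3,
    by rw [e1 _ (by decide)]; exact h.n4, by rw [e1 _ (by decide)]; exact h.n5,
    by rw [e1 _ (by decide)]; exact h.n8, by rw [e2]; exact h.q2, by rw [e2]; exact h.q3,
    by rw [e2]; exact h.q5, by rw [e2]; exact h.q6, by
      intro r c h1 h2
      rw [e4]
      exact h.table r c h1 h2⟩

theorem visitLoad_spec {i j : ℕ} {s : Ram} {chk : Prop} (hij : (i, j) ∈ triInds p q)
    (h : Before p q X i j s) (hl : Log p q X chk s) :
    During p q X i j (visitLoad.run s) ∧ Log p q X chk (visitLoad.run s) := by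
  obtain ⟨hi, hip, hj, hjq, hji⟩ := mem_triInds.1 hij
  have ha : (i - 1) * q + j - 1 = addr q i j := by unfold addr; omega
  have ha' : s.nreg 5 + s.nreg 4 - s.nreg 6 = addr q i j := by rw [h.n5, h.n4, h.env.n6, ha]
  constructor
  · constructor
    · constructor
      all_goals simp [visitLoad, block, Prog.run, Instr.eval, h.env.n0, h.env.n1, h.env.n6,
        h.env.n7, h.env.n14, h.env.q0, h.env.q1]
      exact h.env.input
    · simp [visitLoad, block, Prog.run, Instr.eval, h.n3]
    · simp [visitLoad, block, Prog.run, Instr.eval, h.n4]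
    · simp [visitLoad, block, Prog.run, Instr.eval, h.n5]
    · simp [visitLoad, block, Prog.run, Instr.eval, ha']
    · simp [visitLoad, block, Prog.run, Instr.eval, ha', h.env.input i j hij]
    · have := barValue_succ (X := X) hj (le_min hji hjq)
      rw [Nat.sub_add_cancel hj] at this
      simp [visitLoad, block, Prog.run, Instr.eval, ha', h.env.input i j hij, h.q3, this]
    · intro hlt
      simp only [visitLoad, block, Prog.run, Instr.eval]
      simp only [Function.update_apply]
      simp [ha', h.env.n1]
      rw [addr_sub (by omega)]
      exact h.table _ _ (mem_triInds.2 ⟨by omega, by omega, hj, hjq, by omega⟩) (Or.inl (by omega))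
    · intro hj3
      simp only [visitLoad, block, Prog.run, Instr.eval]
      simp only [Function.update_apply]
      simp [h.n5, h.n4, ha, h.env.n1, h.env.n6]
      rw [addr_sub (by omega), addr_sub_one (by omega)]
      exact h.table _ _ (mem_triInds.2 ⟨by omega, by omega, by omega, by omega, by omega⟩)
        (Or.inl (by omega))
    · intro r c h1 h2
      simp [visitLoad, block, Prog.run, Instr.eval, h.table r c h1 h2]
  · refine hl.congr ?_ ?_ ?_ ?_ <;> simp [visitLoad, block, Prog.run, Instr.eval]

theorem recordNonneg_spec {i j : ℕ} {s : Ram} {chk : Prop} (hij : (i, j) ∈ triInds p q)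
    (h : During p q X i j s) (h1 : ¬ (i = j ∧ j < q)) (h2 : X i j < 0) :
    During p q X i j (recordNonneg.run s) ∧ Log p q X chk (recordNonneg.run s) := by
  refine ⟨h.of_sameData (sameData_recordNonneg s), Or.inr (Or.inr (Or.inl ?_))⟩
  have e10 : (recordNonneg.run s).nreg 10 = 2 := by
    simp [recordNonneg, block, Prog.run, Instr.eval]
  have e11 : (recordNonneg.run s).nreg 11 = i := by
    simp [recordNonneg, block, Prog.run, Instr.eval, h.env.n14, h.n3]
  have e12 : (recordNonneg.run s).nreg 12 = j := by
    simp [recordNonneg, block, Prog.run, Instr.eval, h.env.n14, h.n4]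
  rw [e10, e11, e12]
  exact ⟨rfl, hij, h1, h2⟩

theorem visitNonneg_spec {i j : ℕ} {s : Ram} {chk : Prop} (hij : (i, j) ∈ triInds p q)
    (h : During p q X i j s) (hl : Log p q X chk s) :
    During p q X i j (visitNonneg.run s) ∧
      Log p q X (chk ∧ (¬ (i = j ∧ j < q) → 0 ≤ X i j)) (visitNonneg.run s) := by
  obtain ⟨hi, hip, hj, hjq, hji⟩ := mem_triInds.1 hij
  simp only [visitNonneg, Prog.run, Test.IsTrue, h.q2, h.env.q0, h.n3, h.n4, h.env.n1]
  have hskip : ∀ chk', (chk → chk') → During p q X i j (skip.run s) ∧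
      Log p q X chk' (skip.run s) :=
    fun chk' hc => ⟨h.of_sameData (sameData_skip s), hl.skip.imp hc⟩
  split_ifs with h1 h2 h3
  · exact recordNonneg_spec hij h (by omega) h1
  · exact recordNonneg_spec hij h (by omega) h1
  · exact hskip _ fun hc => ⟨hc, fun h4 => (h4 (by omega)).elim⟩
  · exact hskip _ fun hc => ⟨hc, fun _ => not_lt.1 h1⟩

theorem visitSci_spec {i j : ℕ} {s : Ram} {chk : Prop} (hij : (i, j) ∈ triInds p q)
    (h : During p q X i j s) (hl : Log p q X chk s) :
    During p q X i j (visitSci.run s) ∧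
      Log p q X (chk ∧ (3 ≤ j → barValue q X i j ≤ lightest X (i - 1) (j - 1)))
        (visitSci.run s) := by
  have hskip : ∀ chk', (chk → chk') → During p q X i j (skip.run s) ∧
      Log p q X chk' (skip.run s) :=
    fun chk' hc => ⟨h.of_sameData (sameData_skip s), hl.skip.imp hc⟩
  have t1 : (Test.nle 7 4).IsTrue s ↔ 3 ≤ j := by simp only [Test.IsTrue, h.env.n7, h.n4]
  simp only [visitSci, Prog.run]
  by_cases h1 : 3 ≤ j
  swap
  · rw [if_neg fun t => h1 (t1.1 t)]
    exact hskip _ fun hc => ⟨hc, fun h3 => (h1 h3).elim⟩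
  rw [if_pos (t1.2 h1)]
  by_cases h2 : (Test.qlt 6 3).IsTrue s
  · rw [if_pos h2]
    refine ⟨h.of_sameData (sameData_recordSci s), Or.inr (Or.inr (Or.inr ?_))⟩
    have e10 : (recordSci.run s).nreg 10 = 3 := by
      simp [recordSci, block, Prog.run, Instr.eval]
    have e11 : (recordSci.run s).nreg 11 = i := by
      simp [recordSci, block, Prog.run, Instr.eval, h.env.n14, h.n3]
    have e12 : (recordSci.run s).nreg 12 = j := by
      simp [recordSci, block, Prog.run, Instr.eval, h.env.n14, h.n4]
    have e13 : (recordSci.run s).nreg 13 = (i - 1) * q := by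
      simp [recordSci, block, Prog.run, Instr.eval, h.env.n14, h.n5]
    rw [e10, e11, e12, e13]
    rw [Test.IsTrue, h.q6 h1, h.q3] at h2
    exact ⟨rfl, hij, h1, rfl, h2⟩
  · rw [if_neg h2]
    rw [Test.IsTrue, h.q6 h1, h.q3, not_lt] at h2
    exact hskip _ fun hc => ⟨hc, fun _ => h2⟩

theorem visitWeight_spec {i j : ℕ} {s : Ram} {chk : Prop} (hi : 1 ≤ i) (hji : j ≤ i)
    (h : During p q X i j s) (hl : Log p q X chk s) :
    (During p q X i j (visitWeight.run s) ∧ Log p q X chk (visitWeight.run s)) ∧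
      (visitWeight.run s).qreg 4 = lightest X i j := by
  have hD : ∀ v : ℚ, During p q X i j { s with qreg := Function.update s.qreg 4 v } := by
    intro v
    have hne : ∀ a : ℕ, a ≠ 4 → Function.update s.qreg 4 v a = s.qreg a :=
      fun a ha => Function.update_of_ne ha _ _
    exact ⟨⟨h.env.n0, h.env.n1, h.env.n6, h.env.n7, h.env.n14, (hne 0 (by decide)).trans h.env.q0,
      (hne 1 (by decide)).trans h.env.q1, h.env.input⟩, h.n3, h.n4, h.n5, h.n8,
      (hne 2 (by decide)).trans h.q2, (hne 3 (by decide)).trans h.q3,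
      fun hj => (hne 5 (by decide)).trans (h.q5 hj), fun hj => (hne 6 (by decide)).trans (h.q6 hj),
      h.table⟩
  have hL : ∀ v : ℚ, Log p q X chk { s with qreg := Function.update s.qreg 4 v } :=
    fun v => hl.congr rfl rfl rfl rfl
  simp only [visitWeight, Prog.run, Test.IsTrue, Instr.eval, h.n3, h.n4, h.env.n7]
  by_cases h1 : j < i
  · rw [if_pos h1]
    by_cases h2 : 3 ≤ j
    · rw [if_pos h2, lightest_of_three_le h1 h2, ← h.q5 h1, ← h.q6 h2, ← h.q2]
      simp only [Function.update_self, Function.update_of_ne (show (6 : ℕ) ≠ 4 by decide)]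
      split_ifs with h3
      · simp only [Function.update_idem, Function.update_of_ne (show (0 : ℕ) ≠ 4 by decide), h.env.q0, add_zero,
          Function.update_self]
        exact ⟨⟨hD _, hL _⟩, (min_eq_left h3.le).symm⟩
      · refine ⟨⟨(hD _).of_sameData (sameData_skip _), (hL _).skip⟩, ?_⟩
        rw [(sameData_skip _).2.1, min_eq_right (not_lt.1 h3)]
        simp only [Function.update_self]
    · rw [if_neg h2, lightest_of_lt h1 (by omega), ← h.q5 h1, ← h.q2]
      refine ⟨⟨(hD _).of_sameData (sameData_skip _), (hL _).skip⟩, ?_⟩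
      rw [(sameData_skip _).2.1]
      simp only [Function.update_self]
  · rw [if_neg h1, lightest_of_le hi (by omega), ← h.q2]
    refine ⟨⟨hD _, hL _⟩, ?_⟩
    simp only [Function.update_self, h.env.q0, add_zero]

theorem visitStore_spec {i j : ℕ} {s : Ram} {chk : Prop} (hij : (i, j) ∈ triInds p q)
    (h : During p q X i j s) (hl : Log p q X chk s) (hw : s.qreg 4 = lightest X i j) :
    Before p q X i (j - 1) (visitStore.run s) ∧ Log p q X chk (visitStore.run s) := by
  obtain ⟨hi, hip, hj, hjq, hji⟩ := mem_triInds.1 hij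
  constructor
  · constructor
    · constructor
      all_goals simp [visitStore, block, Prog.run, Instr.eval, h.env.n0, h.env.n1, h.env.n6,
        h.env.n7, h.env.n14, h.env.q0, h.env.q1]
      exact h.env.input
    · simp [visitStore, block, Prog.run, Instr.eval, h.n3]
    · simp [visitStore, block, Prog.run, Instr.eval, h.n4, h.env.n6]
    · simp [visitStore, block, Prog.run, Instr.eval, h.n5]
    · rw [Nat.sub_add_cancel hj]
      simp [visitStore, block, Prog.run, Instr.eval, h.q3]
    · intro r c hrc h2
      obtain ⟨a, b, c1, c2, c3⟩ := mem_triInds.1 hrc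
      simp only [visitStore, block, Prog.run, Instr.eval, Function.update_self, h.n8, hw]
      by_cases e : addr q r c = addr q i j
      · obtain ⟨rfl, rfl⟩ := addr_inj hi a hj hjq c1 c2 e
        rw [Function.update_self]
      · rw [Function.update_of_ne e]
        refine h.table r c hrc ?_
        rcases h2 with h2 | ⟨rfl, h2⟩
        · exact Or.inl h2
        · right
          refine ⟨rfl, ?_⟩
          by_contra hcj
          obtain rfl : c = j := by omega
          exact e rfl
  · refine hl.congr ?_ ?_ ?_ ?_ <;> simp [visitStore, block, Prog.run, Instr.eval]

theorem visit_loopFree : visit.LoopFree := by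
  simp [visit, visitLoad, visitNonneg, visitSci, visitWeight, visitStore, recordNonneg, recordSci,
    skip, block, Prog.LoopFree]

theorem visit_spec {i j : ℕ} {s : Ram} {chk : Prop} (hij : (i, j) ∈ triInds p q)
    (h : Before p q X i j s) (hl : Log p q X chk s) :
    Before p q X i (j - 1) (visit.run s) ∧ Log p q X (chk ∧ CellOk q X i j) (visit.run s) := by
  obtain ⟨hi, hip, hj, hjq, hji⟩ := mem_triInds.1 hij
  obtain ⟨h1, l1⟩ := visitLoad_spec hij h hl
  obtain ⟨h2, l2⟩ := visitNonneg_spec hij h1 l1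
  obtain ⟨h3, l3⟩ := visitSci_spec hij h2 l2
  obtain ⟨⟨h4, l4⟩, w4⟩ := visitWeight_spec hi hji h3 l3
  obtain ⟨h5, l5⟩ := visitStore_spec hij h4 l4 w4
  exact ⟨h5, l5.imp fun hc => ⟨hc.1.1, hc.1.2, hc.2⟩⟩

/-- The state before row `i` is processed. -/
structure RowBefore (p q : ℕ) (X : ℕ → ℕ → ℚ) (i : ℕ) (s : Ram) : Prop where
  env : Env p q X s
  n3 : s.nreg 3 = i
  n5 : s.nreg 5 = (i - 1) * q
  table : ∀ r c, (r, c) ∈ triInds p q → r < i → s.qmem 1 (addr q r c) = lightest X r c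
  log : Log p q X (RowsOk p q X i) s

theorem rowStart_spec {i : ℕ} {s : Ram} (h : RowBefore p q X i s) :
    Before p q X i (min i q) (rowStart.run s) ∧ Log p q X (RowsOk p q X i) (rowStart.run s) := by
  have hbar : barValue q X i (min i q + 1) = 0 := by
    rw [barValue, Finset.Icc_eq_empty (by omega), Finset.sum_empty]
  have key : ∀ s', s' = ({ s with
      qreg := Function.update s.qreg 3 0
      nreg := Function.update s.nreg 4 (min i q) } : Ram) →
      Before p q X i (min i q) s' ∧ Log p q X (RowsOk p q X i) s' := by
    rintro _ rfl
    constructor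
    · constructor
      · constructor
        all_goals simp [h.env.n0, h.env.n1, h.env.n6, h.env.n7, h.env.n14, h.env.q0, h.env.q1]
        exact h.env.input
      · simp [h.n3]
      · simp
      · simp [h.n5]
      · simp [hbar]
      · intro r c hrc h2
        have := mem_triInds.1 hrc
        exact h.table r c hrc (by omega)
    · refine h.log.congr ?_ ?_ ?_ ?_ <;> simp
  apply key
  simp only [rowStart, Prog.run, Test.IsTrue, Instr.eval, h.n3, h.env.n1, h.env.n14, add_zero]
  split_ifs with h1
  · rw [min_eq_left h1]
  · rw [min_eq_right (by omega)]

theorem recordRow_spec {i : ℕ} {s : Ram} {chk : Prop} (hi : 1 ≤ i) (hip : i ≤ p)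
    (h : Before p q X i 0 s) (h1 : barValue q X i 1 ≠ 1) :
    Log p q X chk (recordRow.run s) := by
  refine Or.inr (Or.inl ?_)
  have e10 : (recordRow.run s).nreg 10 = 1 := by
    simp [recordRow, block, Prog.run, Instr.eval]
  have e11 : (recordRow.run s).nreg 11 = i := by
    simp [recordRow, block, Prog.run, Instr.eval, h.env.n14, h.n3]
  rw [e10, e11]
  exact ⟨rfl, hi, hip, h1⟩

theorem rowCheck_spec {i : ℕ} {s : Ram} {chk : Prop} (hi : 1 ≤ i) (hip : i ≤ p)
    (h : Before p q X i 0 s) (hl : Log p q X chk s) :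
    SameData s (rowCheck.run s) ∧ Log p q X (chk ∧ barValue q X i 1 = 1) (rowCheck.run s) := by
  simp only [rowCheck, Prog.run, Test.IsTrue, h.q3, h.env.q1, zero_add]
  split_ifs with h1 h2
  · exact ⟨sameData_recordRow s, recordRow_spec hi hip h h1.ne⟩
  · exact ⟨sameData_recordRow s, recordRow_spec hi hip h h2.ne'⟩
  · exact ⟨sameData_skip s, hl.skip.imp fun hc => ⟨hc, le_antisymm (not_lt.1 h2) (not_lt.1 h1)⟩⟩

theorem rowNext_spec {i : ℕ} {s : Ram} (hi : 1 ≤ i) (h : Before p q X i 0 s)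
    (hl : Log p q X (RowsOk p q X (i + 1)) s) : RowBefore p q X (i + 1) (rowNext.run s) := by
  constructor
  · constructor
    all_goals simp [rowNext, block, Prog.run, Instr.eval, h.env.n0, h.env.n1, h.env.n6,
      h.env.n7, h.env.n14, h.env.q0, h.env.q1]
    exact h.env.input
  · simp [rowNext, block, Prog.run, Instr.eval, h.n3, h.env.n6]
  · obtain ⟨i, rfl⟩ := Nat.exists_eq_add_of_le' hi
    simp [rowNext, block, Prog.run, Instr.eval, h.n5, h.env.n1, Nat.succ_mul]
  · intro r c hrc hr
    have := mem_triInds.1 hrc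
    exact h.table r c hrc (by omega)
  · refine hl.congr ?_ ?_ ?_ ?_ <;> simp [rowNext, block, Prog.run, Instr.eval]

theorem sweepRow_spec {i : ℕ} {s : Ram} (hi : 1 ≤ i) (hip : i ≤ p) (h : RowBefore p q X i s) :
    Runs sweepRow s (rowStart.cost + (q * (visit.cost + 1) + 1 + (rowCheck.cost + rowNext.cost)))
      (RowBefore p q X (i + 1)) := by
  have lf1 : rowStart.LoopFree := by simp [rowStart, Prog.LoopFree]
  have lf2 : rowCheck.LoopFree := by
    simp [rowCheck, recordRow, skip, block, Prog.LoopFree]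
  have lf3 : rowNext.LoopFree := by simp [rowNext, block, Prog.LoopFree]
  obtain ⟨h1, l1⟩ := rowStart_spec h
  refine Runs.seq (lf1.runs (Q := fun s => Before p q X i (min i q) s ∧
    Log p q X (RowsOk p q X i) s) ⟨h1, l1⟩) fun s1 hs1 => ?_
  refine Runs.seq (Q := fun s => Before p q X i 0 s ∧
    Log p q X (RowsOk p q X i ∧ ∀ c, (i, c) ∈ triInds p q → CellOk q X i c) s) ?_
    fun s2 hs2 => ?_
  · have hstep : ∀ j s, (j ≤ min i q ∧ Before p q X i j s ∧ Log p q X (RowsOk p q X i ∧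
        ∀ c, (i, c) ∈ triInds p q → j < c → CellOk q X i c) s) → (Test.nle 6 4).IsTrue s →
        ∃ m, j = m + 1 ∧ Runs visit s visit.cost fun s => m ≤ min i q ∧ Before p q X i m s ∧
          Log p q X (RowsOk p q X i ∧
            ∀ c, (i, c) ∈ triInds p q → m < c → CellOk q X i c) s := by
      rintro j s ⟨hj, hb, hl⟩ ht
      simp only [Test.IsTrue, hb.env.n6, hb.n4] at ht
      obtain ⟨j, rfl⟩ := Nat.exists_eq_add_of_le' ht
      obtain ⟨h2, l2⟩ := visit_spec (mem_triInds.2 ⟨hi, hip, ht, by omega, by omega⟩) hb hl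
      refine ⟨j, rfl, visit_loopFree.runs ⟨by omega, h2, l2.imp fun hc => ⟨hc.1.1, ?_⟩⟩⟩
      intro c hc' hlt
      rcases Nat.lt_or_ge (j + 1) c with h3 | h3
      · exact hc.1.2 c hc' h3
      · obtain rfl : c = j + 1 := by omega
        exact hc.2
    have hloop := Runs.loop _ hstep (n := min i q) (s := s1) ⟨le_rfl, hs1.1, hs1.2.imp fun hc =>
      ⟨hc, fun c hc hlt => by have := mem_triInds.1 hc; omega⟩⟩
    have hle : min i q * (visit.cost + 1) + 1 ≤ q * (visit.cost + 1) + 1 :=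
      Nat.add_le_add_right (Nat.mul_le_mul_right _ (min_le_right _ _)) _
    refine (hloop.mono hle).imp ?_
    rintro s' ⟨hn, m, hm, hb, hl⟩
    simp only [Test.IsTrue, hb.env.n6, hb.n4, not_le] at hn
    obtain rfl : m = 0 := by omega
    exact ⟨hb, hl.imp fun hc => ⟨hc.1, fun c hc' => hc.2 c hc' (mem_triInds.1 hc').2.2.1⟩⟩
  · obtain ⟨e, l⟩ := rowCheck_spec hi hip hs2.1 hs2.2
    refine Runs.seq (lf2.runs (Q := fun s => Before p q X i 0 s ∧
      Log p q X (RowsOk p q X (i + 1)) s) ⟨?_, l.imp ?_⟩) fun s3 hs3 => lf3.runs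
        (rowNext_spec hi hs3.1 hs3.2)
    · obtain ⟨e1, e2, e3, e4⟩ := id e
      exact ⟨hs2.1.env.of_sameData e, by rw [e1 _ (by decide)]; exact hs2.1.n3,
        by rw [e1 _ (by decide)]; exact hs2.1.n4, by rw [e1 _ (by decide)]; exact hs2.1.n5,
        by rw [e2]; exact hs2.1.q3, by
          intro r c h1 h2
          rw [e4]
          exact hs2.1.table r c h1 h2⟩
    · rintro ⟨⟨h1, h2⟩, h3⟩ r hr hri
      rcases Nat.lt_or_ge r i with h4 | h4
      · exact h1 r hr h4
      · obtain rfl : r = i := by omega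
        exact ⟨h3, h2⟩

/-- All rows are processed with at most a constant number of steps for every position. -/
theorem sweep_spec {s : Ram} (h : RowBefore p q X 1 s) :
    Runs (.loop (.nle 3 0) sweepRow) s
      (p * (rowStart.cost + (q * (visit.cost + 1) + 1 + (rowCheck.cost + rowNext.cost)) + 1) + 1)
      (RowBefore p q X (p + 1)) := by
  have hstep : ∀ n s, (∃ i, i + n = p + 1 ∧ 1 ≤ i ∧ RowBefore p q X i s) →
      (Test.nle 3 0).IsTrue s → ∃ m, n = m + 1 ∧ Runs sweepRow s
        (rowStart.cost + (q * (visit.cost + 1) + 1 + (rowCheck.cost + rowNext.cost)))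
        fun s => ∃ i, i + m = p + 1 ∧ 1 ≤ i ∧ RowBefore p q X i s := by
    rintro n s ⟨i, h1, h2, h3⟩ ht
    simp only [Test.IsTrue, h3.env.n0, h3.n3] at ht
    exact ⟨n - 1, by omega, (sweepRow_spec h2 ht h3).imp fun s' hs' =>
      ⟨i + 1, by omega, by omega, hs'⟩⟩
  refine (Runs.loop _ hstep (n := p) ⟨1, by omega, le_rfl, h⟩).imp ?_
  rintro s' ⟨hn, m, i, h1, h2, h3⟩
  simp only [Test.IsTrue, h3.env.n0, h3.n3, not_le] at hn
  obtain rfl : i = p + 1 := by omega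
  exact h3

/-! ### Reconstruction of a lightest shifted column -/

/-- The state while a lightest shifted column for the bar with leader `(i, j)` is reconstructed:
the columns with index at least `k` have been found, and the first `k` positions form a lightest
shifted column that ends in row `r` and uses no columns beyond `c`. -/
structure Tracing (p q : ℕ) (X : ℕ → ℕ → ℚ) (i j r k c : ℕ) (s : Ram) : Prop where
  n1 : s.nreg 1 = q
  n6 : s.nreg 6 = 1
  n7 : s.nreg 7 = 3
  n14 : s.nreg 14 = 0
  n2 : s.nreg 2 = i + 1 - j
  n12 : s.nreg 12 = j
  n15 : s.nreg 15 = k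
  n3 : s.nreg 3 = r
  n4 : s.nreg 4 = c
  n5 : s.nreg 5 = (r - 1) * q
  table : ∀ r c, (r, c) ∈ triInds p q → s.qmem 1 (addr q r c) = lightest X r c
  row_eq : r + 1 = c + k
  row_lt : r < i
  two_le : 2 ≤ c
  le_max : c ≤ j - 1
  bounds : ∀ m, k ≤ m → m < i + 1 - j → c ≤ s.nmem 0 m ∧ s.nmem 0 m ≤ j - 1
  mono_succ : ∀ m, k ≤ m → m + 1 < i + 1 - j → s.nmem 0 m ≤ s.nmem 0 (m + 1)
  start_eq : 2 ≤ i + 1 - j → (k = 1 → s.nmem 0 1 = c) ∧ (k = 0 → s.nmem 0 0 = s.nmem 0 1)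
  start_one : i + 1 - j = 1 → c = j - 1 ∧ (k = 0 → s.nmem 0 0 = j - 1)
  weight : (if k = 0 then 0 else lightest X r c) +
      ∑ m ∈ Finset.Ico k (i + 1 - j), X (s.nmem 0 m + m) (s.nmem 0 m) ≤
    lightest X (i - 1) (j - 1)

theorem Tracing.isPath {i j r c : ℕ} {s : Ram} (h : Tracing p q X i j r 0 c s) :
    IsPath (i + 1 - j) (j - 1) (s.nmem 0) :=
  ⟨fun k hk => h.two_le.trans (h.bounds k (Nat.zero_le _) hk).1,
    fun k hk => (h.bounds k (Nat.zero_le _) hk).2, fun k hk => h.mono_succ k (Nat.zero_le _) hk,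
    fun hk => (h.start_eq hk).2 rfl, fun hk => (h.start_one hk).2 rfl⟩

/-- Moving along the diagonal. -/
theorem Tracing.diag {i j r k c : ℕ} {s s' : Ram} (h : Tracing p q X i j r k c s) (hk : 2 ≤ k)
    (hki : k ≤ i + 1 - j) (hc : 3 ≤ c) (hw : lightest X (r - 1) (c - 1) ≤ lightest X r c)
    (hn : ∀ a, a ∉ ({3, 4, 5, 8, 9} : Finset ℕ) → s'.nreg a = s.nreg a)
    (h3 : s'.nreg 3 = r - 1) (h4 : s'.nreg 4 = c - 1) (h5 : s'.nreg 5 = (r - 1 - 1) * q)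
    (hm : s'.nmem = s.nmem) (hq : s'.qmem = s.qmem) : Tracing p q X i j (r - 1) k (c - 1) s' := by
  have h1 := h.row_eq
  have h2 := h.row_lt
  have h6 := h.le_max
  have hkne : k ≠ 0 := by omega
  refine ⟨by rw [hn _ (by decide)]; exact h.n1, by rw [hn _ (by decide)]; exact h.n6,
    by rw [hn _ (by decide)]; exact h.n7, by rw [hn _ (by decide)]; exact h.n14,
    by rw [hn _ (by decide)]; exact h.n2, by rw [hn _ (by decide)]; exact h.n12,
    by rw [hn _ (by decide)]; exact h.n15, h3, h4, h5, by rw [hq]; exact h.table,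
    by omega, by omega, by omega, by omega, ?_, ?_, by omega, by omega, ?_⟩
  · intro m a b
    rw [hm]
    have := h.bounds m a b
    omega
  · rw [hm]
    exact h.mono_succ
  · have := h.weight
    rw [if_neg hkne] at this ⊢
    rw [hm]
    linarith

/-- Using the position `(r, c)`. -/
theorem Tracing.column {i j r k c : ℕ} {s s' : Ram} (h : Tracing p q X i j r (k + 1) c s)
    (hki : k + 1 ≤ i + 1 - j)
    (hw : (if k = 0 then 0 else lightest X (r - 1) c) + X r c ≤ lightest X r c)
    (hn : ∀ a, a ∉ ({3, 5, 8, 9, 15} : Finset ℕ) → s'.nreg a = s.nreg a)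
    (h3 : s'.nreg 3 = r - 1) (h15 : s'.nreg 15 = k) (h5 : s'.nreg 5 = (r - 1 - 1) * q)
    (hm : s'.nmem 0 = Function.update (s.nmem 0) k c) (hq : s'.qmem = s.qmem) :
    Tracing p q X i j (r - 1) k c s' := by
  have h1 := h.row_eq
  have h2 := h.row_lt
  have h6 := h.le_max
  have h7 := h.two_le
  refine ⟨by rw [hn _ (by decide)]; exact h.n1, by rw [hn _ (by decide)]; exact h.n6,
    by rw [hn _ (by decide)]; exact h.n7, by rw [hn _ (by decide)]; exact h.n14,
    by rw [hn _ (by decide)]; exact h.n2, by rw [hn _ (by decide)]; exact h.n12, h15,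
    h3, by rw [hn _ (by decide)]; exact h.n4, h5, by rw [hq]; exact h.table,
    by omega, by omega, h7, h6, ?_, ?_, ?_, ?_, ?_⟩
  · intro m a b
    rw [hm, Function.update_apply]
    split_ifs with e
    · exact ⟨le_rfl, h6⟩
    · exact h.bounds m (by omega) b
  · intro m a b
    rw [hm, Function.update_of_ne (show m + 1 ≠ k by omega), Function.update_apply]
    split_ifs with e
    · exact (h.bounds (m + 1) (by omega) b).1
    · exact h.mono_succ m (by omega) b
  · intro hη
    rw [hm]
    constructor
    · rintro rfl
      rw [Function.update_self]
    · rintro rfl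
      rw [Function.update_self, Function.update_of_ne one_ne_zero]
      exact ((h.start_eq hη).1 rfl).symm
  · intro hη
    refine ⟨(h.start_one hη).1, ?_⟩
    rintro rfl
    rw [hm, Function.update_self]
    exact (h.start_one hη).1
  · have h8 := h.weight
    rw [if_neg (Nat.succ_ne_zero k)] at h8
    rw [hm, Finset.sum_eq_sum_Ico_succ_bot (by omega), Function.update_self]
    have e : ∑ m ∈ Finset.Ico (k + 1) (i + 1 - j), X (Function.update (s.nmem 0) k c m + m)
        (Function.update (s.nmem 0) k c m) =
        ∑ m ∈ Finset.Ico (k + 1) (i + 1 - j), X (s.nmem 0 m + m) (s.nmem 0 m) := by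
      refine Finset.sum_congr rfl fun m hm => ?_
      have := (Finset.mem_Ico.1 hm).1
      rw [Function.update_of_ne (by omega)]
    rw [e, show c + k = r by omega]
    linarith

theorem traceStep_loopFree : traceStep.LoopFree := by
  simp [traceStep, traceLoad, traceChoice, traceNext, traceColumn, block, Prog.LoopFree]

/-- One step of the reconstruction: the recursion for `lightest` tells which move is possible. -/
theorem traceStep_spec {i j r k c : ℕ} {s : Ram} (hij : (i, j) ∈ triInds p q) (hk : 1 ≤ k)
    (hki : k ≤ i + 1 - j) (h : Tracing p q X i j r k c s) :
    ∃ k' c', k' ≤ i + 1 - j ∧ Tracing p q X i j (r - 1) k' c' (traceStep.run s) := by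
  obtain ⟨hi, hip, hj, hjq, hji⟩ := mem_triInds.1 hij
  have h1 := h.row_eq
  have h2 := h.row_lt
  have h3 := h.two_le
  have h4 := h.le_max
  have hr : 2 ≤ r := by omega
  have ha : s.nreg 5 + s.nreg 4 - s.nreg 6 = addr q r c := by
    rw [h.n5, h.n4, h.n6]; unfold addr; omega
  have hbase : (r - 1) * q - q = (r - 1 - 1) * q := by
    rw [Nat.sub_mul (r - 1) 1 q, one_mul]
  have hT1 : s.qmem 1 (addr q r c) = lightest X r c :=
    h.table r c (mem_triInds.2 ⟨by omega, by omega, by omega, by omega, by omega⟩)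
  obtain ⟨k, rfl⟩ := Nat.exists_eq_add_of_le' hk
  set s1 := traceLoad.run s with hs1
  have f4 : s1.qreg 4 = lightest X r c := by
    simp [hs1, traceLoad, block, Prog.run, Instr.eval, ha, hT1]
  have f6 : c < r → 3 ≤ c → s1.qreg 6 = lightest X (r - 1) (c - 1) := by
    intro _ _
    rw [← h.table (r - 1) (c - 1) (mem_triInds.2
      ⟨by omega, by omega, by omega, by omega, by omega⟩), ← addr_sub_one (by omega), ← addr_sub hr]
    rw [h.n6] at ha
    simp [hs1, traceLoad, block, Prog.run, Instr.eval, ha, h.n1, h.n6]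
  have fn : ∀ a, a ≠ 8 → a ≠ 9 → s1.nreg a = s.nreg a := by
    intro a h8 h9
    simp [hs1, traceLoad, block, Prog.run, Instr.eval, h8, h9]
  have fm : s1.nmem = s.nmem := rfl
  have fq : s1.qmem = s.qmem := rfl
  have e1 := fn 1 (by decide) (by decide)
  have e3 := fn 3 (by decide) (by decide)
  have e4 := fn 4 (by decide) (by decide)
  have e5 := fn 5 (by decide) (by decide)
  have e6 := fn 6 (by decide) (by decide)
  have e7 := fn 7 (by decide) (by decide)
  have e15 := fn 15 (by decide) (by decide)
  rw [h.n1] at e1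
  rw [h.n3] at e3
  rw [h.n4] at e4
  rw [h.n5] at e5
  rw [h.n6] at e6
  rw [h.n7] at e7
  rw [h.n15] at e15
  have hcol : (if k = 0 then 0 else lightest X (r - 1) c) + X r c ≤ lightest X r c →
      ∃ k' c', k' ≤ i + 1 - j ∧
        Tracing p q X i j (r - 1) k' c' (traceNext.run (traceColumn.run s1)) := by
    intro hw
    refine ⟨k, c, by omega, h.column hki hw ?_ ?_ ?_ ?_ ?_ ?_⟩
    · intro a ha
      simp only [Finset.mem_insert, Finset.mem_singleton, not_or] at ha
      rw [← fn a ha.2.2.1 ha.2.2.2.1]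
      simp [traceNext, traceColumn, block, Prog.run, Instr.eval, ha]
    · simp [traceNext, traceColumn, block, Prog.run, Instr.eval, e3, e6]
    · simp [traceNext, traceColumn, block, Prog.run, Instr.eval, e15, e6]
    · simp [traceNext, traceColumn, block, Prog.run, Instr.eval, e5, e1, hbase]
    · simp [traceNext, traceColumn, block, Prog.run, Instr.eval, e4, e15, e6, fm]
    · simp [traceNext, traceColumn, block, Prog.run, Instr.eval, fq]
  simp only [traceStep, traceChoice, Prog.run, Test.IsTrue, ← hs1, e3, e4, e7]
  by_cases hcr : c < r
  · have hk0 : k ≠ 0 := by omega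
    rw [if_pos hcr]
    by_cases hc3 : 3 ≤ c
    · rw [if_pos hc3, f4, f6 hcr hc3]
      split_ifs with hle
      · refine ⟨k + 1, c - 1, hki, h.diag (by omega) hki hc3 hle ?_ ?_ ?_ ?_ ?_ ?_⟩
        · intro a ha
          simp only [Finset.mem_insert, Finset.mem_singleton, not_or] at ha
          rw [← fn a ha.2.2.2.1 ha.2.2.2.2]
          simp [traceNext, block, Prog.run, Instr.eval, ha]
        · simp [traceNext, block, Prog.run, Instr.eval, e3, e6]
        · simp [traceNext, block, Prog.run, Instr.eval, e4, e6]
        · simp [traceNext, block, Prog.run, Instr.eval, e5, e1, hbase]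
        · simp [traceNext, block, Prog.run, Instr.eval, fm]
        · simp [traceNext, block, Prog.run, Instr.eval, fq]
      · refine hcol ?_
        rw [if_neg hk0]
        rw [lightest_of_three_le hcr hc3] at hle ⊢
        rcases min_choice (lightest X (r - 1) (c - 1)) (lightest X (r - 1) c + X r c) with e | e
        · rw [e] at hle
          exact absurd le_rfl hle
        · rw [e]
    · rw [if_neg hc3]
      refine hcol ?_
      rw [if_neg hk0, lightest_of_lt hcr (by omega)]
  · rw [if_neg hcr]
    refine hcol ?_
    rw [if_pos (by omega), lightest_of_le (by omega) (by omega), zero_add]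

theorem traceStart_spec {i j : ℕ} {s : Ram} (hij : (i, j) ∈ triInds p q) (hj3 : 3 ≤ j)
    (h : RowBefore p q X (p + 1) s) (h11 : s.nreg 11 = i) (h12 : s.nreg 12 = j)
    (h13 : s.nreg 13 = (i - 1) * q) :
    Tracing p q X i j (i - 1) (i + 1 - j) (j - 1) (traceStart.run s) := by
  obtain ⟨hi, hip, hj, hjq, hji⟩ := mem_triInds.1 hij
  have hbase : (i - 1) * q - q = (i - 1 - 1) * q := by
    rw [Nat.sub_mul (i - 1) 1 q, one_mul]
  refine ⟨?_, ?_, ?_, ?_, ?_, ?_, ?_, ?_, ?_, ?_, ?_, by omega, by omega, by omega, le_rfl,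
    by omega, by omega, by omega, by omega, ?_⟩
  · simp [traceStart, block, Prog.run, Instr.eval, h.env.n1]
  · simp [traceStart, block, Prog.run, Instr.eval, h.env.n6]
  · simp [traceStart, block, Prog.run, Instr.eval, h.env.n7]
  · simp [traceStart, block, Prog.run, Instr.eval, h.env.n14]
  · simp [traceStart, block, Prog.run, Instr.eval, h.env.n14, h.env.n6, h11, h12]
  · simp [traceStart, block, Prog.run, Instr.eval, h12]
  · simp [traceStart, block, Prog.run, Instr.eval, h.env.n6, h11, h12]
  · simp [traceStart, block, Prog.run, Instr.eval, h.env.n6, h11]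
  · simp [traceStart, block, Prog.run, Instr.eval, h.env.n6, h12]
  · simp [traceStart, block, Prog.run, Instr.eval, h.env.n1, h13, hbase]
  · intro r c hrc
    have := mem_triInds.1 hrc
    exact h.table r c hrc (by omega)
  · rw [if_neg (by omega), Finset.Ico_self, Finset.sum_empty, add_zero]

theorem trace_spec {i j : ℕ} {s : Ram} (hij : (i, j) ∈ triInds p q)
    (h : Tracing p q X i j (i - 1) (i + 1 - j) (j - 1) s) :
    Runs (.loop (.nle 6 15) traceStep) s ((i - 1) * (traceStep.cost + 1) + 1)
      fun s' => ∃ r c, Tracing p q X i j r 0 c s' := by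
  have hstep : ∀ r s, (∃ k c, k ≤ i + 1 - j ∧ Tracing p q X i j r k c s) →
      (Test.nle 6 15).IsTrue s → ∃ m, r = m + 1 ∧ Runs traceStep s traceStep.cost
        fun s => ∃ k c, k ≤ i + 1 - j ∧ Tracing p q X i j m k c s := by
    rintro r s ⟨k, c, h1, h2⟩ ht
    simp only [Test.IsTrue, h2.n6, h2.n15] at ht
    have := h2.row_eq
    have := h2.two_le
    exact ⟨r - 1, by omega, traceStep_loopFree.runs (traceStep_spec hij ht h1 h2)⟩
  refine (Runs.loop _ hstep ⟨_, _, le_rfl, h⟩).imp ?_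
  rintro s' ⟨hn, r, k, c, h1, h2⟩
  simp only [Test.IsTrue, h2.n6, h2.n15, not_le] at hn
  obtain rfl : k = 0 := by omega
  exact ⟨r, c, h2⟩

end spec

/-! ### Correctness and running time of the separation program -/

/-- The coordinate `x_ij` of a rational point (`0` if `(i, j)` is not a lower triangular
position). -/
def ratEntry {p q : ℕ} (x : triInds p q → ℚ) (i j : ℕ) : ℚ :=
  if h : (i, j) ∈ triInds p q then x ⟨(i, j), h⟩ else 0

section separation

variable {p q : ℕ} {x : triInds p q → ℚ}

theorem entry_cast (x : triInds p q → ℚ) (i j : ℕ) :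
    entry (fun ij => (x ij : ℝ)) (i, j) = (ratEntry x i j : ℝ) := by
  unfold entry ratEntry
  split_ifs
  · rfl
  · exact Rat.cast_zero.symm

theorem sum_entry_cast (x : triInds p q → ℚ) (i j : ℕ) :
    ∑ m ∈ Finset.Icc j (min i q), entry (fun ij => (x ij : ℝ)) (i, m) =
      (barValue q (ratEntry x) i j : ℝ) := by
  simp only [entry_cast, barValue, Rat.cast_sum]

theorem mem_solutionSet_of_rowsOk (h : RowsOk p q (ratEntry x) (p + 1)) :
    (fun ij => (x ij : ℝ)) ∈ solutionSet p q (system p q) := by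
  refine mem_solutionSet_system.2 ⟨fun i h1 h2 => ?_, fun i j hij hd => ?_,
    fun j η γ h1 h2 h3 h4 h5 => ?_⟩
  · rw [sum_entry_cast, (h i h1 (by omega)).1, Rat.cast_one]
  · have := mem_triInds.1 hij
    rw [entry_cast]
    exact_mod_cast ((h i this.1 (by omega)).2 j hij).1 hd
  · have hmem : (j + η - 1, j) ∈ triInds p q :=
      mem_triInds.2 ⟨by omega, h4, by omega, h3, by omega⟩
    have h6 := ((h (j + η - 1) (by omega) (by omega)).2 j hmem).2 h2
    obtain ⟨e, rfl⟩ := Nat.exists_eq_add_of_le' h1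
    have h7 := lightest_le (X := ratEntry x) e (j - 1) (by omega) h5
    rw [show j - 1 + e = j + (e + 1) - 1 - 1 by omega] at h7
    rw [sum_entry_cast]
    simp only [entry_cast]
    exact_mod_cast h6.trans h7

theorem setup_spec (hq : 1 ≤ q) :
    RowBefore p q (ratEntry x) 1 (setup.run (inputState p q x)) := by
  constructor
  · constructor
    all_goals simp [setup, block, Prog.run, Instr.eval, inputState]
    intro i j hij
    obtain ⟨a, b, c, d, e⟩ := mem_triInds.1 hij
    have h1 : addr q i j / q + 1 = i := by
      rw [addr, mul_comm, Nat.mul_add_div (by omega), Nat.div_eq_of_lt (by omega)]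
      omega
    have h2 : addr q i j % q + 1 = j := by
      rw [addr, mul_comm, Nat.mul_add_mod, Nat.mod_eq_of_lt (by omega)]
      omega
    rw [h1, h2]
    rfl
  · simp [setup, block, Prog.run, Instr.eval]
  · simp [setup, block, Prog.run, Instr.eval, inputState]
  · intro r c hrc hr
    have := mem_triInds.1 hrc
    omega
  · exact Or.inl ⟨by simp [setup, block, Prog.run, Instr.eval, inputState], fun r h1 h2 => by omega⟩

theorem answerPlain_spec {s : Ram} (h : RowBefore p q (ratEntry x) (p + 1) s)
    (hk : s.nreg 10 < 3) :
    CorrectAnswer p q (fun ij => (x ij : ℝ)) (answerPlain.run s).answer := by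
  have e0 : (answerPlain.run s).nreg 0 = s.nreg 10 := by
    simp [answerPlain, block, Prog.run, Instr.eval, h.env.n14]
  have e1 : (answerPlain.run s).nreg 1 = s.nreg 11 := by
    simp [answerPlain, block, Prog.run, Instr.eval, h.env.n14]
  have e2 : (answerPlain.run s).nreg 2 = s.nreg 12 := by
    simp [answerPlain, block, Prog.run, Instr.eval, h.env.n14]
  rw [Ram.answer, e0, e1, e2]
  rcases h.log with ⟨h1, h2⟩ | ⟨h1, h2, h3, h4⟩ | ⟨h1, h2, h3, h4⟩ | ⟨h1, -⟩
  · rw [h1, if_pos rfl]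
    exact mem_solutionSet_of_rowsOk h2
  · rw [h1, if_neg one_ne_zero, if_pos rfl]
    refine ⟨Finset.mem_Icc.2 ⟨h2, h3⟩, ?_⟩
    rw [holds_row, sum_entry_cast]
    exact_mod_cast h4
  · rw [h1, if_neg two_ne_zero, if_neg (by norm_num), if_pos rfl]
    refine ⟨⟨h2, h3⟩, ?_⟩
    rw [Constraint.Holds, entry_cast, not_le]
    exact_mod_cast h4
  · omega

theorem answerSci_spec {i j r c : ℕ} {s : Ram} (hij : (i, j) ∈ triInds p q) (hj3 : 3 ≤ j)
    (hlt : lightest (ratEntry x) (i - 1) (j - 1) < barValue q (ratEntry x) i j)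
    (h : Tracing p q (ratEntry x) i j r 0 c s) :
    CorrectAnswer p q (fun ij => (x ij : ℝ)) (answerSci.run s).answer := by
  obtain ⟨hi, hip, hj, hjq, hji⟩ := mem_triInds.1 hij
  have e0 : (answerSci.run s).nreg 0 = 3 := by
    simp [answerSci, block, Prog.run, Instr.eval]
  have e1 : (answerSci.run s).nreg 1 = j := by
    simp [answerSci, block, Prog.run, Instr.eval, h.n14, h.n12]
  have e2 : (answerSci.run s).nreg 2 = i + 1 - j := by
    simp [answerSci, block, Prog.run, Instr.eval, h.n2]
  have em : (answerSci.run s).nmem = s.nmem := rfl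
  rw [Ram.answer, e0, e1, e2, em, if_neg (by norm_num), if_neg (by norm_num),
    if_neg (by norm_num)]
  refine ⟨listed_sci.2 ⟨by omega, hj3, hjq, by omega, h.isPath⟩, ?_⟩
  rw [holds_sci, show j + (i + 1 - j) - 1 = i by omega, sum_entry_cast, not_le]
  simp only [entry_cast]
  have hw := h.weight
  rw [if_pos rfl, zero_add, ← Finset.range_eq_Ico] at hw
  exact_mod_cast hw.trans_lt hlt

end separation

/-- The factor in the running time of the separation program. -/
def separationConst : ℕ :=
  setup.cost + (rowStart.cost + rowCheck.cost + rowNext.cost + 2 + (visit.cost + 1)) + 1 +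
    (traceStart.cost + ((traceStep.cost + 1) + 1 + answerSci.cost) + answerPlain.cost + 1)

theorem separationProg_solves : SolvesSeparation separationProg separationConst := by
  intro p q hq hqp x
  have lf1 : setup.LoopFree := by simp [setup, block, Prog.LoopFree]
  have lf2 : traceStart.LoopFree := by simp [traceStart, block, Prog.LoopFree]
  have lf3 : answerSci.LoopFree := by simp [answerSci, block, Prog.LoopFree]
  have lf4 : answerPlain.LoopFree := by simp [answerPlain, block, Prog.LoopFree]
  have hrun : Runs separationProg (inputState p q x)
      (setup.cost + ((p * (rowStart.cost + (q * (visit.cost + 1) + 1 +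
        (rowCheck.cost + rowNext.cost)) + 1) + 1) + (traceStart.cost + ((p * (traceStep.cost + 1) + 1)
          + answerSci.cost) + answerPlain.cost + 1)))
      fun s => CorrectAnswer p q (fun ij => (x ij : ℝ)) s.answer := by
    refine Runs.seq (lf1.runs (setup_spec (by omega))) fun s1 h1 => ?_
    refine Runs.seq (sweep_spec h1) fun s2 h2 => ?_
    have t : (Test.nle 7 10).IsTrue s2 ↔ 3 ≤ s2.nreg 10 := by
      simp only [Test.IsTrue, h2.env.n7]
    refine Runs.ite (fun ht => ?_) fun ht => ?_
    · rw [t] at ht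
      rcases h2.log with ⟨h3, -⟩ | ⟨h3, -⟩ | ⟨h3, -⟩ | ⟨-, hij, hj3, h13, hlt⟩
      · omega
      · omega
      · omega
      refine Runs.mono (Runs.seq (lf2.runs (traceStart_spec hij hj3 h2 rfl rfl h13))
        fun s3 h3 => ?_) (Nat.le_add_right _ _)
      refine Runs.seq ((trace_spec hij h3).mono ?_) fun s4 ⟨r, c, h4⟩ =>
        lf3.runs (answerSci_spec hij hj3 hlt h4)
      have := mem_triInds.1 hij
      exact Nat.add_le_add_right (Nat.mul_le_mul_right _ (by omega)) _
    · rw [t, not_le] at ht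
      exact (lf4.runs (answerPlain_spec h2 ht)).mono (Nat.le_add_left _ _)
  obtain ⟨t, s, h1, h2, h3⟩ := hrun
  refine ⟨t, s, h1, h2.trans ?_, h3⟩
  have hN1 : 1 ≤ p * q := Nat.mul_pos (by omega) (by omega)
  have hNp : p ≤ p * q := Nat.le_mul_of_pos_right p (by omega)
  have k1 : ∀ a : ℕ, a ≤ a * (p * q) := fun a => Nat.le_mul_of_pos_right a hN1
  have k2 : ∀ a : ℕ, p * a ≤ a * (p * q) := fun a => by
    rw [mul_comm p a]; exact Nat.mul_le_mul_left a hNp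
  have e1 : p * (rowStart.cost + (q * (visit.cost + 1) + 1 + (rowCheck.cost + rowNext.cost)) + 1) =
      p * (rowStart.cost + rowCheck.cost + rowNext.cost + 2) + (visit.cost + 1) * (p * q) := by
    ring
  have b1 := k1 setup.cost
  have b2 := k2 (rowStart.cost + rowCheck.cost + rowNext.cost + 2)
  have b3 := k1 1
  have b4 := k1 (traceStart.cost + (1 + answerSci.cost) + answerPlain.cost + 1)
  have b5 := k2 (traceStep.cost + 1)
  rw [e1, separationConst]
  calc _ ≤ setup.cost * (p * q) + (((rowStart.cost + rowCheck.cost + rowNext.cost + 2) * (p * q) +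
        (visit.cost + 1) * (p * q)) + 1 * (p * q) + ((traceStep.cost + 1) * (p * q) +
        (traceStart.cost + (1 + answerSci.cost) + answerPlain.cost + 1) * (p * q))) := by omega
    _ = _ := by ring

end Orbitope

theorem mainTheorem1 :
    (∀ p q : ℕ, 2 ≤ q → q ≤ p →
      -- matrices in the orbitope vanish above the diagonal
      (∀ A ∈ Orbitope.orbipart p q ⊤, ∀ (i : Orbitope.Ints p) (j : Orbitope.Ints q), (i : ℕ) < (j : ℕ) → A i j = 0) ∧
      -- the system describes the orbitope in the lower triangular coordinates
      Orbitope.orbipartTri p q = Orbitope.solutionSet p q (Orbitope.system p q) ∧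
      -- the system is non-redundant: no equation or inequality can be dropped
      (∀ l ∈ Orbitope.system p q,
        Orbitope.solutionSet p q (Orbitope.system p q) ⊂
          Orbitope.solutionSet p q (Orbitope.system p q \ {l})) ∧
      -- every inequality of the system defines a facet
      (∀ l ∈ Orbitope.system p q, l.IsIneq →
        Orbitope.DefinesFacet (Orbitope.orbipartTri p q) l)) ∧
    -- the separation problem is solved by one program in `O(p q)` steps
    (∃ (P : Orbitope.Prog) (C : ℕ), Orbitope.SolvesSeparation P C) := by
  refine ⟨fun p q hq hqp => ?_, _, _, Orbitope.separationProg_solves⟩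
  have h : Orbitope.orbipartTri p q = Orbitope.solutionSet p q (Orbitope.system p q) :=
    (Orbitope.orbipartTri_subset p q).antisymm (Orbitope.solutionSet_subset (by omega) hqp)
  refine ⟨fun A hA i j hij => Orbitope.apply_eq_zero_of_mem_orbipart hA i j hij, h,
    fun l hl => Orbitope.solutionSet_ssubset hq hl, fun l hl hi => ?_⟩
  rw [h]
  exact Orbitope.definesFacet_of_listed hq hl hi
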